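/- For a finite field $\mathbb F_q$ of characteristic $p$ and an integer $d\ge 1$, let $S_d^{\rm ns}$ be the (finite, nonempty) set of homogeneous polynomials $F\in\mathbb F_q[X,Y,Z]$ of degree $d$ for which the projective plane curve $C_F: F=0$ is smooth, i.e. $F$ and its three partial derivatives have no common zero in $\mathbb P^2(\overline{\mathbb F}_q)$. For an integer $k\ge 1$ put $$M_k(q,d)=\frac{1}{\#S_d^{\rm ns}}\sum_{F\in S_d^{\rm ns}}\left(\frac{\#C_F(\mathbb F_q)-(q+1)}{\sqrt{q+1}}\right)^k,\qquad E_k(q)=\mathbb E\left(\left(\frac{1}{\sqrt{q+1}}\left(\sum_{i=1}^{q^2+q+1}X_i-(q+1)\right)\right)^k\right),$$ where $X_1,\dots,X_{q^2+q+1}$ are i.i.d. random variables taking the value $1$ with probability $\frac{q+1}{q^2+q+1}$ and the value $0$ with probability $\frac{q^2}{q^2+q+1}$, and put $$\varepsilon_k(q,d)=q^{\min(k,q^2+q+1)}\left(q^{-k}d^{-1/3}+(d-1)^2q^{-\min\left(\lfloor d/p\rfloor+1,\,d/3\right)}+d\,q^{-\lfloor (d-1)/p\rfloor-1}\right).$$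 Then, for every integer $k\ge 1$, there is a constant $C_k$, depending only on $k$, such that the following holds for all prime powers $q$ and all integers $d\ge 1$. If $k\ge 2$, then $M_k(q,d)=E_k(q)\,(1+\delta)$ for some real $\delta$ with $|\delta|\le C_k\,\varepsilon_k(q,d)$. If $k=1$ (where $E_1(q)=0$), then $|M_1(q,d)-E_1(q)|\le C_1\,\varepsilon_1(q,d)$. -/

import Mathlib

open MvPolynomial MeasureTheory ProbabilityTheory
open scoped LinearAlgebra.Projectivization

namespace PlaneCurves

section Field

variable {K : Type*} [Field K]

/-- The projective plane curve `F = 0` is smooth: over the algebraic closure, `F` and its three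
partial derivatives have no common zero other than the origin. (For a form `F` over a perfect
field this says that the scheme `F = 0` is smooth of dimension `1`; it excludes `F = 0`.) -/
def IsSmoothForm (F : MvPolynomial (Fin 3) K) : Prop :=
  ∀ v : Fin 3 → AlgebraicClosure K, v ≠ 0 →
    ¬ (aeval v F = 0 ∧ ∀ i, aeval v (pderiv i F) = 0)

/-- The `K`-rational points of the plane curve `F = 0`, as a subset of the projective plane. -/
def rationalPoints (F : MvPolynomial (Fin 3) K) : Set (ℙ K (Fin 3 → K)) :=
  {P | eval P.rep F = 0}

/-- For a form, vanishing at a point does not depend on the choice of coordinates. -/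
theorem mk_mem_rationalPoints {F : MvPolynomial (Fin 3) K} {d : ℕ} (hF : F.IsHomogeneous d)
    (v : Fin 3 → K) (hv : v ≠ 0) :
    Projectivization.mk K v hv ∈ rationalPoints F ↔ eval v F = 0 := by
  obtain ⟨a, ha⟩ := Projectivization.exists_smul_eq_mk_rep K v hv
  have h : eval (a • v) F = (a : K) ^ d * eval v F := by
    rw [eval_eq, eval_eq, Finset.mul_sum]
    refine Finset.sum_congr rfl fun m hm => ?_
    have hdeg : m.degree = d := by
      rw [Finsupp.degree_eq_weight_one]
      exact hF (mem_support_iff.mp hm)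
    have hs : ∏ i ∈ m.support, (a • v) i ^ m i = (a : K) ^ d * ∏ i ∈ m.support, v i ^ m i := by
      rw [← hdeg, Finsupp.degree_apply, ← Finset.prod_pow_eq_pow_sum, ← Finset.prod_mul_distrib]
      exact Finset.prod_congr rfl fun i _ => by
        rw [Pi.smul_apply, Units.smul_def, smul_eq_mul, mul_pow]
    rw [hs]
    ring
  rw [rationalPoints, Set.mem_ofPred_eq, ← ha, h]
  simp

/-- The number of `K`-rational points of the plane curve `F = 0`. -/
noncomputable def pointCount (F : MvPolynomial (Fin 3) K) : ℕ :=
  (rationalPoints F).ncard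

/-- The forms of degree `d` in three variables over `K` that define smooth plane curves. -/
def smoothFormSet (K : Type*) [Field K] (d : ℕ) : Set (MvPolynomial (Fin 3) K) :=
  {F | F.IsHomogeneous d ∧ IsSmoothForm F}

end Field

section FiniteField

variable (K : Type*) [Field K] [Fintype K]

theorem finite_smoothFormSet (d : ℕ) : (smoothFormSet K d).Finite := by
  have := Module.Finite.iff_fg.mpr (homogeneousSubmodule_fg (σ := Fin 3) (R := K) d)
  have h : Finite (homogeneousSubmodule (Fin 3) K d) := Module.finite_of_finite K
  exact Set.Finite.subset (Set.toFinite (homogeneousSubmodule (Fin 3) K d :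
    Set (MvPolynomial (Fin 3) K))) fun F hF => hF.1

/-- The finite set of the forms of degree `d` over `K` that define smooth plane curves. -/
noncomputable def smoothForms (d : ℕ) : Finset (MvPolynomial (Fin 3) K) :=
  (finite_smoothFormSet K d).toFinset

/-- There are smooth plane curves of every positive degree over every finite field, so averages
over them make sense. -/
theorem smoothForms_nonempty (d : ℕ) (hd : 1 ≤ d) : (smoothForms K d).Nonempty := by
  obtain ⟨n, rfl⟩ : ∃ n, d = n + 1 := ⟨d - 1, by omega⟩
  suffices h : ∃ F, F ∈ smoothFormSet K (n + 1) by
    obtain ⟨F, hF⟩ := h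
    exact ⟨F, by simpa [smoothForms] using hF⟩
  by_cases hc : ((n + 1 : ℕ) : AlgebraicClosure K) = 0
  · have hn : n ≠ 0 := by
      rintro rfl
      simp at hc
    refine ⟨X 0 ^ (n + 1) + X 0 * X 1 ^ n + X 1 * X 2 ^ n, ?_, ?_⟩
    · refine ((isHomogeneous_X_pow _ _).add ?_).add ?_
      · have := (isHomogeneous_X K (0 : Fin 3)).mul (isHomogeneous_X_pow (R := K) (1 : Fin 3) n)
        rwa [add_comm] at this
      · have := (isHomogeneous_X K (1 : Fin 3)).mul (isHomogeneous_X_pow (R := K) (2 : Fin 3) n)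
        rwa [add_comm] at this
    · rintro v hv ⟨h0, hd⟩
      have d0 := hd 0
      have d1 := hd 1
      push_cast at hc
      simp [pderiv_X, Derivation.leibniz_pow, hc] at h0 d0 d1
      have h1 : v 1 = 0 := by simpa [hn] using d0
      have h00 : v 0 = 0 := by simpa [hn, h1] using h0
      have h2 : v 2 = 0 := by simpa [hn, h1, h00] using d1
      exact hv (funext fun i => by fin_cases i <;> assumption)
  · refine ⟨X 0 ^ (n + 1) + X 1 ^ (n + 1) + X 2 ^ (n + 1), ?_, ?_⟩
    · exact ((isHomogeneous_X_pow _ _).add (isHomogeneous_X_pow _ _)).add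
        (isHomogeneous_X_pow _ _)
    · rintro v hv ⟨-, hd⟩
      push_cast at hc
      refine hv (funext fun i => ?_)
      have := hd i
      fin_cases i <;> simp [pderiv_X, Derivation.leibniz_pow, hc] at this <;> simp [this]

/-- The `k`-th moment of the normalized number of points `(#C_F(K) - (q + 1)) / √(q + 1)`, where
`q = #K`, over the smooth plane curves of degree `d`. -/
noncomputable def smoothMoment (k d : ℕ) : ℝ :=
  ((smoothForms K d).card : ℝ)⁻¹ * ∑ F ∈ smoothForms K d,
    (((pointCount F : ℝ) - ((Fintype.card K : ℝ) + 1)) / √((Fintype.card K : ℝ) + 1)) ^ k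

end FiniteField

/-- The random variables `X i` are measurable, independent and identically distributed, each
taking the value `1` with probability `(q + 1) / (q ^ 2 + q + 1)` and the value `0` with
probability `q ^ 2 / (q ^ 2 + q + 1)`. -/
structure IsPointModel (q : ℕ) {Ω : Type*} [MeasurableSpace Ω] (μ : Measure Ω)
    (X : Fin (q ^ 2 + q + 1) → Ω → ℝ) : Prop where
  measurable : ∀ i, Measurable (X i)
  indep : iIndepFun X μ
  prob_one : ∀ i, μ.real {ω | X i ω = 1} = ((q : ℝ) + 1) / ((q : ℝ) ^ 2 + q + 1)
  prob_zero : ∀ i, μ.real {ω | X i ω = 0} = (q : ℝ) ^ 2 / ((q : ℝ) ^ 2 + q + 1)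

/-- The error term
`q ^ min(k, q² + q + 1) * (q ^ (-k) * d ^ (-1/3) + (d - 1)² * q ^ (-min(⌊d/p⌋ + 1, d/3))
  + d * q ^ (-⌊(d-1)/p⌋ - 1))`,
for `d ≥ 1` (the divisions `d / p` and `(d - 1) / p` below are divisions of natural numbers, that
is, rounded down). -/
noncomputable def errorTerm (k q p d : ℕ) : ℝ :=
  (q : ℝ) ^ min k (q ^ 2 + q + 1) *
    ((q : ℝ) ^ (-(k : ℝ)) * (d : ℝ) ^ (-(1 / 3) : ℝ)
      + ((d : ℝ) - 1) ^ 2 * (q : ℝ) ^ (-min (((d / p : ℕ) : ℝ) + 1) ((d : ℝ) / 3))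
      + (d : ℝ) * (q : ℝ) ^ (-(((d - 1) / p : ℕ) : ℝ) - 1))

end PlaneCurves

set_option linter.unusedSectionVars false

namespace PlaneCurves

/-! ### Forms of degree d and their monomials -/

section Forms

variable (K : Type*) [Field K] [Fintype K]

/-! Put q = #K and let x be the error term. Everything is a probability for a uniformly random form
of degree d, zero included; up to the power of √(q + 1), the moment over smooth curves is the
quotient `smoothAvg` / `smoothProb`. The central estimate is `exists_abs_sub_le`: |smoothAvg -
modelMoment · smoothProb| ≤ C x q^⌊k/2⌋ smoothProb. For k ≥ 2 the central moment of the binomial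
model is at least c q^⌊k/2⌋ (`exists_le_modelMoment`), so division gives a relative error; for k = 1
the power of q is 1 and the absolute bound results.

The model comes from a sieve over closed points, after Poonen. Vanishing at rational points and
singularity at closed points are independent conditions once d is large against the number of
geometric points involved (`card_vanish_singOn`). Inclusion-exclusion over closed points of degree
at most r, of size log d + 2k, truncated after r terms, shows that vanishing on a set Z of rational
points with no singularity of degree at most r has probability close to an Euler product times
rho^|Z|. Here rho = (q² - 1)/(q³ - 1) is the proportion of jets with value zero among the nonzero
1-jets at a rational point (`abs_prob_low_sub_le`). Sums over the sets Z of size j ≤ k are factorial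
moments of the point count, and these control its k-th moment (`abs_sub_binE_le`).

Singular points of degree between r and d/2 are rare by a union bound (`prob_medium_le`). For higher
degrees F is replaced by F + H^p X_c^(d - pD), which leaves two partial derivatives unchanged. They
are usually coprime, and then a weak Bézout theorem leaves few orbits of possible singular points,
at each of which a random H seldom makes the form vanish (`prob_singAt_le`). If b is the probability
of a singular point of degree above r, then q b = O(x²). Cauchy-Schwarz against the 2k-th moment
over all forms bounds the contribution of these forms by a multiple of x q^⌊k/2⌋, even for odd k,
because of the factor q.

It remains to bound `smoothProb` from below. The Euler product is at least e^(-4), which suffices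
for large d unless d is not small against q^(⌊d/p⌋+1). In that case either q and d are bounded, or q
is a prime larger than d (`exists_bound_of_le_mul`). When q and d are bounded, so is the error term
from below, and trivial bounds do. In the prime case the error term exceeds a multiple of q^(k+1),
and it is enough that smooth forms have probability at least 1/q, a union bound with careful
constants (`inv_card_le_prob_smooth`). Bounded d with q arbitrary is treated apart
(`exists_abs_sub_le_of_degree_lt`). -/

theorem finite_homogeneous (d : ℕ) : {F : MvPolynomial (Fin 3) K | F.IsHomogeneous d}.Finite := by
  have := Module.Finite.iff_fg.mpr (homogeneousSubmodule_fg (σ := Fin 3) (R := K) d)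
  have h : Finite (homogeneousSubmodule (Fin 3) K d) := Module.finite_of_finite K
  exact Set.toFinite (homogeneousSubmodule (Fin 3) K d : Set (MvPolynomial (Fin 3) K))

/-- The finite set of all ternary forms of degree `d`, including `0`. -/
noncomputable def forms (d : ℕ) : Finset (MvPolynomial (Fin 3) K) :=
  (finite_homogeneous K d).toFinset

variable {K}

@[simp]
theorem mem_forms {d : ℕ} {F : MvPolynomial (Fin 3) K} : F ∈ forms K d ↔ F.IsHomogeneous d := by
  simp [forms]

end Forms

/-- The exponents of the ternary monomials of degree `d`. -/
def exps (d : ℕ) : Finset (Fin 3 →₀ ℕ) := (Finset.univ : Finset (Fin 3)).finsuppAntidiag d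

theorem mem_exps {d : ℕ} {m : Fin 3 →₀ ℕ} : m ∈ exps d ↔ m.degree = d := by
  simp [exps, Finset.mem_finsuppAntidiag, Finsupp.degree_eq_sum]

theorem card_exps (d : ℕ) : (exps d).card = (d + 2).choose 2 := by
  rw [exps, Finset.card_finsuppAntidiag_nat_eq_choose]
  simp only [Finset.card_univ, Fintype.card_fin]
  rw [show 3 + d - 1 = d + 2 by omega, Nat.choose_symm_add]

theorem coeff_eq_zero_of_notMem_exps {R : Type*} [CommSemiring R] {d : ℕ}
    {F : MvPolynomial (Fin 3) R} (hF : F.IsHomogeneous d) {m : Fin 3 →₀ ℕ} (hm : m ∉ exps d) :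
    coeff m F = 0 :=
  hF.coeff_eq_zero fun h => hm (mem_exps.2 h)

theorem eq_sum_exps {R : Type*} [CommSemiring R] {d : ℕ}
    {F : MvPolynomial (Fin 3) R} (hF : F.IsHomogeneous d) :
    F = ∑ m : exps d, monomial m.1 (coeff m.1 F) := by
  classical
  ext m
  rw [coeff_sum]
  by_cases hm : m ∈ exps d
  · rw [Finset.sum_eq_single ⟨m, hm⟩]
    · simp
    · intro b _ hb
      rw [coeff_monomial, if_neg]
      exact fun h => hb (Subtype.ext h)
    · simp
  · rw [coeff_eq_zero_of_notMem_exps hF hm]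
    refine (Finset.sum_eq_zero fun b _ => ?_).symm
    rw [coeff_monomial, if_neg]
    rintro rfl
    exact hm b.2

theorem isHomogeneous_sum_exps {R : Type*} [CommSemiring R] {d : ℕ} (c : exps d → R) :
    (∑ m : exps d, monomial m.1 (c m)).IsHomogeneous d :=
  IsHomogeneous.sum _ _ _ fun m _ => isHomogeneous_monomial _ (mem_exps.1 m.2)

/-! ### Counting forms over K under linear conditions over an extension -/

section Forms

variable {K : Type*} [Field K] [Fintype K]

theorem card_forms (d : ℕ) :
    (forms K d).card = Fintype.card K ^ ((d + 2).choose 2) := by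
  classical
  have h : (forms K d).card = (Finset.univ : Finset (exps d → K)).card := by
    refine Finset.card_bij (fun F _ m => coeff m.1 F) (fun _ _ => Finset.mem_univ _) ?_ ?_
    · intro F hF G hG h
      rw [eq_sum_exps (mem_forms.1 hF), eq_sum_exps (mem_forms.1 hG)]
      exact Finset.sum_congr rfl fun m _ => by rw [congr_fun h m]
    · intro c _
      refine ⟨∑ m : exps d, monomial m.1 (c m), mem_forms.2 (isHomogeneous_sum_exps c), ?_⟩
      funext m
      rw [coeff_sum, Finset.sum_eq_single m]
      · simp
      · intro b _ hb
        rw [coeff_monomial, if_neg]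
        exact fun h => hb (Subtype.ext h)
      · simp
  rw [h]
  simp [card_exps]

theorem card_forms_pos (d : ℕ) : 0 < (forms K d).card :=
  Finset.card_pos.2 ⟨0, mem_forms.2 (isHomogeneous_zero _ _ _)⟩

open Classical in
/-- If a linear map on ternary forms over an extension `L` of `K` maps the forms of degree `d`
onto `W`, then the forms over `K` in its kernel have codimension at least `dim W`. -/
theorem card_ker_mul_le {L : Type*} [Field L] [Algebra K L] {W : Type*} [AddCommGroup W]
    [Module L W] {d : ℕ} (ψ : MvPolynomial (Fin 3) L →ₗ[L] W)
    (hψ : ∀ w, ∃ G : MvPolynomial (Fin 3) L, G.IsHomogeneous d ∧ ψ G = w) :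
    {F ∈ forms K d | ψ (map (algebraMap K L) F) = 0}.card *
      Fintype.card K ^ Module.finrank L W ≤ (forms K d).card := by
  set w : exps d → W := fun m => ψ (monomial m.1 1) with hw
  have key : ∀ G : MvPolynomial (Fin 3) L, G.IsHomogeneous d →
      ψ G = ∑ m : exps d, coeff m.1 G • w m := by
    intro G hG
    conv_lhs => rw [eq_sum_exps hG]
    rw [map_sum]
    refine Finset.sum_congr rfl fun m _ => ?_
    rw [hw, ← map_smul, smul_monomial, smul_eq_mul, mul_one]
  have hspan : Submodule.span L (Set.range w) = ⊤ := by
    rw [eq_top_iff]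
    rintro x -
    obtain ⟨G, hG, rfl⟩ := hψ x
    rw [key G hG]
    exact Submodule.sum_mem _ fun m _ =>
      Submodule.smul_mem _ _ (Submodule.subset_span ⟨m, rfl⟩)
  -- A basis of W among the images of the monomials. A form over K in the kernel is determined by
  -- its coefficients at the other monomials, so no descent from L to K is needed.
  obtain ⟨κ, a, ha, hsp, hli⟩ := exists_linearIndependent' L w
  have : Finite κ := Finite.of_injective a ha
  have := Fintype.ofFinite κ
  have hfr : Module.finrank L W = Fintype.card κ :=
    Module.finrank_eq_card_basis (Module.Basis.mk hli (by rw [hsp, hspan]))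
  have hcard : Fintype.card {m : exps d // m ∉ Set.range a} + Fintype.card κ
      = (exps d).card := by
    have h1 := Fintype.card_subtype_compl (fun m : exps d => m ∈ Set.range a)
    have h2 : Fintype.card {m : exps d // m ∈ Set.range a} = Fintype.card κ :=
      (Fintype.card_congr (Equiv.ofInjective a ha)).symm
    have h3 := Fintype.card_subtype_le (fun m : exps d => m ∈ Set.range a)
    rw [Fintype.card_coe] at h1 h3
    omega
  have hle : {F ∈ forms K d | ψ (map (algebraMap K L) F) = 0}.card ≤
      (Finset.univ : Finset ({m : exps d // m ∉ Set.range a} → K)).card := by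
    refine Finset.card_le_card_of_injOn (fun F m => coeff m.1.1 F) (fun _ _ => by simp) ?_
    intro F hF G hG h
    simp only [Finset.coe_filter, mem_forms, Set.mem_ofPred_eq] at hF hG
    have hz : ∑ m : exps d, coeff m.1 (map (algebraMap K L) (F - G)) • w m = 0 := by
      rw [← key _ ((hF.1.sub hG.1).map _), map_sub, map_sub, hF.2, hG.2, sub_zero]
    have hz' : ∑ i : κ, coeff (a i).1 (map (algebraMap K L) (F - G)) • w (a i) = 0 := by
      rw [← hz]
      have : ∑ m ∈ Finset.univ.map ⟨a, ha⟩, coeff m.1 (map (algebraMap K L) (F - G)) • w m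
          = ∑ m : exps d, coeff m.1 (map (algebraMap K L) (F - G)) • w m := by
        refine Finset.sum_subset (Finset.subset_univ _) fun m _ hm => ?_
        have hm' : m ∉ Set.range a := by simpa using hm
        have := congr_fun h ⟨m, hm'⟩
        simp only at this
        rw [coeff_map, coeff_sub, this, sub_self, map_zero, zero_smul]
      rw [← this, Finset.sum_map]
      rfl
    have hzero := Fintype.linearIndependent_iff.1 hli _ hz'
    rw [← sub_eq_zero, eq_sum_exps (hF.1.sub hG.1)]
    refine Finset.sum_eq_zero fun m _ => ?_
    by_cases hm : m ∈ Set.range a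
    · obtain ⟨i, rfl⟩ := hm
      have := hzero i
      rw [coeff_map, map_eq_zero] at this
      rw [this, map_zero]
    · have := congr_fun h ⟨m, hm⟩
      simp only at this
      rw [coeff_sub, this, sub_self, map_zero]
  calc _ ≤ (Finset.univ : Finset ({m : exps d // m ∉ Set.range a} → K)).card *
        Fintype.card K ^ Module.finrank L W := Nat.mul_le_mul_right _ hle
    _ = (forms K d).card := by
      rw [card_forms, ← card_exps, ← hcard, hfr, pow_add]
      simp

end Forms

/-! ### Interpolation by products of linear forms -/

section Interpolation

variable {L : Type*} [Field L]

/-- `F` and all its partial derivatives vanish at `v`. -/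
def SingAt {K : Type*} [Field K] [Algebra K L] (F : MvPolynomial (Fin 3) K) (v : Fin 3 → L) :
    Prop :=
  aeval v F = 0 ∧ ∀ i, aeval v (pderiv i F) = 0

/-- No two distinct vectors of the set are proportional, and none of them vanishes. -/
def Nonprop (S : Set (Fin 3 → L)) : Prop :=
  ∀ v ∈ S, v ≠ 0 ∧ ∀ w ∈ S, v ≠ w → ∀ t : L, v ≠ t • w

theorem Nonprop.mono {S T : Set (Fin 3 → L)} (h : Nonprop T) (hST : S ⊆ T) : Nonprop S :=
  fun v hv => ⟨(h v (hST hv)).1, fun w hw => (h v (hST hv)).2 w (hST hw)⟩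

/-- A linear form that vanishes at `w` but not at `v`. -/
theorem exists_linear_form {v w : Fin 3 → L} (h : ∀ t : L, v ≠ t • w) :
    ∃ ℓ : MvPolynomial (Fin 3) L, ℓ.IsHomogeneous 1 ∧ eval w ℓ = 0 ∧ eval v ℓ ≠ 0 := by
  by_cases hw : w = 0
  · subst hw
    have hv : v ≠ 0 := by simpa using h 0
    obtain ⟨i, hi⟩ := Function.ne_iff.1 hv
    exact ⟨X i, isHomogeneous_X _ _, by simp, by simpa using hi⟩
  obtain ⟨i, hi⟩ := Function.ne_iff.1 hw
  obtain ⟨j, hj⟩ := Function.ne_iff.1 (h (v i / w i))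
  simp only [Pi.zero_apply, Pi.smul_apply, smul_eq_mul] at hi hj
  refine ⟨C (w i) * X j - C (w j) * X i, ?_, ?_, ?_⟩
  · exact (isHomogeneous_C_mul_X _ _).sub (isHomogeneous_C_mul_X _ _)
  · simp [mul_comm]
  · simp only [map_sub, map_mul, eval_C, eval_X]
    intro h0
    apply hj
    field_simp
    linear_combination h0

/-- A form with prescribed value and partial derivatives in two directions at a point. -/
theorem exists_form_jet {v : Fin 3 → L} {i : Fin 3} (hv : v i ≠ 0) (m : ℕ) (a : L)
    (b : Fin 3 → L) :
    ∃ Q : MvPolynomial (Fin 3) L, Q.IsHomogeneous (m + 1) ∧ eval v Q = a ∧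
      ∀ j, j ≠ i → eval v (pderiv j Q) = b j := by
  classical
  -- A linear form suffices: the factor `X i ^ m` that raises the degree is constant in the
  -- directions j ≠ i, and its value at v is divided out in the coefficients. The terms X j - (v j /
  -- v i) X i vanish at v, so they adjust the derivatives without changing the value.
  set R : MvPolynomial (Fin 3) L := C (a / v i ^ (m + 1)) * X i +
    ∑ j ∈ Finset.univ.erase i, C (b j / v i ^ m) * (X j - C (v j / v i) * X i) with hR
  have hR1 : R.IsHomogeneous 1 := by
    refine (isHomogeneous_C_mul_X _ _).add (IsHomogeneous.sum _ _ _ fun j _ => ?_)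
    exact ((isHomogeneous_X _ _).sub (isHomogeneous_C_mul_X _ _)).C_mul _
  have hRv : eval v R = a / v i ^ m := by
    rw [hR, map_add, map_sum]
    rw [Finset.sum_eq_zero]
    · simp only [map_mul, eval_C, eval_X, add_zero]
      rw [pow_succ]
      field_simp
    · intro j _
      simp only [map_mul, map_sub, eval_C, eval_X]
      field_simp
      ring
  have hRd : ∀ j, j ≠ i → eval v (pderiv j R) = b j / v i ^ m := by
    intro j hj
    rw [hR, map_add, map_sum, map_add, map_sum, Finset.sum_eq_single j]
    · simp [pderiv_X, hj.symm]
    · intro k _ hk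
      simp [pderiv_X, hj.symm, hk]
    · intro h
      simp [hj] at h
  refine ⟨X i ^ m * R, ?_, ?_, ?_⟩
  · simpa [add_comm] using (isHomogeneous_X_pow i m).mul hR1
  · simp only [map_mul, map_pow, eval_X, hRv]
    exact mul_div_cancel₀ _ (pow_ne_zero _ hv)
  · intro j hj
    rw [Derivation.leibniz]
    simp only [smul_eq_mul, map_add, map_mul, map_pow, eval_X, hRd j hj]
    rw [Derivation.leibniz_pow]
    simp [pderiv_X, hj.symm]
    field_simp

/-- A form that is singular on `S₁`, vanishes on `S₀`, and does not vanish at a further point. -/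
theorem exists_form_separating (S₀ S₁ : Finset (Fin 3 → L)) (v : Fin 3 → L)
    (h₀ : ∀ w ∈ S₀, ∀ t : L, v ≠ t • w) (h₁ : ∀ w ∈ S₁, ∀ t : L, v ≠ t • w) :
    ∃ P : MvPolynomial (Fin 3) L, P.IsHomogeneous (S₀.card + 2 * S₁.card) ∧ eval v P ≠ 0 ∧
      (∀ w ∈ S₀, eval w P = 0) ∧ ∀ w ∈ S₁, SingAt P w := by
  classical
  choose! ℓ hℓ1 hℓ2 hℓ3 using fun w (h : ∀ t : L, v ≠ t • w) => exists_linear_form h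
  -- A line through each point of S₀ and a double line through each point of S₁, all avoiding v.
  refine ⟨(∏ w ∈ S₀, ℓ w) * ∏ w ∈ S₁, ℓ w ^ 2, ?_, ?_, ?_, ?_⟩
  · refine IsHomogeneous.mul ?_ ?_
    · simpa using IsHomogeneous.prod S₀ ℓ (fun _ => 1) fun w hw => hℓ1 w (h₀ w hw)
    · have := IsHomogeneous.prod S₁ (fun w => ℓ w ^ 2) (fun _ => 2)
        fun w hw => by simpa using (hℓ1 w (h₁ w hw)).pow 2
      simpa [mul_comm] using this
  · rw [map_mul, map_prod, map_prod]
    refine mul_ne_zero (Finset.prod_ne_zero_iff.2 fun w hw => hℓ3 w (h₀ w hw))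
      (Finset.prod_ne_zero_iff.2 fun w hw => ?_)
    rw [map_pow]
    exact pow_ne_zero _ (hℓ3 w (h₁ w hw))
  · intro w hw
    rw [map_mul, map_prod, Finset.prod_eq_zero hw (hℓ2 w (h₀ w hw)), zero_mul]
  · intro w hw
    have hz := hℓ2 w (h₁ w hw)
    rw [← Finset.mul_prod_erase _ _ hw]
    constructor
    · simp [hz]
    · intro i
      simp [Derivation.leibniz, Derivation.leibniz_pow, hz]

end Interpolation

/-! ### Independence of vanishing and singularity conditions -/

section Codimension

variable {K : Type*} [Field K] {L : Type*} [Field L] [Algebra K L]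

theorem aeval_eq_eval_self (v : Fin 3 → L) (F : MvPolynomial (Fin 3) L) :
    aeval v F = eval v F := by
  rw [← coe_aeval_eq_eval]
  rfl

theorem eval_map_algebraMap (v : Fin 3 → L) (F : MvPolynomial (Fin 3) K) :
    eval v (map (algebraMap K L) F) = aeval v F := by
  rw [eval_map, aeval_def]

theorem SingAt.eval_eq_zero {F : MvPolynomial (Fin 3) L} {v : Fin 3 → L} (h : SingAt F v) :
    eval v F = 0 := by simpa using h.1

theorem SingAt.eval_pderiv_eq_zero {F : MvPolynomial (Fin 3) L} {v : Fin 3 → L}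
    (h : SingAt F v) (i : Fin 3) : eval v (pderiv i F) = 0 := by simpa using h.2 i

/-- The value and two partial derivatives of `F` at `v`; the value takes the place of the
derivative in the direction `i`. -/
noncomputable def jet (v : Fin 3 → L) (i : Fin 3) :
    MvPolynomial (Fin 3) L →ₗ[L] (Fin 3 → L) :=
  LinearMap.pi fun j => if j = i then (aeval v).toLinearMap else
    (aeval v).toLinearMap ∘ₗ (pderiv j).toLinearMap

theorem jet_apply_self (v : Fin 3 → L) (i : Fin 3) (F : MvPolynomial (Fin 3) L) :
    jet v i F i = eval v F := by
  simp [jet]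

theorem jet_apply_of_ne (v : Fin 3 → L) {i j : Fin 3} (h : j ≠ i) (F : MvPolynomial (Fin 3) L) :
    jet v i F j = eval v (pderiv j F) := by
  simp [jet, h]

theorem SingAt.jet_eq_zero {F : MvPolynomial (Fin 3) L} {v : Fin 3 → L} (h : SingAt F v)
    (i : Fin 3) : jet v i F = 0 := by
  funext j
  by_cases hj : j = i
  · subst hj
    rw [jet_apply_self, h.eval_eq_zero, Pi.zero_apply]
  · rw [jet_apply_of_ne v hj, h.eval_pderiv_eq_zero, Pi.zero_apply]

theorem singAt_map {F : MvPolynomial (Fin 3) K} {v : Fin 3 → L} :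
    SingAt (map (algebraMap K L) F) v ↔ SingAt F v := by
  simp [SingAt, pderiv_map, aeval_def]

/-- The separating form for the other points has degree |S₀| - 1 + 2 |S₁| ≤ d; it is padded with a
power of a coordinate that is nonzero at v. With `exists_form_jets` this gives the surjectivity
behind `card_vanish_sing_mul_le`. -/
theorem exists_form_value {S₀ S₁ : Finset (Fin 3 → L)} {d : ℕ} [DecidableEq (Fin 3 → L)]
    (hdisj : Disjoint S₀ S₁) (hnp : Nonprop (S₀ ∪ S₁ : Set (Fin 3 → L)))
    (hd : S₀.card + 2 * S₁.card ≤ d + 1) {v : Fin 3 → L} (hv : v ∈ S₀) (a : L) :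
    ∃ G : MvPolynomial (Fin 3) L, G.IsHomogeneous d ∧ eval v G = a ∧
      (∀ w ∈ S₀, w ≠ v → eval w G = 0) ∧ ∀ w ∈ S₁, SingAt G w := by
  have hvS : v ∈ (S₀ ∪ S₁ : Set (Fin 3 → L)) := Or.inl hv
  obtain ⟨P, hP, hPv, hP0, hP1⟩ := exists_form_separating (S₀.erase v) S₁ v
    (fun w hw => (hnp v hvS).2 w (Or.inl (Finset.mem_of_mem_erase hw))
      (Finset.ne_of_mem_erase hw).symm)
    (fun w hw => (hnp v hvS).2 w (Or.inr hw)
      fun h => Finset.disjoint_left.1 hdisj hv (h ▸ hw))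
  obtain ⟨i, hi⟩ := Function.ne_iff.1 (hnp v hvS).1
  simp only [Pi.zero_apply] at hi
  have hc := Finset.card_erase_of_mem hv
  have hpos := Finset.card_pos.2 ⟨v, hv⟩
  obtain ⟨m, hm⟩ : ∃ m, (S₀.erase v).card + 2 * S₁.card + m = d := ⟨_, Nat.add_sub_of_le (by omega)⟩
  refine ⟨C (a / (eval v P * v i ^ m)) * (P * X i ^ m), ?_, ?_, ?_, ?_⟩
  · rw [← hm]
    exact (hP.mul (isHomogeneous_X_pow i m)).C_mul _
  · simp only [map_mul, eval_C, map_pow, eval_X]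
    field_simp
  · intro w hw hwv
    simp [hP0 w (Finset.mem_erase.2 ⟨hwv, hw⟩)]
  · intro w hw
    have h0 := (hP1 w hw).eval_eq_zero
    have h1 := (hP1 w hw).eval_pderiv_eq_zero
    constructor
    · simp [h0]
    · intro j
      simp [Derivation.leibniz, h0, h1]

/-- The separating form P for the other points has degree at most d - 1, which leaves room for a
factor Q of positive degree with a prescribed jet. As P(v) ≠ 0, the product rule can be solved for
the jet of Q. -/
theorem exists_form_jets {S₀ S₁ : Finset (Fin 3 → L)} {d : ℕ} [DecidableEq (Fin 3 → L)]
    (hdisj : Disjoint S₀ S₁) (hnp : Nonprop (S₀ ∪ S₁ : Set (Fin 3 → L)))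
    (hd : S₀.card + 2 * S₁.card ≤ d + 1) {v : Fin 3 → L} (hv : v ∈ S₁) {i : Fin 3} (hi : v i ≠ 0)
    (b : Fin 3 → L) :
    ∃ G : MvPolynomial (Fin 3) L, G.IsHomogeneous d ∧ jet v i G = b ∧
      (∀ w ∈ S₀, eval w G = 0) ∧ ∀ w ∈ S₁, w ≠ v → SingAt G w := by
  have hvS : v ∈ (S₀ ∪ S₁ : Set (Fin 3 → L)) := Or.inr hv
  obtain ⟨P, hP, hPv, hP0, hP1⟩ := exists_form_separating S₀ (S₁.erase v) v
    (fun w hw => (hnp v hvS).2 w (Or.inl hw)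
      fun h => Finset.disjoint_left.1 hdisj hw (h ▸ hv))
    (fun w hw => (hnp v hvS).2 w (Or.inr (Finset.mem_of_mem_erase hw))
      (Finset.ne_of_mem_erase hw).symm)
  have hc := Finset.card_erase_of_mem hv
  have hpos := Finset.card_pos.2 ⟨v, hv⟩
  obtain ⟨m, hm⟩ : ∃ m, S₀.card + 2 * (S₁.erase v).card + (m + 1) = d :=
    ⟨d - (S₀.card + 2 * (S₁.erase v).card + 1), by omega⟩
  obtain ⟨Q, hQ, hQv, hQd⟩ := exists_form_jet hi m (b i / eval v P)
    (fun j => (b j - eval v (pderiv j P) * (b i / eval v P)) / eval v P)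
  refine ⟨P * Q, hm ▸ hP.mul hQ, ?_, ?_, ?_⟩
  · funext j
    by_cases hj : j = i
    · subst hj
      rw [jet_apply_self, map_mul, hQv]
      field_simp
    · rw [jet_apply_of_ne v hj, Derivation.leibniz]
      simp only [smul_eq_mul, map_add, map_mul, hQv, hQd j hj]
      field_simp
      ring
  · intro w hw
    simp [hP0 w hw]
  · intro w hw hwv
    have h0 := (hP1 w (Finset.mem_erase.2 ⟨hwv, hw⟩)).eval_eq_zero
    have h1 := (hP1 w (Finset.mem_erase.2 ⟨hwv, hw⟩)).eval_pderiv_eq_zero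
    constructor
    · simp [h0]
    · intro j
      simp [Derivation.leibniz, h0, h1]

open Classical in
/-- Vanishing at the points of `S₀` and being singular at the points of `S₁` imposes at least
`|S₀| + 3 |S₁|` independent conditions on the forms over `K` of large degree. -/
theorem card_vanish_sing_mul_le [Fintype K] {S₀ S₁ : Finset (Fin 3 → L)} {d : ℕ}
    (hdisj : Disjoint S₀ S₁) (hnp : Nonprop (S₀ ∪ S₁ : Set (Fin 3 → L)))
    (hd : S₀.card + 2 * S₁.card ≤ d + 1) :
    {F ∈ forms K d | (∀ v ∈ S₀, aeval v F = 0) ∧ ∀ v ∈ S₁, SingAt F v}.card *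
      Fintype.card K ^ (S₀.card + 3 * S₁.card) ≤ (forms K d).card := by
  have hne : ∀ v : S₁, ∃ i, v.1 i ≠ 0 := fun v => by
    simpa using Function.ne_iff.1 (hnp v.1 (Or.inr v.2)).1
  choose i hi using hne
  let ψ : MvPolynomial (Fin 3) L →ₗ[L] (S₀ → L) × (S₁ → Fin 3 → L) :=
    (LinearMap.pi fun v : S₀ => (aeval v.1).toLinearMap).prod
      (LinearMap.pi fun v : S₁ => jet v.1 (i v))
  have hψ : ∀ w, ∃ G : MvPolynomial (Fin 3) L, G.IsHomogeneous d ∧ ψ G = w := by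
    rintro ⟨a, b⟩
    choose G₀ hG₀ hG₀v hG₀0 hG₀1 using fun v : S₀ =>
      exists_form_value hdisj hnp hd v.2 (a v)
    choose G₁ hG₁ hG₁v hG₁0 hG₁1 using fun v : S₁ =>
      exists_form_jets hdisj hnp hd v.2 (hi v) (b v)
    refine ⟨∑ v, G₀ v + ∑ v, G₁ v, (IsHomogeneous.sum _ _ _ fun v _ => hG₀ v).add
      (IsHomogeneous.sum _ _ _ fun v _ => hG₁ v), Prod.ext ?_ ?_⟩
    · funext v
      change aeval v.1 (∑ v, G₀ v + ∑ v, G₁ v) = a v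
      rw [aeval_eq_eval_self, map_add, map_sum, map_sum, Finset.sum_eq_single v,
        Finset.sum_eq_zero, hG₀v, add_zero]
      · exact fun w _ => hG₁0 w v.1 v.2
      · exact fun w _ hw => hG₀0 w v.1 v.2 fun h => hw (Subtype.ext h.symm)
      · simp
    · funext v
      change jet v.1 (i v) (∑ v, G₀ v + ∑ v, G₁ v) = b v
      rw [map_add, map_sum, map_sum, Finset.sum_eq_zero, zero_add, Finset.sum_eq_single v, hG₁v]
      · exact fun w _ hw => (hG₁1 w v.1 v.2 fun h => hw (Subtype.ext h.symm)).jet_eq_zero _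
      · simp
      · exact fun w _ => (hG₀1 w v.1 v.2).jet_eq_zero _
  have hrank : Module.finrank L ((S₀ → L) × (S₁ → Fin 3 → L)) = S₀.card + 3 * S₁.card := by
    rw [Module.finrank_prod, Module.finrank_fintype_fun_eq_card, Module.finrank_pi_fintype]
    simp [mul_comm]
  refine le_trans ?_ (card_ker_mul_le (K := K) ψ hψ)
  rw [hrank]
  refine Nat.mul_le_mul_right _ (Finset.card_le_card fun F hF => ?_)
  simp only [Finset.mem_filter] at hF ⊢
  refine ⟨hF.1, Prod.ext (funext fun v => ?_) (funext fun v => ?_)⟩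
  · change aeval v.1 (map (algebraMap K L) F) = 0
    rw [aeval_eq_eval_self, eval_map_algebraMap]
    exact hF.2.1 v.1 v.2
  · exact (singAt_map.2 (hF.2.2 v.1 v.2)).jet_eq_zero _

end Codimension

/-! ### Scaling, Euler's identity and normalized coordinates -/

section Scaling

variable {K : Type*} [Field K] {L : Type*} [Field L] [Algebra K L]

theorem aeval_smul_of_isHomogeneous {F : MvPolynomial (Fin 3) K} {d : ℕ} (hF : F.IsHomogeneous d)
    (t : L) (v : Fin 3 → L) : aeval (t • v) F = t ^ d * aeval v F := by
  rw [aeval_def, aeval_def, eval₂_eq', eval₂_eq', Finset.mul_sum]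
  refine Finset.sum_congr rfl fun m hm => ?_
  have hdeg : ∑ i, m i = d := by
    rw [← Finsupp.degree_eq_sum]
    by_contra h
    exact (mem_support_iff.1 hm) (hF.coeff_eq_zero h)
  simp only [Pi.smul_apply, smul_eq_mul, mul_pow]
  rw [Finset.prod_mul_distrib, Finset.prod_pow_eq_pow_sum, hdeg]
  ring

theorem singAt_smul {F : MvPolynomial (Fin 3) K} {d : ℕ} (hF : F.IsHomogeneous d)
    {t : L} (ht : t ≠ 0) (v : Fin 3 → L) : SingAt F (t • v) ↔ SingAt F v := by
  simp only [SingAt, aeval_smul_of_isHomogeneous hF, aeval_smul_of_isHomogeneous hF.pderiv,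
    mul_eq_zero, pow_eq_zero_iff', ht, false_and, false_or]

/-- By Euler's identity, one of the partial derivatives is redundant. -/
theorem singAt_iff {F : MvPolynomial (Fin 3) K} {d : ℕ} (hF : F.IsHomogeneous d) {v : Fin 3 → L}
    {i : Fin 3} (hi : v i ≠ 0) :
    SingAt F v ↔ aeval v F = 0 ∧ ∀ j, j ≠ i → aeval v (pderiv j F) = 0 := by
  refine ⟨fun h => ⟨h.1, fun j _ => h.2 j⟩, fun h => ⟨h.1, fun j => ?_⟩⟩
  by_cases hj : j = i
  · subst hj
    have he := congrArg (aeval v) hF.sum_X_mul_pderiv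
    rw [map_nsmul, h.1, smul_zero, map_sum, Finset.sum_eq_single j] at he
    · simpa [hi] using he
    · intro k _ hk
      rw [map_mul, h.2 k hk, mul_zero]
    · simp
  · exact h.2 j hj

/-- The first nonzero coordinate of `v` is `1`. -/
def Nrm {L : Type*} [Field L] (v : Fin 3 → L) : Prop := ∃ i, v i = 1 ∧ ∀ j < i, v j = 0

theorem Nrm.ne_zero {v : Fin 3 → L} (h : Nrm v) : v ≠ 0 := by
  rintro rfl
  obtain ⟨i, hi, -⟩ := h
  simp at hi

theorem Nrm.eq_of_eq_smul {v w : Fin 3 → L} (hv : Nrm v) (hw : Nrm w) {t : L}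
    (h : v = t • w) : v = w := by
  obtain ⟨i, hi, hi'⟩ := hv
  obtain ⟨j, hj, hj'⟩ := hw
  have ht : t ≠ 0 := by
    rintro rfl
    rw [h] at hi
    simp at hi
  rcases lt_trichotomy i j with hij | rfl | hij
  · rw [h, Pi.smul_apply, hj' i hij] at hi
    simp at hi
  · rw [h, Pi.smul_apply, hj] at hi
    have : t = 1 := by simpa using hi
    rw [h, this, one_smul]
  · have := hi' j hij
    rw [h, Pi.smul_apply, hj] at this
    simp [ht] at this

theorem nonprop_nrm : Nonprop {v : Fin 3 → L | Nrm v} :=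
  fun _ hv => ⟨hv.ne_zero, fun _ hw hne _ h => hne (Nrm.eq_of_eq_smul hv hw h)⟩

theorem exists_nrm_smul {v : Fin 3 → L} (hv : v ≠ 0) :
    ∃ t : L, t ≠ 0 ∧ ∃ w, Nrm w ∧ v = t • w := by
  classical
  have hex : ∃ i, v i ≠ 0 := by simpa using Function.ne_iff.1 hv
  have hne : (Finset.univ.filter fun i => v i ≠ 0).Nonempty := by
    obtain ⟨i, hi⟩ := hex
    exact ⟨i, by simpa using hi⟩
  set i := (Finset.univ.filter fun i => v i ≠ 0).min' hne with hidef
  have hi : v i ≠ 0 := by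
    have := Finset.min'_mem _ hne
    rw [← hidef] at this
    simpa using this
  refine ⟨v i, hi, (v i)⁻¹ • v, ⟨i, by simp [hi], fun j hj => ?_⟩, by simp [smul_smul, hi]⟩
  by_contra h
  have hvj : v j ≠ 0 := by
    intro h0
    simp [h0] at h
  exact absurd (Finset.min'_le _ j (by simpa using hvj)) (not_le.2 hj)

theorem isSmoothForm_iff {F : MvPolynomial (Fin 3) K} {d : ℕ} (hF : F.IsHomogeneous d) :
    IsSmoothForm F ↔ ∀ v : Fin 3 → AlgebraicClosure K, Nrm v → ¬ SingAt F v := by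
  refine ⟨fun h v hv => h v hv.ne_zero, fun h v hv hs => ?_⟩
  obtain ⟨t, ht, w, hw, rfl⟩ := exists_nrm_smul hv
  exact h w hw ((singAt_smul hF ht w).1 hs)

theorem nrm_cases {v : Fin 3 → L} (hv : Nrm v) :
    (∃ x y, v = ![1, x, y]) ∨ (∃ y, v = ![0, 1, y]) ∨ v = ![0, 0, 1] := by
  obtain ⟨i, hi, hi'⟩ := hv
  fin_cases i
  · exact Or.inl ⟨v 1, v 2, by ext k; fin_cases k <;> simp_all⟩
  · have := hi' 0 (by decide)
    exact Or.inr (Or.inl ⟨v 2, by ext k; fin_cases k <;> simp_all⟩)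
  · have h0 := hi' 0 (by decide)
    have h1 := hi' 1 (by decide)
    exact Or.inr (Or.inr (by ext k; fin_cases k <;> simp_all))

end Scaling

/-! ### Rational points of the plane -/

section RationalPoints

variable (K : Type*) [Field K] [Fintype K]

open Classical in
/-- The normalized vectors over `K`; they represent the rational points of the plane. -/
noncomputable def ratPts : Finset (Fin 3 → K) := {v | Nrm v}

variable {K}

@[simp]
theorem mem_ratPts {v : Fin 3 → K} : v ∈ ratPts K ↔ Nrm v := by
  simp [ratPts]

theorem bijective_mk :
    Function.Bijective fun v : ratPts K =>
      Projectivization.mk K v.1 (mem_ratPts.1 v.2).ne_zero := by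
  constructor
  · intro v w h
    obtain ⟨a, ha⟩ := (Projectivization.mk_eq_mk_iff' K _ _ _ _).1 h
    exact Subtype.ext (Nrm.eq_of_eq_smul (mem_ratPts.1 v.2) (mem_ratPts.1 w.2) ha.symm)
  · intro P
    obtain ⟨t, ht, w, hw, h⟩ := exists_nrm_smul P.rep_nonzero
    refine ⟨⟨w, mem_ratPts.2 hw⟩, ?_⟩
    rw [← P.mk_rep]
    exact (Projectivization.mk_eq_mk_iff' K _ _ _ _).2 ⟨t⁻¹, by rw [h, smul_smul, inv_mul_cancel₀ ht, one_smul]⟩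

theorem card_ratPts : (ratPts K).card = Fintype.card K ^ 2 + Fintype.card K + 1 := by
  have h := Nat.card_congr (Equiv.ofBijective _ (bijective_mk (K := K)))
  rw [Projectivization.card_of_finrank K (Fin 3 → K) (n := 3) (by simp)] at h
  simp only [Nat.card_eq_fintype_card, Fintype.card_coe] at h
  rw [h]
  simp [Finset.sum_range_succ]
  ring

open Classical in
theorem pointCount_eq {F : MvPolynomial (Fin 3) K} {d : ℕ} (hF : F.IsHomogeneous d) :
    pointCount F = {v ∈ ratPts K | eval v F = 0}.card := by
  rw [pointCount, ← Set.ncard_coe_finset]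
  symm
  refine Set.ncard_congr (fun v hv => Projectivization.mk K v
    (mem_ratPts.1 (Finset.mem_filter.1 hv).1).ne_zero) ?_ ?_ ?_
  · intro v hv
    exact (mk_mem_rationalPoints hF v _).2 (Finset.mem_filter.1 hv).2
  · intro v w hv hw h
    have := (bijective_mk (K := K)).1 (a₁ := ⟨v, (Finset.mem_filter.1 hv).1⟩)
      (a₂ := ⟨w, (Finset.mem_filter.1 hw).1⟩) h
    exact congrArg Subtype.val this
  · intro P hP
    obtain ⟨⟨v, hv⟩, rfl⟩ := (bijective_mk (K := K)).2 P
    exact ⟨v, Finset.mem_coe.2 (Finset.mem_filter.2 ⟨hv, (mk_mem_rationalPoints hF v _).1 hP⟩), rfl⟩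

end RationalPoints

/-! ### Frobenius orbits and the degree of a point -/

section Frobenius

variable (K : Type*) [Field K] [Fintype K] {L : Type*} [Field L] [Algebra K L]

/-- The Frobenius map on vectors over an extension of the finite field `K`. -/
def frob (v : Fin 3 → L) : Fin 3 → L := fun i => v i ^ Fintype.card K

theorem frob_iterate_apply (e : ℕ) (v : Fin 3 → L) (i : Fin 3) :
    (frob K)^[e] v i = v i ^ Fintype.card K ^ e := by
  induction e with
  | zero => simp
  | succ e ih => rw [Function.iterate_succ_apply', frob, ih, ← pow_mul, pow_succ]

variable {K}

theorem aeval_frob (v : Fin 3 → L) (F : MvPolynomial (Fin 3) K) :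
    aeval (frob K v) F = aeval v F ^ Fintype.card K := by
  have h := comp_aeval_apply (f := v) (FiniteField.frobeniusAlgHom K L) F
  exact h.symm

theorem aeval_frob_iterate (e : ℕ) (v : Fin 3 → L) (F : MvPolynomial (Fin 3) K) :
    aeval ((frob K)^[e] v) F = aeval v F ^ Fintype.card K ^ e := by
  induction e with
  | zero => simp
  | succ e ih => rw [Function.iterate_succ_apply', aeval_frob, ih, ← pow_mul, pow_succ]

theorem singAt_frob_iterate {F : MvPolynomial (Fin 3) K} (e : ℕ) (v : Fin 3 → L) :
    SingAt F ((frob K)^[e] v) ↔ SingAt F v := by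
  have : Fintype.card K ^ e ≠ 0 := (pow_pos Fintype.card_pos e).ne'
  simp [SingAt, aeval_frob_iterate, Fintype.card_ne_zero]

theorem nrm_frob {v : Fin 3 → L} (hv : Nrm v) : Nrm (frob K v) := by
  obtain ⟨i, hi, hi'⟩ := hv
  exact ⟨i, by simp [frob, hi], fun j hj => by simp [frob, hi' j hj, Fintype.card_ne_zero]⟩

theorem nrm_frob_iterate {v : Fin 3 → L} (hv : Nrm v) (e : ℕ) : Nrm ((frob K)^[e] v) := by
  induction e with
  | zero => exact hv
  | succ e ih => rw [Function.iterate_succ_apply']; exact nrm_frob ih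

theorem frob_injective : Function.Injective (frob K : (Fin 3 → L) → Fin 3 → L) := by
  intro v w h
  funext i
  exact (FiniteField.frobeniusAlgHom K L).toRingHom.injective (congr_fun h i)

variable (K) in
theorem exists_pow_card_pow_eq [Algebra.IsAlgebraic K L] (a : L) :
    ∃ e, 0 < e ∧ a ^ Fintype.card K ^ e = a := by
  have hint : IsIntegral K a := Algebra.IsIntegral.isIntegral a
  have := IntermediateField.adjoin.finiteDimensional hint
  have : Finite (IntermediateField.adjoin K {a}) := Module.finite_of_finite K
  have := Fintype.ofFinite (IntermediateField.adjoin K {a})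
  refine ⟨Module.finrank K (IntermediateField.adjoin K {a}), Module.finrank_pos, ?_⟩
  have h := FiniteField.pow_card (⟨a, IntermediateField.mem_adjoin_simple_self K a⟩ :
    IntermediateField.adjoin K {a})
  rw [Module.card_eq_pow_finrank (K := K)] at h
  exact congrArg Subtype.val h

theorem pow_card_pow_mul {a : L} {e : ℕ} (h : a ^ Fintype.card K ^ e = a) (m : ℕ) :
    a ^ Fintype.card K ^ (e * m) = a := by
  induction m with
  | zero => simp
  | succ m ih => rw [mul_add, mul_one, pow_add, pow_mul, ih, h]

variable (K) in
theorem mem_periodicPts_frob [Algebra.IsAlgebraic K L] (v : Fin 3 → L) :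
    v ∈ Function.periodicPts (frob K) := by
  choose e he hv using fun i => exists_pow_card_pow_eq K (v i)
  refine Function.mk_mem_periodicPts (n := ∏ i, e i) (Finset.prod_pos fun i _ => he i) ?_
  funext i
  rw [frob_iterate_apply]
  obtain ⟨m, hm⟩ := Finset.dvd_prod_of_mem e (Finset.mem_univ i)
  rw [hm]
  exact pow_card_pow_mul (hv i) m

variable (K) in
/-- The degree over `K` of a vector: the number of its conjugates. -/
noncomputable def deg (v : Fin 3 → L) : ℕ := Function.minimalPeriod (frob K) v

theorem deg_pos [Algebra.IsAlgebraic K L] (v : Fin 3 → L) : 0 < deg K v :=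
  Function.minimalPeriod_pos_of_mem_periodicPts (mem_periodicPts_frob K v)

theorem frob_iterate_deg (v : Fin 3 → L) : (frob K)^[deg K v] v = v :=
  Function.iterate_minimalPeriod

theorem aeval_pow_card_pow_deg (v : Fin 3 → L) (F : MvPolynomial (Fin 3) K) :
    aeval v F ^ Fintype.card K ^ deg K v = aeval v F := by
  rw [← aeval_frob_iterate, frob_iterate_deg]

open Classical in
variable (K) in
/-- The conjugates of a vector. -/
noncomputable def orb (v : Fin 3 → L) : Finset (Fin 3 → L) :=
  (Finset.range (deg K v)).image fun i => (frob K)^[i] v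

theorem card_orb (v : Fin 3 → L) : (orb K v).card = deg K v := by
  classical
  rw [orb, Finset.card_image_of_injOn, Finset.card_range]
  intro i hi j hj h
  exact Function.iterate_injOn_Iio_minimalPeriod (by simpa [deg] using hi)
    (by simpa [deg] using hj) h

theorem mem_orb [Algebra.IsAlgebraic K L] {v w : Fin 3 → L} :
    w ∈ orb K v ↔ ∃ i, (frob K)^[i] v = w := by
  classical
  constructor
  · intro h
    obtain ⟨i, -, hi⟩ := Finset.mem_image.1 h
    exact ⟨i, hi⟩
  · rintro ⟨i, rfl⟩
    refine Finset.mem_image.2 ⟨i % deg K v, Finset.mem_range.2 (Nat.mod_lt _ (deg_pos v)), ?_⟩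
    exact Function.iterate_mod_minimalPeriod_eq

theorem self_mem_orb [Algebra.IsAlgebraic K L] (v : Fin 3 → L) : v ∈ orb K v :=
  mem_orb.2 ⟨0, rfl⟩

theorem orb_subset_of_mem [Algebra.IsAlgebraic K L] {v w : Fin 3 → L} (h : w ∈ orb K v) :
    orb K w ⊆ orb K v := by
  obtain ⟨i, rfl⟩ := mem_orb.1 h
  intro x hx
  obtain ⟨j, rfl⟩ := mem_orb.1 hx
  exact mem_orb.2 ⟨j + i, by rw [Function.iterate_add_apply]⟩

theorem deg_of_mem_orb [Algebra.IsAlgebraic K L] {v w : Fin 3 → L} (h : w ∈ orb K v) :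
    deg K w = deg K v := by
  obtain ⟨i, rfl⟩ := mem_orb.1 h
  exact Function.minimalPeriod_apply_iterate (mem_periodicPts_frob K v) i

theorem orb_eq_of_mem [Algebra.IsAlgebraic K L] {v w : Fin 3 → L} (h : w ∈ orb K v) :
    orb K w = orb K v :=
  Finset.eq_of_subset_of_card_le (orb_subset_of_mem h) (by
    rw [card_orb, card_orb, deg_of_mem_orb h])

theorem orb_disjoint [Algebra.IsAlgebraic K L] {v w : Fin 3 → L} (h : orb K v ≠ orb K w) :
    Disjoint (orb K v) (orb K w) := by
  rw [Finset.disjoint_left]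
  intro x hx hx'
  exact h ((orb_eq_of_mem hx).symm.trans (orb_eq_of_mem hx'))

theorem nrm_of_mem_orb [Algebra.IsAlgebraic K L] {v w : Fin 3 → L} (hv : Nrm v)
    (h : w ∈ orb K v) : Nrm w := by
  obtain ⟨i, rfl⟩ := mem_orb.1 h
  exact nrm_frob_iterate hv i

theorem singAt_of_mem_orb [Algebra.IsAlgebraic K L] {F : MvPolynomial (Fin 3) K}
    {v w : Fin 3 → L} (h : w ∈ orb K v) : SingAt F w ↔ SingAt F v := by
  obtain ⟨i, rfl⟩ := mem_orb.1 h
  exact singAt_frob_iterate i v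

variable (K L) in
/-- The elements of the extension of degree `e` of `K` inside `L`. -/
noncomputable def fixedElts (e : ℕ) : Finset L :=
  open Classical in (Polynomial.X ^ Fintype.card K ^ e - Polynomial.X : Polynomial L).roots.toFinset

theorem mem_fixedElts {e : ℕ} (he : e ≠ 0) {a : L} :
    a ∈ fixedElts K L e ↔ a ^ Fintype.card K ^ e = a := by
  classical
  rw [fixedElts, Multiset.mem_toFinset, Polynomial.mem_roots
    (FiniteField.X_pow_card_pow_sub_X_ne_zero L he Fintype.one_lt_card)]
  simp [sub_eq_zero]

theorem card_fixedElts_le {e : ℕ} (he : e ≠ 0) :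
    (fixedElts K L e).card ≤ Fintype.card K ^ e := by
  classical
  refine (Multiset.toFinset_card_le _).trans ((Polynomial.card_roots' _).trans ?_)
  rw [FiniteField.X_pow_card_pow_sub_X_natDegree_eq L he Fintype.one_lt_card]

/-- The three shapes of a normalized vector give at most q^(2e) + q^e + 1 of them, and q^e ≥ 2. -/
theorem finite_nrm_fixed (e : ℕ) (he : e ≠ 0) :
    ∃ T : Finset (Fin 3 → L), (∀ v, v ∈ T ↔ Nrm v ∧ (frob K)^[e] v = v) ∧
      T.card ≤ 2 * Fintype.card K ^ (2 * e) := by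
  classical
  set A := fixedElts K L e with hA
  have hAc : A.card ≤ Fintype.card K ^ e := card_fixedElts_le he
  set T := (A ×ˢ A).image (fun p => (![1, p.1, p.2] : Fin 3 → L)) ∪
    (A.image (fun y => (![0, 1, y] : Fin 3 → L)) ∪ {![0, 0, 1]}) with hT
  have hfix : ∀ v ∈ T, Nrm v := by
    intro v hv
    simp only [hT, Finset.mem_union, Finset.mem_image, Finset.mem_singleton] at hv
    rcases hv with ⟨p, -, rfl⟩ | ⟨y, -, rfl⟩ | rfl
    · exact ⟨0, by simp, fun j hj => by simp at hj⟩
    · exact ⟨1, by simp, fun j hj => by fin_cases j <;> simp_all⟩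
    · exact ⟨2, by simp, fun j hj => by fin_cases j <;> simp_all⟩
  refine ⟨T.filter fun v => (frob K)^[e] v = v, fun v => ?_, ?_⟩
  · rw [Finset.mem_filter]
    refine ⟨fun h => ⟨hfix v h.1, h.2⟩, fun h => ⟨?_, h.2⟩⟩
    have hmem : ∀ i, v i ∈ A := fun i => by
      rw [hA, mem_fixedElts he, ← frob_iterate_apply, h.2]
    simp only [hT, Finset.mem_union, Finset.mem_image, Finset.mem_singleton]
    rcases nrm_cases h.1 with ⟨x, y, rfl⟩ | ⟨y, rfl⟩ | rfl
    · exact Or.inl ⟨(x, y), Finset.mem_product.2 ⟨by simpa using hmem 1, by simpa using hmem 2⟩, rfl⟩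
    · exact Or.inr (Or.inl ⟨y, by simpa using hmem 2, rfl⟩)
    · exact Or.inr (Or.inr rfl)
  · have hq : 2 ≤ Fintype.card K ^ e :=
      le_trans Fintype.one_lt_card (Nat.le_self_pow he _)
    have h1 : T.card ≤ A.card * A.card + (A.card + 1) := by
      refine (Finset.card_union_le _ _).trans (add_le_add ?_ ?_)
      · exact Finset.card_image_le.trans (Finset.card_product _ _).le
      · exact (Finset.card_union_le _ _).trans (add_le_add Finset.card_image_le (by simp))
    refine (Finset.card_filter_le _ _).trans (h1.trans ?_)
    rw [mul_comm 2 e, pow_mul]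
    nlinarith

end Frobenius

open Classical in
-- Each nonempty fibre on `H` is a translate of a part of the kernel. Nothing is asked of `T` except
-- that it contains the image, so a bound for the number of possible values is enough.
theorem card_le_card_ker_mul {A B : Type*} [AddCommGroup A] [AddCommGroup B] (H : Finset A)
    (hH : ∀ x ∈ H, ∀ y ∈ H, x - y ∈ H) (f : A →+ B) (T : Finset B) (hT : ∀ x ∈ H, f x ∈ T) :
    H.card ≤ {x ∈ H | f x = 0}.card * T.card := by
  refine Finset.card_le_mul_card_image_of_maps_to hT _ fun b _ => ?_
  rcases Finset.eq_empty_or_nonempty {x ∈ H | f x = b} with h | ⟨y, hy⟩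
  · rw [h]
    simp
  · rw [Finset.mem_filter] at hy
    refine Finset.card_le_card_of_injOn (fun x => x - y) (fun x hx => ?_) fun x _ z _ h => ?_
    · simp only [Finset.coe_filter, Set.mem_ofPred_eq] at hx ⊢
      exact ⟨hH x hx.1 y hy.1, by rw [map_sub, hx.2, hy.2, sub_self]⟩
    · simpa using h

/-! ### Closed points and the exact codimension -/

section ClosedPoints

variable {K : Type*} [Field K] [Fintype K] {L : Type*} [Field L] [Algebra K L]
  [Algebra.IsAlgebraic K L]

open Classical in
-- The converse of `card_vanish_sing_mul_le`, with no condition on d. By Euler's identity three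
-- numbers decide whether F is singular at v, and each is a root of T^(q^e) - T, where e is the
-- degree of v, hence one of at most q^e values.
theorem card_forms_le (d : ℕ) (Z : Finset (Fin 3 → K)) (R : Finset (Fin 3 → L))
    (hR : ∀ v ∈ R, v ≠ 0) :
    (forms K d).card ≤
      {F ∈ forms K d | (∀ v ∈ Z, eval v F = 0) ∧ ∀ v ∈ R, SingAt F v}.card *
        Fintype.card K ^ (Z.card + 3 * ∑ v ∈ R, deg K v) := by
  have hne : ∀ v : R, ∃ i, v.1 i ≠ 0 := fun v => by
    simpa using Function.ne_iff.1 (hR v.1 v.2)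
  choose i hi using hne
  let f₁ : MvPolynomial (Fin 3) K →+ (Z → K) :=
    AddMonoidHom.mk' (fun F v => eval v.1 F) fun F G => by funext v; simp
  let f₂ : MvPolynomial (Fin 3) K →+ (R → Fin 3 → L) :=
    AddMonoidHom.mk' (fun F v j => if j = i v then aeval v.1 F else aeval v.1 (pderiv j F))
      fun F G => by
        funext v j
        by_cases h : j = i v <;> simp [h]
  have h₂ : ∀ F v j, f₂ F v j = if j = i v then aeval v.1 F else aeval v.1 (pderiv j F) :=
    fun _ _ _ => rfl
  let T₂ : Finset (R → Fin 3 → L) := Fintype.piFinset fun v =>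
    Fintype.piFinset fun _ => fixedElts K L (deg K v.1)
  refine (card_le_card_ker_mul (forms K d) (fun F hF G hG => mem_forms.2
    ((mem_forms.1 hF).sub (mem_forms.1 hG))) (f₁.prod f₂) (Finset.univ ×ˢ T₂) ?_).trans ?_
  · intro F _
    refine Finset.mem_product.2 ⟨Finset.mem_univ _, Fintype.mem_piFinset.2 fun v =>
      Fintype.mem_piFinset.2 fun j => ?_⟩
    rw [mem_fixedElts (deg_pos v.1).ne']
    simp only [AddMonoidHom.prod_apply, h₂]
    split_ifs <;> exact aeval_pow_card_pow_deg _ _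
  · refine Nat.mul_le_mul (Finset.card_le_card fun F hF => ?_) ?_
    · simp only [Finset.mem_filter, AddMonoidHom.prod_apply, Prod.mk_eq_zero] at hF ⊢
      refine ⟨hF.1, fun v hv => congr_fun hF.2.1 ⟨v, hv⟩, fun v hv => ?_⟩
      have h0 := fun j => congr_fun (congr_fun hF.2.2 ⟨v, hv⟩) j
      simp only [h₂] at h0
      refine (singAt_iff (mem_forms.1 hF.1) (hi ⟨v, hv⟩)).2 ⟨?_, fun j hj => ?_⟩
      · simpa using h0 (i ⟨v, hv⟩)
      · simpa [hj] using h0 j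
    · rw [Finset.card_product, pow_add]
      refine Nat.mul_le_mul (by simp) ?_
      rw [Fintype.card_piFinset]
      simp only [Fintype.card_piFinset, Finset.prod_const, Finset.card_univ, Fintype.card_fin]
      rw [mul_comm, pow_mul, ← Finset.prod_pow_eq_pow_sum, ← Finset.prod_pow]
      rw [← Finset.prod_coe_sort R fun v => (Fintype.card K ^ deg K v) ^ 3]
      exact Finset.prod_le_prod' fun v _ =>
        Nat.pow_le_pow_left (card_fixedElts_le (deg_pos v.1).ne') 3

variable (K) in
/-- A closed point of the projective plane over `K`, given by its conjugate geometric points in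
normalized coordinates. -/
def IsClosedPt (Q : Finset (Fin 3 → L)) : Prop := ∃ v, Nrm v ∧ Q = orb K v

/-- `F` is singular at all points of `Q`. -/
def SingOn (F : MvPolynomial (Fin 3) K) (Q : Finset (Fin 3 → L)) : Prop := ∀ v ∈ Q, SingAt F v

theorem singOn_orb {F : MvPolynomial (Fin 3) K} {v : Fin 3 → L} :
    SingOn F (orb K v) ↔ SingAt F v :=
  ⟨fun h => h v (self_mem_orb v), fun h _ hw => (singAt_of_mem_orb hw).2 h⟩

theorem IsClosedPt.eq_orb {Q : Finset (Fin 3 → L)} (hQ : IsClosedPt K Q) {v : Fin 3 → L}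
    (hv : v ∈ Q) : Q = orb K v := by
  obtain ⟨w, -, rfl⟩ := hQ
  exact (orb_eq_of_mem hv).symm

theorem IsClosedPt.nrm {Q : Finset (Fin 3 → L)} (hQ : IsClosedPt K Q) {v : Fin 3 → L}
    (hv : v ∈ Q) : Nrm v := by
  obtain ⟨w, hw, rfl⟩ := hQ
  exact nrm_of_mem_orb hw hv

theorem IsClosedPt.card_pos {Q : Finset (Fin 3 → L)} (hQ : IsClosedPt K Q) : 0 < Q.card := by
  obtain ⟨w, hw, rfl⟩ := hQ
  rw [card_orb]
  exact deg_pos w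

theorem IsClosedPt.disjoint {Q R : Finset (Fin 3 → L)} (hQ : IsClosedPt K Q)
    (hR : IsClosedPt K R) (h : Q ≠ R) : Disjoint Q R := by
  obtain ⟨w, hw, rfl⟩ := hQ
  obtain ⟨w, hw, rfl⟩ := hR
  exact orb_disjoint h

variable (L) in
/-- The vector over `L` with the coordinates of a vector over `K`. -/
def lift (v : Fin 3 → K) : Fin 3 → L := fun i => algebraMap K L (v i)

theorem lift_injective : Function.Injective (lift L : (Fin 3 → K) → Fin 3 → L) := fun _ _ h =>
  funext fun i => (algebraMap K L).injective (congr_fun h i)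

theorem aeval_lift (v : Fin 3 → K) (F : MvPolynomial (Fin 3) K) :
    aeval (lift L v) F = algebraMap K L (eval v F) := by
  have := aeval_algebraMap_apply L v F
  rwa [aeval_eq_eval_self] at this

theorem aeval_lift_eq_zero {v : Fin 3 → K} {F : MvPolynomial (Fin 3) K} :
    aeval (lift L v) F = 0 ↔ eval v F = 0 := by
  rw [aeval_lift, map_eq_zero]

theorem Nrm.lift {v : Fin 3 → K} (hv : Nrm v) : Nrm (lift L v) := by
  obtain ⟨i, hi, hi'⟩ := hv
  exact ⟨i, by simp [PlaneCurves.lift, hi], fun j hj => by simp [PlaneCurves.lift, hi' j hj]⟩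

theorem frob_lift (v : Fin 3 → K) : frob K (lift L v) = lift L v := by
  funext i
  simp [frob, lift, ← map_pow, FiniteField.pow_card]

theorem deg_lift (v : Fin 3 → K) : deg K (lift L v) = 1 :=
  Function.minimalPeriod_eq_one_iff_isFixedPt.2 (frob_lift v)

theorem orb_lift (v : Fin 3 → K) : orb K (lift L v) = {lift L v} := by
  obtain ⟨w, hw⟩ := Finset.card_eq_one.1 ((card_orb (lift L v)).trans (deg_lift v))
  have := self_mem_orb (K := K) (lift L v)
  rw [hw, Finset.mem_singleton] at this
  rw [hw, this]

theorem isClosedPt_lift {v : Fin 3 → K} (hv : Nrm v) : IsClosedPt K {lift L v} :=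
  ⟨lift L v, hv.lift, (orb_lift v).symm⟩

theorem IsClosedPt.eq_singleton_lift {Q : Finset (Fin 3 → L)} (hQ : IsClosedPt K Q)
    {v : Fin 3 → K} (hv : PlaneCurves.lift L v ∈ Q) : Q = {PlaneCurves.lift L v} := by
  rw [hQ.eq_orb hv, orb_lift]

theorem IsClosedPt.singOn_lift {F : MvPolynomial (Fin 3) K} {v : Fin 3 → K}
    (h : SingOn F ({PlaneCurves.lift L v} : Finset (Fin 3 → L))) : eval v F = 0 :=
  aeval_lift_eq_zero.1 (h _ (Finset.mem_singleton_self _)).1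

open Classical in
/-- The forms of large degree that vanish at the given rational points and are singular at the
given closed points have exactly the expected codimension. -/
theorem card_vanish_singOn {d : ℕ} (Z : Finset (Fin 3 → K)) (hZ : ∀ v ∈ Z, Nrm v)
    (Y : Finset (Finset (Fin 3 → L))) (hY : ∀ Q ∈ Y, IsClosedPt K Q)
    (hd : Z.card + 2 * ∑ Q ∈ Y, Q.card ≤ d + 1) :
    {F ∈ forms K d | (∀ v ∈ Z, eval v F = 0) ∧ ∀ Q ∈ Y, SingOn F Q}.card *
      Fintype.card K ^ ({v ∈ Z | {lift L v} ∉ Y}.card + 3 * ∑ Q ∈ Y, Q.card) =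
        (forms K d).card := by
  -- Singularity at a rational point contains vanishing there, so the points of Z that also occur in
  -- Y impose no condition of their own.
  set Z' := {v ∈ Z | {lift L v} ∉ Y} with hZ'
  have hpd : (Y : Set (Finset (Fin 3 → L))).PairwiseDisjoint id := fun Q hQ R hR h =>
    (hY Q hQ).disjoint (hY R hR) h
  have hcard : (Y.biUnion id).card = ∑ Q ∈ Y, Q.card := by
    rw [Finset.card_biUnion hpd]
    rfl
  have hZcard : (Z'.image (lift L)).card = Z'.card :=
    Finset.card_image_of_injective _ lift_injective
  have hZle : Z'.card ≤ Z.card := Finset.card_filter_le _ _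
  apply le_antisymm
  · have hdisj : Disjoint (Z'.image (lift L)) (Y.biUnion id) := by
      rw [Finset.disjoint_left]
      intro x hx hx'
      obtain ⟨v, hv, rfl⟩ := Finset.mem_image.1 hx
      obtain ⟨Q, hQ, hvQ⟩ := Finset.mem_biUnion.1 hx'
      exact (Finset.mem_filter.1 hv).2 ((hY Q hQ).eq_singleton_lift hvQ ▸ hQ)
    have hnp : Nonprop (Z'.image (lift L) ∪ Y.biUnion id : Set (Fin 3 → L)) := by
      refine nonprop_nrm.mono ?_
      rintro x (hx | hx)
      · obtain ⟨v, hv, rfl⟩ := Finset.mem_image.1 hx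
        exact (hZ v (Finset.mem_filter.1 hv).1).lift
      · obtain ⟨Q, hQ, hvQ⟩ := Finset.mem_biUnion.1 hx
        exact (hY Q hQ).nrm hvQ
    have h := card_vanish_sing_mul_le (K := K) (d := d) hdisj hnp (by
      rw [hcard, hZcard]
      omega)
    rw [hcard, hZcard] at h
    refine le_trans (Nat.mul_le_mul_right _ (Finset.card_le_card fun F hF => ?_)) h
    simp only [Finset.mem_filter] at hF ⊢
    refine ⟨hF.1, fun x hx => ?_, fun x hx => ?_⟩
    · obtain ⟨v, hv, rfl⟩ := Finset.mem_image.1 hx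
      exact aeval_lift_eq_zero.2 (hF.2.1 v (Finset.mem_filter.1 hv).1)
    · obtain ⟨Q, hQ, hvQ⟩ := Finset.mem_biUnion.1 hx
      exact hF.2.2 Q hQ x hvQ
  -- One representative of each closed point is enough, since singularity spreads along the orbit.
  · choose! r hr hrY using hY
    have hinj : Set.InjOn r Y := fun Q hQ R hR h => by rw [hrY Q hQ, hrY R hR, h]
    have hsum : ∑ v ∈ Y.image r, deg K v = ∑ Q ∈ Y, Q.card := by
      rw [Finset.sum_image hinj]
      refine Finset.sum_congr rfl fun Q hQ => ?_
      conv_rhs => rw [hrY Q hQ, card_orb]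
    have h := card_forms_le (K := K) d Z' (Y.image r) (fun v hv => by
      obtain ⟨Q, hQ, rfl⟩ := Finset.mem_image.1 hv
      exact (hr Q hQ).ne_zero)
    rw [hsum] at h
    refine h.trans (Nat.mul_le_mul_right _ (Finset.card_le_card fun F hF => ?_))
    simp only [Finset.mem_filter] at hF ⊢
    have hs : ∀ Q ∈ Y, SingOn F Q := fun Q hQ => by
      rw [hrY Q hQ]
      exact singOn_orb.2 (hF.2.2 _ (Finset.mem_image_of_mem _ hQ))
    refine ⟨hF.1, fun v hv => ?_, hs⟩
    by_cases hvY : {lift L v} ∈ Y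
    · exact IsClosedPt.singOn_lift (hs _ hvY)
    · exact hF.2.1 v (Finset.mem_filter.2 ⟨hv, hvY⟩)

open Classical in
/-- Being singular at a given point of degree `e` has probability at most `q ^ (-3 e)`. -/
theorem card_singAt_mul_le {d : ℕ} {v : Fin 3 → L} (hv : Nrm v) (hd : 2 * deg K v ≤ d + 1) :
    {F ∈ forms K d | SingAt F v}.card * Fintype.card K ^ (3 * deg K v) ≤ (forms K d).card := by
  have h := card_vanish_singOn (K := K) (d := d) ∅ (by simp) {orb K v}
    (by simpa using ⟨v, hv, rfl⟩) (by simpa [card_orb] using hd)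
  simp only [Finset.notMem_empty, IsEmpty.forall_iff, implies_true, true_and,
    Finset.mem_singleton, forall_eq, singOn_orb, Finset.filter_empty, Finset.card_empty,
    Finset.sum_singleton, card_orb, zero_add] at h
  exact h.le

end ClosedPoints

/-! ### Averages and probabilities over all forms -/

section Average

variable (K : Type*) [Field K] [Fintype K]

/-- The average of a function over all forms of degree `d`. -/
noncomputable def avg (d : ℕ) (f : MvPolynomial (Fin 3) K → ℝ) : ℝ :=
  (∑ F ∈ forms K d, f F) / (forms K d).card

open Classical in
/-- The indicator function of a property, as a real number. -/
noncomputable def ind (p : Prop) : ℝ := if p then 1 else 0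

/-- The probability of a property of forms of degree `d`. -/
noncomputable def prob (d : ℕ) (p : MvPolynomial (Fin 3) K → Prop) : ℝ :=
  avg K d fun F => ind (p F)

variable {K}

theorem ind_nonneg (p : Prop) : 0 ≤ ind p := by
  unfold ind; split_ifs <;> norm_num

theorem ind_le_one (p : Prop) : ind p ≤ 1 := by
  unfold ind; split_ifs <;> norm_num

theorem ind_of {p : Prop} (h : p) : ind p = 1 := if_pos h

theorem ind_of_not {p : Prop} (h : ¬ p) : ind p = 0 := if_neg h

theorem ind_mono {p r : Prop} (h : p → r) : ind p ≤ ind r := by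
  by_cases hp : p
  · rw [ind_of hp, ind_of (h hp)]
  · rw [ind_of_not hp]
    exact ind_nonneg r

theorem ind_and (p r : Prop) : ind (p ∧ r) = ind p * ind r := by
  by_cases hp : p <;> by_cases hr : r <;> simp [ind, hp, hr]

theorem ind_or_le (p r : Prop) : ind (p ∨ r) ≤ ind p + ind r := by
  by_cases hp : p <;> by_cases hr : r <;> simp [ind, hp, hr]

theorem card_forms_pos' (d : ℕ) : (0 : ℝ) < (forms K d).card := by
  exact_mod_cast card_forms_pos d

theorem avg_mono {d : ℕ} {f g : MvPolynomial (Fin 3) K → ℝ} (h : ∀ F ∈ forms K d, f F ≤ g F) :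
    avg K d f ≤ avg K d g :=
  div_le_div_of_nonneg_right (Finset.sum_le_sum h) (card_forms_pos' d).le

theorem avg_congr {d : ℕ} {f g : MvPolynomial (Fin 3) K → ℝ} (h : ∀ F ∈ forms K d, f F = g F) :
    avg K d f = avg K d g := by
  rw [avg, Finset.sum_congr rfl h, avg]

theorem avg_add (d : ℕ) (f g : MvPolynomial (Fin 3) K → ℝ) :
    avg K d (fun F => f F + g F) = avg K d f + avg K d g := by
  simp only [avg, Finset.sum_add_distrib, add_div]

theorem avg_sub (d : ℕ) (f g : MvPolynomial (Fin 3) K → ℝ) :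
    avg K d (fun F => f F - g F) = avg K d f - avg K d g := by
  simp only [avg, Finset.sum_sub_distrib, sub_div]

theorem avg_mul_left (d : ℕ) (c : ℝ) (f : MvPolynomial (Fin 3) K → ℝ) :
    avg K d (fun F => c * f F) = c * avg K d f := by
  simp only [avg, ← Finset.mul_sum, mul_div_assoc]

theorem avg_sum {ι : Type*} (s : Finset ι) (d : ℕ) (f : ι → MvPolynomial (Fin 3) K → ℝ) :
    avg K d (fun F => ∑ i ∈ s, f i F) = ∑ i ∈ s, avg K d (f i) := by
  simp only [avg]
  rw [Finset.sum_comm, Finset.sum_div]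

theorem avg_const (d : ℕ) (c : ℝ) : avg K d (fun _ => c) = c := by
  have := (card_forms_pos' (K := K) d).ne'
  simp [avg, this]

theorem avg_nonneg {d : ℕ} {f : MvPolynomial (Fin 3) K → ℝ} (h : ∀ F ∈ forms K d, 0 ≤ f F) :
    0 ≤ avg K d f :=
  div_nonneg (Finset.sum_nonneg h) (card_forms_pos' d).le

theorem abs_avg_le (d : ℕ) (f : MvPolynomial (Fin 3) K → ℝ) :
    |avg K d f| ≤ avg K d fun F => |f F| := by
  rw [avg, abs_div, abs_of_pos (card_forms_pos' d)]
  exact div_le_div_of_nonneg_right (Finset.abs_sum_le_sum_abs _ _) (card_forms_pos' d).le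

theorem prob_nonneg (d : ℕ) (p : MvPolynomial (Fin 3) K → Prop) : 0 ≤ prob K d p :=
  avg_nonneg fun _ _ => ind_nonneg _

theorem prob_le_one (d : ℕ) (p : MvPolynomial (Fin 3) K → Prop) : prob K d p ≤ 1 := by
  rw [← avg_const (K := K) d 1]
  exact avg_mono fun _ _ => ind_le_one _

theorem prob_mono {d : ℕ} {p r : MvPolynomial (Fin 3) K → Prop}
    (h : ∀ F ∈ forms K d, p F → r F) : prob K d p ≤ prob K d r :=
  avg_mono fun F hF => ind_mono (h F hF)

theorem prob_or_le (d : ℕ) (p r : MvPolynomial (Fin 3) K → Prop) :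
    prob K d (fun F => p F ∨ r F) ≤ prob K d p + prob K d r := by
  rw [prob, prob, prob, ← avg_add]
  exact avg_mono fun F _ => ind_or_le _ _

theorem prob_not (d : ℕ) (p : MvPolynomial (Fin 3) K → Prop) :
    prob K d (fun F => ¬ p F) = 1 - prob K d p := by
  rw [prob, prob, ← avg_const (K := K) d 1, ← avg_sub]
  refine avg_congr fun F _ => ?_
  by_cases h : p F <;> simp [ind, h]

theorem prob_exists_le {ι : Type*} (s : Finset ι) (d : ℕ)
    (p : ι → MvPolynomial (Fin 3) K → Prop) :
    prob K d (fun F => ∃ i ∈ s, p i F) ≤ ∑ i ∈ s, prob K d (p i) := by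
  simp only [prob]
  rw [← avg_sum]
  refine avg_mono fun F _ => ?_
  by_cases h : ∃ i ∈ s, p i F
  · rw [ind_of h]
    obtain ⟨i, hi, hp⟩ := h
    rw [← ind_of hp]
    exact Finset.single_le_sum (f := fun i => ind (p i F)) (fun i _ => ind_nonneg _) hi
  · rw [ind_of_not h]
    exact Finset.sum_nonneg fun _ _ => ind_nonneg _

open Classical in
theorem sum_ind {α : Type*} (s : Finset α) (p : α → Prop) :
    ∑ a ∈ s, ind (p a) = ({a ∈ s | p a}.card : ℝ) := by
  rw [Finset.card_filter]
  push_cast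
  exact Finset.sum_congr rfl fun a _ => by by_cases h : p a <;> simp [ind, h]

open Classical in
theorem prob_eq (d : ℕ) (p : MvPolynomial (Fin 3) K → Prop) :
    prob K d p = ({F ∈ forms K d | p F}.card : ℝ) / (forms K d).card := by
  rw [prob, avg, sum_ind]

open Classical in
theorem prob_le_of_card_mul_le {d N M : ℕ} {p : MvPolynomial (Fin 3) K → Prop} (hN : 0 < N)
    (h : {F ∈ forms K d | p F}.card * N ≤ M * (forms K d).card) :
    prob K d p ≤ (M : ℝ) / N := by
  rw [prob_eq, div_le_div_iff₀ (card_forms_pos' d) (by exact_mod_cast hN)]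
  exact_mod_cast h

end Average

/-! ### Truncated inclusion-exclusion -/

section Bonferroni

/-- For N ≥ 1 the truncated alternating sum is ± `(N - 1).choose j`, which is at most `N.choose (j +
1)` by Pascal's rule. -/
theorem abs_indicator_sub_alternating_le (N j : ℕ) :
    |(if N = 0 then (1 : ℝ) else 0) - ∑ i ∈ Finset.range (j + 1), (-1) ^ i * (N.choose i : ℝ)| ≤
      N.choose (j + 1) := by
  rcases N with _ | N
  · rw [Finset.sum_range_succ']
    simp
  · have h := Int.alternating_sum_range_choose_eq_choose (n := N) (m := j)
    have h' : ∑ i ∈ Finset.range (j + 1), (-1) ^ i * ((N + 1).choose i : ℝ) =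
        (-1) ^ j * (N.choose j : ℝ) := by exact_mod_cast h
    rw [h', if_neg (Nat.succ_ne_zero N), zero_sub, abs_neg, abs_mul, abs_pow, abs_neg, abs_one,
      one_pow, one_mul, Nat.abs_cast]
    exact_mod_cast (Nat.choose_succ_succ N j).symm ▸ Nat.le_add_right _ _

theorem sum_powerset_filter_subset {α : Type*} [DecidableEq α] (C S : Finset α) (hS : S ⊆ C)
    (i : ℕ) : ∑ Y ∈ C.powersetCard i, ind (Y ⊆ S) = (S.card.choose i : ℝ) := by
  classical
  rw [← Finset.card_powersetCard]
  rw [sum_ind]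
  congr 2
  ext Y
  simp only [Finset.mem_filter, Finset.mem_powersetCard]
  exact ⟨fun h => ⟨h.2, h.1.2⟩, fun h => ⟨⟨h.1.trans hS, h.2⟩, h.1⟩⟩

theorem prod_one_sub_eq_sum {α : Type*} [DecidableEq α] (C : Finset α) (a : α → ℝ) :
    ∏ Q ∈ C, (1 - a Q) = ∑ Y ∈ C.powerset, (-1) ^ Y.card * ∏ Q ∈ Y, a Q := by
  have := Finset.prod_one_add C (f := fun Q => -a Q)
  simp only [← sub_eq_add_neg] at this
  rw [this]
  exact Finset.sum_congr rfl fun Y _ => by rw [Finset.prod_neg]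

/-- Rankin's trick: for a set of more than j elements the product of the x a is at most t^(-(j+1))
times the product of the t x a, and the latter sum over all subsets to ∏ (1 + t x a). -/
theorem sum_tail_le {α : Type*} [DecidableEq α] (C : Finset α) (x : α → ℝ) (hx : ∀ a ∈ C, 0 ≤ x a)
    {t : ℝ} (ht : 1 ≤ t) (j : ℕ) :
    ∑ Y ∈ C.powerset with j < Y.card, ∏ a ∈ Y, x a ≤
      (t ^ (j + 1))⁻¹ * Real.exp (t * ∑ a ∈ C, x a) := by
  have ht0 : 0 < t := by linarith
  have h1 : ∀ Y ∈ C.powerset, 0 ≤ ∏ a ∈ Y, x a := fun Y hY =>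
    Finset.prod_nonneg fun a ha => hx a (Finset.mem_powerset.1 hY ha)
  have h2 : ∑ Y ∈ C.powerset with j < Y.card, ∏ a ∈ Y, x a ≤
      ∑ Y ∈ C.powerset, (t ^ (j + 1))⁻¹ * ∏ a ∈ Y, (t * x a) := by
    refine (Finset.sum_le_sum fun Y hY => ?_).trans
      (Finset.sum_le_sum_of_subset_of_nonneg (Finset.filter_subset _ _) fun Y hY _ => ?_)
    · rw [Finset.mem_filter] at hY
      rw [Finset.prod_mul_distrib, Finset.prod_const, ← mul_assoc]
      refine le_mul_of_one_le_left (h1 Y hY.1) ?_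
      rw [inv_mul_eq_div, one_le_div (by positivity)]
      exact pow_le_pow_right₀ ht hY.2
    · rw [Finset.prod_mul_distrib]
      have := h1 Y hY
      positivity
  refine h2.trans ?_
  rw [← Finset.mul_sum, ← Finset.prod_one_add]
  refine mul_le_mul_of_nonneg_left ?_ (by positivity)
  rw [Finset.mul_sum, Real.exp_sum]
  refine Finset.prod_le_prod (fun a ha => ?_) fun a _ => ?_
  · have := hx a ha
    positivity
  · rw [add_comm]
    exact Real.add_one_le_exp _

end Bonferroni

/-! ### The sieve over closed points -/

section Sieve

variable {K : Type*} [Field K] [Fintype K] {L : Type*} [Field L] [Algebra K L]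
  [Algebra.IsAlgebraic K L]

open Classical in
-- A rational point common to `Z` and `Y` contributes q^(-3) and not q^(-1) q^(-3), whence the
-- correcting factor q.
theorem prob_vanish_singOn {d : ℕ} (Z : Finset (Fin 3 → K)) (hZ : ∀ v ∈ Z, Nrm v)
    (Y : Finset (Finset (Fin 3 → L))) (hY : ∀ Q ∈ Y, IsClosedPt K Q)
    (hd : Z.card + 2 * ∑ Q ∈ Y, Q.card ≤ d + 1) :
    prob K d (fun F => (∀ v ∈ Z, eval v F = 0) ∧ ∀ Q ∈ Y, SingOn F Q) =
      ((Fintype.card K : ℝ) ^ Z.card)⁻¹ * ∏ Q ∈ Y, ((Fintype.card K : ℝ) ^ (3 * Q.card))⁻¹ *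
        (if Q ∈ Z.image (fun v => {lift L v}) then (Fintype.card K : ℝ) else 1) := by
  have hq : (Fintype.card K : ℝ) ≠ 0 := by exact_mod_cast Fintype.card_ne_zero
  have h := card_vanish_singOn Z hZ Y hY hd
  have hsplit : {v ∈ Z | {lift L v} ∉ Y}.card + {Q ∈ Y | Q ∈ Z.image fun v => {lift L v}}.card
      = Z.card := by
    have h1 : {Q ∈ Y | Q ∈ Z.image fun v => ({lift L v} : Finset (Fin 3 → L))} =
        {v ∈ Z | {lift L v} ∈ Y}.image fun v => {lift L v} := by
      ext Q
      simp only [Finset.mem_filter, Finset.mem_image]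
      constructor
      · rintro ⟨hQ, v, hv, rfl⟩
        exact ⟨v, ⟨hv, hQ⟩, rfl⟩
      · rintro ⟨v, ⟨hv, hQ⟩, rfl⟩
        exact ⟨hQ, v, hv, rfl⟩
    rw [h1, Finset.card_image_of_injective _ fun v w hvw =>
      lift_injective (Finset.singleton_injective hvw), add_comm]
    exact Finset.card_filter_add_card_filter_not _
  rw [prob_eq, div_eq_iff (card_forms_pos' d).ne', ← h, Finset.prod_mul_distrib,
    Finset.prod_inv_distrib, Finset.prod_pow_eq_pow_sum, ← Finset.mul_sum, Finset.prod_ite,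
    Finset.prod_const, Finset.prod_const_one, mul_one, ← hsplit]
  push_cast
  rw [pow_add, pow_add]
  field_simp
  congr!

open Classical in
/-- The sieve: the probability that a form vanishes at the given rational points and is singular
at none of the closed points in `C`. -/
theorem abs_prob_sub_le {d j r : ℕ} (Z : Finset (Fin 3 → K)) (hZ : ∀ v ∈ Z, Nrm v)
    (C : Finset (Finset (Fin 3 → L))) (hC : ∀ Q ∈ C, IsClosedPt K Q) (hr : ∀ Q ∈ C, Q.card ≤ r)
    (hd : Z.card + 2 * ((j + 1) * r) ≤ d + 1) :
    |prob K d (fun F => (∀ v ∈ Z, eval v F = 0) ∧ ∀ Q ∈ C, ¬ SingOn F Q) -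
        ((Fintype.card K : ℝ) ^ Z.card)⁻¹ * ∏ Q ∈ C, (1 - ((Fintype.card K : ℝ) ^ (3 * Q.card))⁻¹ *
          (if Q ∈ Z.image (fun v => {lift L v}) then (Fintype.card K : ℝ) else 1))| ≤
      2 * (((Fintype.card K : ℝ) ^ (j + 1))⁻¹ * Real.exp (Fintype.card K *
        ∑ Q ∈ C, ((Fintype.card K : ℝ) ^ (3 * Q.card))⁻¹)) := by
  set q : ℝ := ((Fintype.card K : ℕ) : ℝ) with hqdef
  have hq1 : 1 ≤ q := by
    rw [hqdef]
    exact_mod_cast Fintype.card_pos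
  set x : Finset (Fin 3 → L) → ℝ := fun Q => (q ^ (3 * Q.card))⁻¹ with hx
  set a : Finset (Fin 3 → L) → ℝ := fun Q => x Q *
    (if Q ∈ Z.image (fun v => {lift L v}) then q else 1) with ha
  have hx0 : ∀ Q, 0 ≤ x Q := fun Q => by positivity
  have ha0 : ∀ Q, 0 ≤ a Q := fun Q => mul_nonneg (hx0 Q) (by split_ifs <;> positivity)
  -- The correcting factor q occurs at most |Z| times and is absorbed by q^(-|Z|), so the error
  -- terms do not depend on Z.
  have hw : ∀ Y ⊆ C, (q ^ Z.card)⁻¹ * ∏ Q ∈ Y, a Q ≤ ∏ Q ∈ Y, x Q := by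
    intro Y hY
    have hcard : {Q ∈ Y | Q ∈ Z.image fun v => {lift L v}}.card ≤ Z.card :=
      (Finset.card_le_card fun Q hQ => (Finset.mem_filter.1 hQ).2).trans Finset.card_image_le
    rw [ha, Finset.prod_mul_distrib, Finset.prod_ite, Finset.prod_const, Finset.prod_const_one,
      mul_one, mul_comm, mul_assoc]
    refine mul_le_of_le_one_right (Finset.prod_nonneg fun Q _ => hx0 Q) ?_
    rw [mul_inv_le_iff₀ (by positivity), one_mul]
    exact pow_le_pow_right₀ hq1 hcard
  set S : MvPolynomial (Fin 3) K → Finset (Finset (Fin 3 → L)) := fun F =>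
    {Q ∈ C | SingOn F Q} with hS
  have hsum : ∀ Y : Finset (Finset (Fin 3 → L)), Y ⊆ C → Y.card ≤ j + 1 →
      prob K d (fun F => (∀ v ∈ Z, eval v F = 0) ∧ Y ⊆ S F) = (q ^ Z.card)⁻¹ * ∏ Q ∈ Y, a Q := by
    intro Y hY hYj
    rw [← prob_vanish_singOn (d := d) Z hZ Y (fun Q hQ => hC Q (hY hQ))]
    · have : ∀ F, Y ⊆ S F ↔ ∀ Q ∈ Y, SingOn F Q := fun F =>
        ⟨fun h Q hQ => (Finset.mem_filter.1 (h hQ)).2,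
          fun h Q hQ => Finset.mem_filter.2 ⟨hY hQ, h Q hQ⟩⟩
      simp only [this]
    · refine le_trans ?_ hd
      have : ∑ Q ∈ Y, Q.card ≤ Y.card * r := by
        rw [← smul_eq_mul, ← Finset.sum_const]
        exact Finset.sum_le_sum fun Q hQ => hr Q (hY hQ)
      have := Nat.mul_le_mul_right r hYj
      omega
  -- The inclusion-exclusion sum over sets of at most j closed points. The codimension is exact up
  -- to size j + 1, so the Bonferroni remainder is known as well; the probability and the full
  -- product each differ from T by at most the tail over sets with more than j elements.
  set T : ℝ := ∑ i ∈ Finset.range (j + 1), ∑ Y ∈ C.powersetCard i,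
    (-1) ^ i * ((q ^ Z.card)⁻¹ * ∏ Q ∈ Y, a Q) with hT
  have hTavg : T = avg K d fun F => ind (∀ v ∈ Z, eval v F = 0) *
      ∑ i ∈ Finset.range (j + 1), (-1) ^ i * ((S F).card.choose i : ℝ) := by
    simp_rw [Finset.mul_sum]
    rw [avg_sum]
    refine Finset.sum_congr rfl fun i hi => ?_
    have : ∀ F, ind (∀ v ∈ Z, eval v F = 0) * ((-1) ^ i * ((S F).card.choose i : ℝ)) =
        ∑ Y ∈ C.powersetCard i, (-1) ^ i * ind ((∀ v ∈ Z, eval v F = 0) ∧ Y ⊆ S F) := by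
      intro F
      rw [← sum_powerset_filter_subset C (S F) (Finset.filter_subset _ _), Finset.mul_sum,
        Finset.mul_sum]
      refine Finset.sum_congr rfl fun Y _ => ?_
      rw [ind_and]
      ring
    simp_rw [this]
    rw [avg_sum]
    refine Finset.sum_congr rfl fun Y hY => ?_
    rw [avg_mul_left, ← hsum Y (Finset.mem_powersetCard.1 hY).1]
    · rfl
    · rw [(Finset.mem_powersetCard.1 hY).2]
      exact (Finset.mem_range.1 hi).le
  have h1 : |prob K d (fun F => (∀ v ∈ Z, eval v F = 0) ∧ ∀ Q ∈ C, ¬ SingOn F Q) - T| ≤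
      ∑ Y ∈ C.powerset with j < Y.card, ∏ Q ∈ Y, x Q := by
    rw [hTavg, prob, ← avg_sub]
    refine (abs_avg_le _ _).trans ?_
    have hle : ∀ F ∈ forms K d, |ind ((∀ v ∈ Z, eval v F = 0) ∧ ∀ Q ∈ C, ¬ SingOn F Q) -
        ind (∀ v ∈ Z, eval v F = 0) *
          ∑ i ∈ Finset.range (j + 1), (-1) ^ i * ((S F).card.choose i : ℝ)| ≤
        ∑ Y ∈ C.powersetCard (j + 1), ind ((∀ v ∈ Z, eval v F = 0) ∧ Y ⊆ S F) := by
      intro F _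
      have e1 : ∑ Y ∈ C.powersetCard (j + 1), ind ((∀ v ∈ Z, eval v F = 0) ∧ Y ⊆ S F) =
          ind (∀ v ∈ Z, eval v F = 0) * ((S F).card.choose (j + 1) : ℝ) := by
        rw [← sum_powerset_filter_subset C (S F) (Finset.filter_subset _ _), Finset.mul_sum]
        exact Finset.sum_congr rfl fun Y _ => ind_and _ _
      have e2 : ind (∀ Q ∈ C, ¬ SingOn F Q) = if (S F).card = 0 then (1 : ℝ) else 0 := by
        have : (∀ Q ∈ C, ¬ SingOn F Q) ↔ (S F).card = 0 := by
          rw [Finset.card_eq_zero, hS]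
          simp only [Finset.filter_eq_empty_iff]
        by_cases h : (S F).card = 0
        · rw [if_pos h, ind_of (this.2 h)]
        · rw [if_neg h, ind_of_not (fun h' => h (this.1 h'))]
      rw [e1, ind_and, e2, ← mul_sub, abs_mul, abs_of_nonneg (ind_nonneg _)]
      exact mul_le_mul_of_nonneg_left (abs_indicator_sub_alternating_le _ _) (ind_nonneg _)
    refine (avg_mono hle).trans ?_
    rw [avg_sum]
    refine le_trans (Finset.sum_le_sum fun Y hY => ?_)
      (Finset.sum_le_sum_of_subset_of_nonneg (s := C.powersetCard (j + 1)) ?_ fun Y _ _ =>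
        Finset.prod_nonneg fun Q _ => hx0 Q)
    · rw [Finset.mem_powersetCard] at hY
      exact (hsum Y hY.1 hY.2.le).trans_le (hw Y hY.1)
    · intro Y hY
      rw [Finset.mem_powersetCard] at hY
      rw [Finset.mem_filter, Finset.mem_powerset]
      exact ⟨hY.1, by omega⟩
  have h2 : |T - (q ^ Z.card)⁻¹ * ∏ Q ∈ C, (1 - a Q)| ≤
      ∑ Y ∈ C.powerset with j < Y.card, ∏ Q ∈ Y, x Q := by
    have e1 : (q ^ Z.card)⁻¹ * ∏ Q ∈ C, (1 - a Q) =
        ∑ Y ∈ C.powerset, (-1) ^ Y.card * ((q ^ Z.card)⁻¹ * ∏ Q ∈ Y, a Q) := by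
      rw [prod_one_sub_eq_sum, Finset.mul_sum]
      exact Finset.sum_congr rfl fun Y _ => by ring
    have e2 : T = ∑ Y ∈ C.powerset with ¬ j < Y.card,
        (-1) ^ Y.card * ((q ^ Z.card)⁻¹ * ∏ Q ∈ Y, a Q) := by
      rw [hT, ← Finset.sum_fiberwise_of_maps_to (s := {Y ∈ C.powerset | ¬ j < Y.card})
        (t := Finset.range (j + 1)) (g := Finset.card)]
      · refine Finset.sum_congr rfl fun i hi => ?_
        have : C.powersetCard i = {Y ∈ {Y ∈ C.powerset | ¬ j < Y.card} | Y.card = i} := by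
          ext Y
          simp only [Finset.mem_powersetCard, Finset.mem_filter, Finset.mem_powerset]
          have := Finset.mem_range.1 hi
          exact ⟨fun h => ⟨⟨h.1, by omega⟩, h.2⟩, fun h => ⟨h.1.1, h.2⟩⟩
        rw [this]
        exact Finset.sum_congr rfl fun Y hY => by rw [(Finset.mem_filter.1 hY).2]
      · intro Y hY
        have := (Finset.mem_filter.1 hY).2
        exact Finset.mem_range.2 (by omega)
    rw [e1, e2, ← Finset.sum_filter_add_sum_filter_not C.powerset (fun Y => j < Y.card),
      sub_add_cancel_right, abs_neg]
    refine (Finset.abs_sum_le_sum_abs _ _).trans (Finset.sum_le_sum fun Y hY => ?_)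
    rw [abs_mul, abs_pow, abs_neg, abs_one, one_pow, one_mul, abs_of_nonneg]
    · exact hw Y (Finset.mem_powerset.1 (Finset.mem_filter.1 hY).1)
    · exact mul_nonneg (by positivity) (Finset.prod_nonneg fun Q _ => ha0 Q)
  have h3 := sum_tail_le C x (fun Q _ => hx0 Q) hq1 j
  calc _ ≤ _ := abs_sub_le _ T _
    _ ≤ _ := by linarith

end Sieve

/-! ### Counting closed points -/

section ClosedPointCounts

variable (K : Type*) [Field K] [Fintype K] (L : Type*) [Field L] [Algebra K L]
  [Algebra.IsAlgebraic K L]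

theorem exists_nrm_deg_eq (e : ℕ) :
    ∃ T : Finset (Fin 3 → L), (∀ v, v ∈ T ↔ Nrm v ∧ deg K v = e) ∧
      T.card ≤ 2 * Fintype.card K ^ (2 * e) := by
  classical
  rcases Nat.eq_zero_or_pos e with rfl | he
  · exact ⟨∅, fun v => by simp [(deg_pos (K := K) v).ne'], by simp⟩
  obtain ⟨T, hT, hTc⟩ := finite_nrm_fixed (K := K) (L := L) e he.ne'
  refine ⟨T.filter fun v => deg K v = e, fun v => ?_, (Finset.card_filter_le _ _).trans hTc⟩
  rw [Finset.mem_filter, hT]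
  refine ⟨fun h => ⟨h.1.1, h.2⟩, fun h => ⟨⟨h.1, ?_⟩, h.2⟩⟩
  rw [← h.2]
  exact frob_iterate_deg v

/-- The normalized vectors of degree `e`. -/
noncomputable def degPts (e : ℕ) : Finset (Fin 3 → L) := (exists_nrm_deg_eq K L e).choose

variable {K L}

theorem mem_degPts {e : ℕ} {v : Fin 3 → L} : v ∈ degPts K L e ↔ Nrm v ∧ deg K v = e :=
  (exists_nrm_deg_eq K L e).choose_spec.1 v

theorem card_degPts_le (e : ℕ) : (degPts K L e).card ≤ 2 * Fintype.card K ^ (2 * e) :=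
  (exists_nrm_deg_eq K L e).choose_spec.2

open Classical in
variable (K L) in
/-- The closed points of degree at most `r`. -/
noncomputable def closedPts (r : ℕ) : Finset (Finset (Fin 3 → L)) :=
  (Finset.Ico 1 (r + 1)).biUnion fun e => (degPts K L e).image (orb K)

theorem mem_closedPts {r : ℕ} {Q : Finset (Fin 3 → L)} :
    Q ∈ closedPts K L r ↔ IsClosedPt K Q ∧ Q.card ≤ r := by
  classical
  simp only [closedPts, Finset.mem_biUnion, Finset.mem_Ico, Finset.mem_image, mem_degPts]
  constructor
  · rintro ⟨e, he, v, ⟨hv, rfl⟩, rfl⟩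
    exact ⟨⟨v, hv, rfl⟩, by rw [card_orb]; omega⟩
  · rintro ⟨⟨v, hv, rfl⟩, hr⟩
    rw [card_orb] at hr
    exact ⟨_, ⟨deg_pos v, by omega⟩, v, ⟨hv, rfl⟩, rfl⟩

theorem one_lt_card_real : (1 : ℝ) < Fintype.card K := by
  exact_mod_cast Fintype.one_lt_card

theorem two_le_card_real : (2 : ℝ) ≤ Fintype.card K := by
  exact_mod_cast Fintype.one_lt_card (α := K)

/-- A geometric tail. -/
theorem sum_Ico_inv_pow_le {x : ℝ} (hx : 2 ≤ x) (a b : ℕ) :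
    ∑ e ∈ Finset.Ico a b, (x ^ e)⁻¹ ≤ 2 * (x ^ a)⁻¹ := by
  have h := geom_sum_Ico_le_of_lt_one (x := x⁻¹) (m := a) (n := b) (by positivity)
    (inv_lt_one_of_one_lt₀ (by linarith))
  simp only [inv_pow] at h
  refine h.trans ?_
  rw [div_le_iff₀ (by rw [sub_pos]; exact inv_lt_one_of_one_lt₀ (by linarith))]
  have h1 : x⁻¹ ≤ 1 / 2 := by
    rw [inv_eq_one_div]
    exact one_div_le_one_div_of_le (by norm_num) hx
  have h2 : 0 ≤ (x ^ a)⁻¹ := by positivity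
  nlinarith

theorem card_degPts_mul_le (e : ℕ) :
    ((degPts K L e).card : ℝ) * ((Fintype.card K : ℝ) ^ (3 * e))⁻¹ ≤
      2 * ((Fintype.card K : ℝ) ^ e)⁻¹ := by
  have hq : (0 : ℝ) < Fintype.card K := by linarith [one_lt_card_real (K := K)]
  have h : ((degPts K L e).card : ℝ) ≤ 2 * (Fintype.card K : ℝ) ^ (2 * e) := by
    exact_mod_cast card_degPts_le e
  refine (mul_le_mul_of_nonneg_right h (by positivity)).trans (le_of_eq ?_)
  rw [show 3 * e = 2 * e + e by ring, pow_add]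
  field_simp

/-- At most 2 q^(2e) closed points of degree e, each counted with q^(-3e), give a geometric series
in 1/q. The factor 1/q on the right keeps the exponential in the sieve bounded, where the tail is
weighted with t = q. -/
theorem sum_closedPts_le (r : ℕ) :
    ∑ Q ∈ closedPts K L r, ((Fintype.card K : ℝ) ^ (3 * Q.card))⁻¹ ≤ 4 * (Fintype.card K : ℝ)⁻¹ := by
  classical
  have hq := two_le_card_real (K := K)
  rw [closedPts]
  calc _ ≤ ∑ e ∈ Finset.Ico 1 (r + 1), ∑ Q ∈ (degPts K L e).image (orb K),
        ((Fintype.card K : ℝ) ^ (3 * Q.card))⁻¹ :=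
        (Finset.sum_biUnion fun e _ e' _ h => Finset.disjoint_left.2 fun Q hQ hQ' => by
          obtain ⟨v, hv, rfl⟩ := Finset.mem_image.1 hQ
          obtain ⟨w, hw, hvw⟩ := Finset.mem_image.1 hQ'
          have := congrArg Finset.card hvw
          rw [card_orb, card_orb, (mem_degPts.1 hv).2, (mem_degPts.1 hw).2] at this
          exact h this.symm).le
    _ ≤ ∑ e ∈ Finset.Ico 1 (r + 1), 2 * ((Fintype.card K : ℝ) ^ e)⁻¹ := by
        refine Finset.sum_le_sum fun e _ => le_trans ?_ (card_degPts_mul_le (L := L) e)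
        refine (Finset.sum_le_card_nsmul _ _ ((Fintype.card K : ℝ) ^ (3 * e))⁻¹
          fun Q hQ => ?_).trans ?_
        · obtain ⟨v, hv, rfl⟩ := Finset.mem_image.1 hQ
          rw [card_orb, (mem_degPts.1 hv).2]
        · rw [nsmul_eq_mul]
          exact mul_le_mul_of_nonneg_right (by exact_mod_cast Finset.card_image_le)
            (by positivity)
    _ ≤ _ := by
        rw [← Finset.mul_sum]
        have := sum_Ico_inv_pow_le hq 1 (r + 1)
        rw [pow_one] at this
        linarith

end ClosedPointCounts

/-! ### Singular points of low and medium degree -/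

section LowDegree

variable {K : Type*} [Field K] [Fintype K] {L : Type*} [Field L] [Algebra K L]
  [Algebra.IsAlgebraic K L]

theorem exp_neg_two_mul_le {x : ℝ} (h0 : 0 ≤ x) (h1 : x ≤ 1 / 2) :
    Real.exp (-(2 * x)) ≤ 1 - x := by
  rw [Real.exp_neg]
  have h := Real.add_one_le_exp (2 * x)
  have h2 : (Real.exp (2 * x))⁻¹ ≤ (2 * x + 1)⁻¹ := inv_anti₀ (by positivity) h
  refine h2.trans ?_
  rw [inv_le_iff_one_le_mul₀ (by positivity)]
  nlinarith

variable (K L) in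
/-- The product of the local factors at the closed points of degree at most `r`. -/
noncomputable def eulerProd (r : ℕ) : ℝ :=
  ∏ Q ∈ closedPts K L r, (1 - ((Fintype.card K : ℝ) ^ (3 * Q.card))⁻¹)

theorem inv_pow_card_le {Q : Finset (Fin 3 → L)} (hQ : IsClosedPt K Q) :
    ((Fintype.card K : ℝ) ^ (3 * Q.card))⁻¹ ≤ 1 / 2 := by
  have hq := two_le_card_real (K := K)
  rw [inv_eq_one_div]
  refine one_div_le_one_div_of_le (by norm_num) ?_
  have := hQ.card_pos
  calc (2 : ℝ) ≤ Fintype.card K := hq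
    _ = (Fintype.card K : ℝ) ^ 1 := (pow_one _).symm
    _ ≤ _ := pow_le_pow_right₀ (by linarith) (by omega)

/-- Uses 1 - y ≥ exp(-2y) for 0 ≤ y ≤ 1/2. The bound depends on neither K nor r, so the sieve leaves
a positive proportion of forms. -/
theorem exp_le_eulerProd (r : ℕ) : Real.exp (-4) ≤ eulerProd K L r := by
  have hq := two_le_card_real (K := K)
  have h : Real.exp (-(2 * ∑ Q ∈ closedPts K L r, ((Fintype.card K : ℝ) ^ (3 * Q.card))⁻¹)) ≤
      eulerProd K L r := by
    rw [Finset.mul_sum, ← Finset.sum_neg_distrib, Real.exp_sum, eulerProd]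
    exact Finset.prod_le_prod (fun _ _ => (Real.exp_pos _).le) fun Q hQ =>
      exp_neg_two_mul_le (by positivity) (inv_pow_card_le (mem_closedPts.1 hQ).1)
  refine le_trans (Real.exp_le_exp.2 ?_) h
  have h1 := sum_closedPts_le (K := K) (L := L) r
  have h2 : (Fintype.card K : ℝ)⁻¹ ≤ 1 / 2 := by
    rw [inv_eq_one_div]
    exact one_div_le_one_div_of_le (by norm_num) hq
  linarith

/-- The probability that a normalized vector is a zero of a smooth form. -/
noncomputable def rho (q : ℕ) : ℝ := ((q : ℝ) + 1) / ((q : ℝ) ^ 2 + q + 1)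

variable (L) in
theorem abs_prob_low_sub_le {d j r : ℕ} (hr : 1 ≤ r) (Z : Finset (Fin 3 → K))
    (hZ : ∀ v ∈ Z, Nrm v) (hd : Z.card + 2 * ((j + 1) * r) ≤ d + 1) :
    |prob K d (fun F => (∀ v ∈ Z, eval v F = 0) ∧
        ∀ v : Fin 3 → L, Nrm v → deg K v ≤ r → ¬ SingAt F v) -
      eulerProd K L r * rho (Fintype.card K) ^ Z.card| ≤
      2 * Real.exp 4 * ((Fintype.card K : ℝ) ^ (j + 1))⁻¹ := by
  classical
  have hq := two_le_card_real (K := K)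
  set q : ℝ := ((Fintype.card K : ℕ) : ℝ) with hqdef
  have h := abs_prob_sub_le (j := j) Z hZ (closedPts K L r) (fun Q hQ => (mem_closedPts.1 hQ).1)
    (fun Q hQ => (mem_closedPts.1 hQ).2) hd
  have e1 : prob K d (fun F => (∀ v ∈ Z, eval v F = 0) ∧
      ∀ v : Fin 3 → L, Nrm v → deg K v ≤ r → ¬ SingAt F v) =
      prob K d (fun F => (∀ v ∈ Z, eval v F = 0) ∧ ∀ Q ∈ closedPts K L r, ¬ SingOn F Q) := by
    congr 1
    funext F
    refine propext (and_congr_right fun _ => ⟨fun h Q hQ => ?_, fun h v hv hvr => ?_⟩)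
    · obtain ⟨⟨v, hv, rfl⟩, hQr⟩ := mem_closedPts.1 hQ
      rw [singOn_orb]
      exact h v hv (by rwa [card_orb] at hQr)
    · rw [← singOn_orb (K := K)]
      exact h _ (mem_closedPts.2 ⟨⟨v, hv, rfl⟩, by rwa [card_orb]⟩)
  set I : Finset (Finset (Fin 3 → L)) := Z.image fun v => {lift L v} with hI
  have hIsub : I ⊆ closedPts K L r := by
    intro Q hQ
    obtain ⟨v, hv, rfl⟩ := Finset.mem_image.1 hQ
    exact mem_closedPts.2 ⟨isClosedPt_lift (hZ v hv), by simpa using hr⟩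
  have hIcard : I.card = Z.card := Finset.card_image_of_injective _ fun v w hvw =>
    lift_injective (Finset.singleton_injective hvw)
  have hIone : ∀ Q ∈ I, Q.card = 1 := by
    intro Q hQ
    obtain ⟨v, hv, rfl⟩ := Finset.mem_image.1 hQ
    exact Finset.card_singleton _
  have e2 : (q ^ Z.card)⁻¹ * ∏ Q ∈ closedPts K L r, (1 - (q ^ (3 * Q.card))⁻¹ *
      (if Q ∈ I then q else 1)) = eulerProd K L r * rho (Fintype.card K) ^ Z.card := by
    rw [eulerProd, ← Finset.prod_sdiff hIsub, ← Finset.prod_sdiff hIsub]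
    have f1 : ∏ Q ∈ closedPts K L r \ I, (1 - (q ^ (3 * Q.card))⁻¹ * (if Q ∈ I then q else 1)) =
        ∏ Q ∈ closedPts K L r \ I, (1 - (q ^ (3 * Q.card))⁻¹) :=
      Finset.prod_congr rfl fun Q hQ => by rw [if_neg (Finset.mem_sdiff.1 hQ).2, mul_one]
    have f2 : ∏ Q ∈ I, (1 - (q ^ (3 * Q.card))⁻¹ * (if Q ∈ I then q else 1)) =
        (1 - (q ^ 3)⁻¹ * q) ^ Z.card := by
      rw [← hIcard, ← Finset.prod_const]
      exact Finset.prod_congr rfl fun Q hQ => by rw [if_pos hQ, hIone Q hQ, mul_one]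
    have f3 : ∏ Q ∈ I, (1 - (q ^ (3 * Q.card))⁻¹) = (1 - (q ^ 3)⁻¹) ^ Z.card := by
      rw [← hIcard, ← Finset.prod_const]
      exact Finset.prod_congr rfl fun Q hQ => by rw [hIone Q hQ, mul_one]
    -- The computation that produces the model: at a rational point, q^(-1) (1 - q^(-2)) is the
    -- local probability of vanishing without being singular, 1 - q^(-3) that of not being singular,
    -- and the quotient is `rho`.
    have f4 : q⁻¹ * (1 - (q ^ 3)⁻¹ * q) = (1 - (q ^ 3)⁻¹) * rho (Fintype.card K) := by
      rw [rho, ← hqdef]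
      have : q ^ 2 + q + 1 ≠ 0 := by positivity
      have : q ≠ 0 := by positivity
      field_simp
      ring
    rw [f1, f2, f3, mul_left_comm, ← inv_pow, ← mul_pow, f4, mul_pow, mul_assoc]
  rw [e1, ← e2]
  refine h.trans ?_
  rw [mul_assoc, mul_comm (Real.exp 4)]
  refine mul_le_mul_of_nonneg_left (mul_le_mul_of_nonneg_left (Real.exp_le_exp.2 ?_)
    (by positivity)) (by norm_num)
  have := mul_le_mul_of_nonneg_left (sum_closedPts_le (K := K) (L := L) r)
    (show 0 ≤ q by linarith)
  rw [← hqdef] at this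
  refine this.trans (le_of_eq ?_)
  have : q ≠ 0 := by positivity
  field_simp

variable (K L) in
/-- Singular points of medium degree are rare. -/
theorem prob_medium_le (d r : ℕ) :
    prob K d (fun F => ∃ v : Fin 3 → L, Nrm v ∧ r < deg K v ∧ 2 * deg K v ≤ d + 1 ∧ SingAt F v) ≤
      4 * ((Fintype.card K : ℝ) ^ (r + 1))⁻¹ := by
  classical
  have hq := two_le_card_real (K := K)
  have h1 : prob K d (fun F => ∃ v : Fin 3 → L, Nrm v ∧ r < deg K v ∧ 2 * deg K v ≤ d + 1 ∧
      SingAt F v) ≤ prob K d (fun F => ∃ e ∈ Finset.Ico (r + 1) (d + 2), ∃ v ∈ degPts K L e,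
        2 * e ≤ d + 1 ∧ SingAt F v) := by
    refine prob_mono fun F _ => ?_
    rintro ⟨v, hv, hr, hd, hs⟩
    have := deg_pos (K := K) v
    exact ⟨deg K v, Finset.mem_Ico.2 ⟨hr, by omega⟩, v, mem_degPts.2 ⟨hv, rfl⟩, hd, hs⟩
  refine h1.trans ((prob_exists_le _ _ _).trans ?_)
  have h2 : ∀ e ∈ Finset.Ico (r + 1) (d + 2), prob K d (fun F => ∃ v ∈ degPts K L e,
      2 * e ≤ d + 1 ∧ SingAt F v) ≤ 2 * ((Fintype.card K : ℝ) ^ e)⁻¹ := by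
    intro e _
    refine (prob_exists_le _ _ _).trans (le_trans ?_ (card_degPts_mul_le (L := L) e))
    rw [← nsmul_eq_mul]
    refine Finset.sum_le_card_nsmul _ _ _ fun v hv => ?_
    obtain ⟨hv', rfl⟩ := mem_degPts.1 hv
    by_cases hd : 2 * deg K v ≤ d + 1
    · have := prob_le_of_card_mul_le (M := 1) (pow_pos Fintype.card_pos _)
        (by simpa using card_singAt_mul_le hv' hd)
      push_cast at this
      simpa [hd] using this
    · rw [prob_eq]
      simp [hd]
  refine (Finset.sum_le_sum h2).trans ?_
  rw [← Finset.mul_sum]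
  linarith [sum_Ico_inv_pow_le hq (r + 1) (d + 2)]

end LowDegree

/-! ### A weak Bézout theorem, and averaging over translates -/

section Bezout

variable {K : Type*} [Field K] [Fintype K] {L : Type*} [Field L] [Algebra K L]

theorem homogeneousComponent_mul_of_isHomogeneous {R : Type*} [CommSemiring R] {m s : ℕ}
    {A : MvPolynomial (Fin 3) R} (hA : A.IsHomogeneous m) (T : MvPolynomial (Fin 3) R) :
    homogeneousComponent (m + s) (A * T) = A * homogeneousComponent s T := by
  let := gradedAlgebra (σ := Fin 3) (R := R)
  have h := DirectSum.coe_decompose_mul_add_of_left_mem (homogeneousSubmodule (Fin 3) R)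
    (i := m) (j := s) (a := A) (b := T) ((mem_homogeneousSubmodule _ _).2 hA)
  have hc : ∀ n (p : MvPolynomial (Fin 3) R),
    (DirectSum.decompose (homogeneousSubmodule (Fin 3) R) p n : MvPolynomial (Fin 3) R) =
      homogeneousComponent n p := fun n p => decomposition.decompose'_apply p n
  rwa [hc, hc] at h

theorem IsHomogeneous.exists_mul_of_dvd {R : Type*} [CommSemiring R] {m s : ℕ}
    {A Q : MvPolynomial (Fin 3) R} (hA : A.IsHomogeneous m) (hQ : Q.IsHomogeneous (m + s))
    (h : A ∣ Q) : ∃ T : MvPolynomial (Fin 3) R, T.IsHomogeneous s ∧ Q = A * T := by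
  obtain ⟨T, rfl⟩ := h
  exact ⟨homogeneousComponent s T, homogeneousComponent_isHomogeneous _ _, by
    rw [← homogeneousComponent_mul_of_isHomogeneous hA, homogeneousComponent_eq_self hQ]⟩

/-- A weak form of Bézout's theorem: two forms of degree `m` without common factor have at most
`m ^ 2` common zeros in the projective plane. -/
theorem card_common_zeros_le {m : ℕ} {A B : MvPolynomial (Fin 3) K} (hA : A.IsHomogeneous m)
    (hB : B.IsHomogeneous m) (hA0 : A ≠ 0) (hrel : IsRelPrime A B) (S : Finset (Fin 3 → L))
    (hS : Nonprop (S : Set (Fin 3 → L))) (h : ∀ v ∈ S, aeval v A = 0 ∧ aeval v B = 0) :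
    S.card ≤ m ^ 2 := by
  classical
  set s := S.card with hs
  -- Count the forms A P + B Q of degree 2m + s. They vanish on S, which imposes s independent
  -- conditions in this degree, and by coprimality the relations are the multiples of (-B, A).
  -- Comparing exponents of q bounds s by the second difference, with step m, of `(i + 2).choose 2`,
  -- which is m².
  let f : MvPolynomial (Fin 3) K × MvPolynomial (Fin 3) K →+ MvPolynomial (Fin 3) K :=
    (AddMonoidHom.mulLeft A).coprod (AddMonoidHom.mulLeft B)
  have hf : ∀ x, f x = A * x.1 + B * x.2 := fun x => rfl
  let T := {F ∈ forms K (2 * m + s) | ∀ v ∈ S, aeval v F = 0}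
  have h1 := card_le_card_ker_mul (forms K (m + s) ×ˢ forms K (m + s)) (fun x hx y hy => by
    simp only [Finset.mem_product, mem_forms] at hx hy ⊢
    exact ⟨hx.1.sub hy.1, hx.2.sub hy.2⟩) f T (fun x hx => by
    simp only [Finset.mem_product, mem_forms] at hx
    simp only [T, Finset.mem_filter, mem_forms, hf]
    refine ⟨?_, fun v hv => by simp [h v hv]⟩
    have e : 2 * m + s = m + (m + s) := by ring
    rw [e]
    exact (hA.mul hx.1).add (hB.mul hx.2))
  have h2 : T.card * Fintype.card K ^ s ≤ (forms K (2 * m + s)).card := by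
    have := card_vanish_sing_mul_le (K := K) (S₀ := S) (S₁ := ∅) (d := 2 * m + s) (by simp)
      (by simpa using hS) (by simp; omega)
    simpa [T, ← hs] using this
  have h3 : {x ∈ forms K (m + s) ×ˢ forms K (m + s) | f x = 0}.card ≤ (forms K s).card := by
    refine (Finset.card_le_card fun x hx => ?_).trans
      (Finset.card_image_le (s := forms K s) (f := fun U => (-(B * U), A * U)))
    simp only [Finset.mem_filter, Finset.mem_product, mem_forms, hf] at hx
    obtain ⟨⟨hP, hQ⟩, h0⟩ := hx
    have hdvd : A ∣ x.2 := hrel.dvd_of_dvd_mul_left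
      ((dvd_add_right (dvd_mul_right A x.1)).1 (h0 ▸ dvd_zero A))
    obtain ⟨U, hU, hU2⟩ := IsHomogeneous.exists_mul_of_dvd hA hQ hdvd
    refine Finset.mem_image.2 ⟨U, mem_forms.2 hU, Prod.ext ?_ hU2.symm⟩
    refine mul_left_cancel₀ hA0 ?_
    rw [hU2] at h0
    linear_combination -h0
  rw [Finset.card_product] at h1
  have h4 : Fintype.card K ^ ((m + s + 2).choose 2 + (m + s + 2).choose 2 + s) ≤
      Fintype.card K ^ ((s + 2).choose 2 + (2 * m + s + 2).choose 2) := by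
    rw [pow_add, pow_add, pow_add, ← card_forms, ← card_forms, ← card_forms]
    have h6 := Nat.mul_le_mul_right (Fintype.card K ^ s) (h1.trans
      (Nat.mul_le_mul_right _ (m := (forms K s).card) (by convert h3)))
    rw [mul_assoc (forms K s).card] at h6
    exact h6.trans (Nat.mul_le_mul_left _ h2)
  have h5 := (Nat.pow_le_pow_iff_right (Fintype.one_lt_card (α := K))).1 h4
  have e : ∀ n : ℕ, 2 * (n + 2).choose 2 = (n + 2) * (n + 1) := fun n => by
    rw [Nat.choose_two_right, Nat.mul_div_cancel' (by
      rw [show n + 2 - 1 = n + 1 by omega, mul_comm]; exact (Nat.even_mul_succ_self (n + 1)).two_dvd)]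
    rfl
  have e1 := e (m + s)
  have e2 := e s
  have e3 := e (2 * m + s)
  nlinarith

open Classical in
/-- If for every form few of its translates by a family of forms have a property, then the
property is unlikely. -/
theorem prob_le_of_translates {ι : Type*} [Fintype ι] [Nonempty ι] {d c : ℕ}
    {p : MvPolynomial (Fin 3) K → Prop} (u : ι → MvPolynomial (Fin 3) K)
    (hu : ∀ i, (u i).IsHomogeneous d)
    (h : ∀ F ∈ forms K d, {i | p (F + u i)}.ncard ≤ c) :
    prob K d p ≤ (c : ℝ) / Fintype.card ι := by
  refine prob_le_of_card_mul_le Fintype.card_pos ?_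
  have h1 : ∀ i, {F ∈ forms K d | p F}.card = {F ∈ forms K d | p (F + u i)}.card := fun i => by
    refine Finset.card_bij' (fun F _ => F - u i) (fun F _ => F + u i) ?_ ?_ ?_ ?_
    · intro F hF
      simp only [Finset.mem_filter, mem_forms, sub_add_cancel] at hF ⊢
      exact ⟨hF.1.sub (hu i), hF.2⟩
    · intro F hF
      simp only [Finset.mem_filter, mem_forms] at hF ⊢
      exact ⟨hF.1.add (hu i), hF.2⟩
    · simp
    · simp
  calc _ = ∑ i : ι, {F ∈ forms K d | p (F + u i)}.card := by
        rw [← Finset.sum_congr rfl fun i _ => h1 i]; simp [mul_comm]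
    _ = ∑ F ∈ forms K d, {i | p (F + u i)}.ncard := by
        simp_rw [Finset.card_filter]
        rw [Finset.sum_comm]
        refine Finset.sum_congr rfl fun F _ => ?_
        rw [← Finset.card_filter, Set.ncard_eq_toFinset_card']
        congr 1
        ext
        simp
    _ ≤ _ := by
        rw [mul_comm, ← smul_eq_mul]
        exact Finset.sum_le_card_nsmul _ _ _ h

end Bezout

/-! ### Perturbing derivatives by binary forms -/

section Perturbation

variable {K : Type*} [Field K] {L : Type*} [Field L] [Algebra K L]

/-- The exponents at most `d` that are not divisible by `p`. -/
def nonMultiples (p d : ℕ) : Finset ℕ := {i ∈ Finset.range (d + 1) | ¬ p ∣ i}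

theorem card_nonMultiples {p : ℕ} (d : ℕ) : (nonMultiples p d).card = d - d / p := by
  have h1 : (nonMultiples p d).card + {i ∈ Finset.range (d + 1) | p ∣ i}.card = d + 1 := by
    rw [add_comm, nonMultiples, Finset.card_filter_add_card_filter_not, Finset.card_range]
  have h2 : {i ∈ Finset.range (d + 1) | p ∣ i}.card = d / p + 1 := by
    rw [← Nat.card_multiples' d p]
    have : {i ∈ Finset.range (d + 1) | p ∣ i} =
        insert 0 {k ∈ Finset.range d.succ | k ≠ 0 ∧ p ∣ k} := by
      ext i
      rcases eq_or_ne i 0 with rfl | hi <;> simp_all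
    rw [this, Finset.card_insert_of_notMem (by simp)]
  omega

/-- A form in two of the variables, without monomials in which the exponent of the first one is
divisible by `p`. -/
noncomputable def binaryForm (x y : Fin 3) (p d : ℕ) (c : nonMultiples p d → K) :
    MvPolynomial (Fin 3) K :=
  ∑ i, C (c i) * (X x ^ i.1 * X y ^ (d - i.1))

theorem isHomogeneous_binaryForm (x y : Fin 3) (p d : ℕ) (c : nonMultiples p d → K) :
    (binaryForm x y p d c).IsHomogeneous d := by
  refine IsHomogeneous.sum _ _ _ fun i _ => ?_
  have hi : i.1 ≤ d := by
    have := i.2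
    simp only [nonMultiples, Finset.mem_filter, Finset.mem_range] at this
    omega
  have := (isHomogeneous_C (Fin 3) (c i)).mul
    ((isHomogeneous_X_pow (R := K) x i.1).mul (isHomogeneous_X_pow (R := K) y (d - i.1)))
  rwa [show 0 + (i.1 + (d - i.1)) = d by omega] at this

theorem binaryForm_sub (x y : Fin 3) (p d : ℕ) (c c' : nonMultiples p d → K) :
    binaryForm x y p d (c - c') = binaryForm x y p d c - binaryForm x y p d c' := by
  simp [binaryForm, sub_mul]

theorem pderiv_binaryForm_of_ne {x y z : Fin 3} (hx : z ≠ x) (hy : z ≠ y) (p d : ℕ)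
    (c : nonMultiples p d → K) : pderiv z (binaryForm x y p d c) = 0 := by
  simp [binaryForm, Derivation.leibniz, Derivation.leibniz_pow, pderiv_X_of_ne hx.symm,
    pderiv_X_of_ne hy.symm]

theorem pderiv_binaryForm {x y : Fin 3} (hxy : x ≠ y) (p d : ℕ)
    (c : nonMultiples p d → K) : pderiv x (binaryForm x y p d c) =
      ∑ i, C (c i * (i.1 : K)) * (X x ^ (i.1 - 1) * X y ^ (d - i.1)) := by
  rw [binaryForm, map_sum]
  refine Finset.sum_congr rfl fun i _ => ?_
  simp [Derivation.leibniz, Derivation.leibniz_pow, pderiv_X_of_ne hxy.symm]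
  ring

theorem degreeOf_pderiv_binaryForm {x y z : Fin 3} (hxy : x ≠ y) (hx : z ≠ x) (hy : z ≠ y)
    (p d : ℕ) (c : nonMultiples p d → K) :
    degreeOf z (pderiv x (binaryForm x y p d c)) = 0 := by
  have h : pderiv x (binaryForm x y p d c) ∈ supported K ({x, y} : Set (Fin 3)) := by
    rw [pderiv_binaryForm hxy]
    refine sum_mem fun i _ => mul_mem (Subalgebra.algebraMap_mem _ _) (mul_mem (pow_mem ?_ _)
      (pow_mem ?_ _)) <;> rw [X_mem_supported] <;> simp
  rw [mem_supported] at h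
  rw [degreeOf_def, Multiset.count_eq_zero, ← Multiset.mem_toFinset, ← vars_def]
  intro hz
  have := h hz
  simp_all

/-- On the line y = 1, z = 0 the derivative is ∑ i c_i T^(i-1), and i is invertible in K because p
does not divide it. Exponents divisible by p are excluded since the derivative would not see them.
-/
theorem eq_zero_of_forall_aeval_pderiv_binaryForm [Infinite L] {x y z : Fin 3} (hxy : x ≠ y)
    (hx : z ≠ x) (hy : z ≠ y) {p d : ℕ} [CharP K p] {c : nonMultiples p d → K}
    (h : ∀ v : Fin 3 → L, v z = 0 → aeval v (pderiv x (binaryForm x y p d c)) = 0) : c = 0 := by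
  classical
  have hpos : ∀ i : nonMultiples p d, i.1 ≠ 0 ∧ (i.1 : K) ≠ 0 := fun i => by
    have := i.2
    simp only [nonMultiples, Finset.mem_filter, Finset.mem_range] at this
    refine ⟨?_, fun h => this.2 ((CharP.cast_eq_zero_iff K p _).1 h)⟩
    rintro h
    exact this.2 (h ▸ dvd_zero p)
  let f : Polynomial L :=
    ∑ i : nonMultiples p d, Polynomial.monomial (i.1 - 1) (algebraMap K L (c i * (i.1 : K)))
  have hf : f = 0 := by
    refine Polynomial.funext fun t => ?_
    have := h (Function.update (Function.update 0 x t) y 1) (by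
      rw [Function.update_of_ne hy, Function.update_of_ne hx, Pi.zero_apply])
    rw [pderiv_binaryForm hxy, map_sum] at this
    simp only [f, Polynomial.eval_finsetSum, Polynomial.eval_monomial, Polynomial.eval_zero]
    rw [← this]
    refine Finset.sum_congr rfl fun i _ => ?_
    simp [Function.update_of_ne hxy]
  funext i
  have h1 : f.coeff (i.1 - 1) = algebraMap K L (c i * (i.1 : K)) := by
    simp only [f, Polynomial.finsetSum_coeff, Polynomial.coeff_monomial]
    rw [Finset.sum_eq_single i, if_pos rfl]
    · intro j _ hji
      refine if_neg fun h => hji (Subtype.ext ?_)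
      have := (hpos i).1
      have := (hpos j).1
      omega
    · simp
  rw [hf, Polynomial.coeff_zero, eq_comm, map_eq_zero, mul_eq_zero] at h1
  exact h1.resolve_right (hpos i).2

end Perturbation

/-! ### Common factors that involve a single variable -/

section CommonFactors

variable {K : Type*} [Field K] {L : Type*} [Field L] [Algebra K L]

theorem degreeOf_le_of_dvd {V W : MvPolynomial (Fin 3) K} (hW : W ≠ 0) (h : V ∣ W) (i : Fin 3) :
    degreeOf i V ≤ degreeOf i W := by
  obtain ⟨U, rfl⟩ := h
  rw [degreeOf_mul_eq (left_ne_zero_of_mul hW) (right_ne_zero_of_mul hW)]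
  exact Nat.le_add_right _ _

/-- An irreducible factor of a form that involves at most the variable `c` forces the form to
vanish where that variable does. -/
theorem aeval_eq_zero_of_dvd [IsAlgClosed L] {a b c : Fin 3} (habc : ∀ i, i = a ∨ i = b ∨ i = c)
    {V G : MvPolynomial (Fin 3) K} {d : ℕ} (hG : G.IsHomogeneous d) (hV : Irreducible V)
    (ha : degreeOf a V = 0) (hb : degreeOf b V = 0) (hVG : V ∣ G) {x : Fin 3 → L}
    (hx : x c = 0) : aeval x G = 0 := by
  classical
  have hvars : ∀ i ∈ V.vars, i = c := fun i hi => by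
    rw [vars_def, Multiset.mem_toFinset] at hi
    rw [degreeOf_def, Multiset.count_eq_zero] at ha hb
    rcases habc i with rfl | rfl | rfl
    exacts [absurd hi ha, absurd hi hb, rfl]
  let f : Polynomial L := aeval (fun _ => Polynomial.X) V
  have hf : ∀ v : Fin 3 → L, aeval v V = f.eval (v c) := fun v => by
    have h1 : f.eval (v c) = aeval (fun _ => v c) V := by
      change (Polynomial.evalRingHom (v c)) (aeval _ V) = _
      rw [MvPolynomial.map_aeval, aeval_def, coe_eval₂Hom]
      congr 1
      · ext t
        simp
      · simp
    rw [h1, aeval_def, aeval_def, ← coe_eval₂Hom, ← coe_eval₂Hom]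
    exact eval₂Hom_congr' rfl (fun i hi _ => by rw [hvars i hi]) rfl
  -- V involves at most the variable c and is not constant, so over the algebraically closed field L
  -- it has a root.
  have hroot : ∃ t, f.eval t = 0 := by
    by_contra hno
    have hdeg : f.degree = 0 := by
      by_contra h0
      obtain ⟨t, ht⟩ := IsAlgClosed.exists_root f h0
      exact hno ⟨t, ht⟩
    have hfC := Polynomial.eq_C_of_degree_eq_zero hdeg
    have hmap : map (algebraMap K L) V = C (f.coeff 0) := by
      have : Infinite L := IsAlgClosed.instInfinite
      refine MvPolynomial.funext fun v => ?_
      rw [eval_map_algebraMap, hf, hfC]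
      simp
    have hVC : V = C (coeff 0 V) := by
      ext m
      rw [coeff_C]
      split_ifs with hm
      · rw [← hm]
      · refine (algebraMap K L).injective ?_
        rw [← coeff_map, hmap, coeff_C, if_neg hm, map_zero]
    refine hV.not_isUnit (hVC ▸ (IsUnit.mk0 _ fun h0 => hV.ne_zero ?_).map C)
    rw [hVC, h0, C_0]
  obtain ⟨t, ht⟩ := hroot
  have hzero : ∀ v : Fin 3 → L, v c = t → aeval v G = 0 := fun v hv => by
    obtain ⟨U, rfl⟩ := hVG
    rw [map_mul, hf, hv, ht, zero_mul]
  by_cases ht0 : t = 0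
  · exact hzero x (hx.trans ht0.symm)
  -- For t ≠ 0, scaling carries the plane x c = t to the planes x c = s with s ≠ 0, so G vanishes on
  -- all of these. As a polynomial in the coordinate c alone, with the others fixed, it is therefore
  -- zero, also at s = 0.
  let g : Polynomial L := aeval (fun i => if i = c then Polynomial.X else Polynomial.C (x i)) G
  have hg : ∀ s, g.eval s = aeval (Function.update x c s) G := fun s => by
    change (Polynomial.evalRingHom s) (aeval _ G) = _
    rw [MvPolynomial.map_aeval, aeval_def, coe_eval₂Hom]
    congr 1
    · ext t
      simp
    · funext i
      rcases eq_or_ne i c with rfl | hi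
      · simp
      · simp [hi]
  have hg0 : g = 0 := by
    have : Infinite L := IsAlgClosed.instInfinite
    refine Polynomial.eq_zero_of_infinite_isRoot g ?_
    refine ((Set.finite_singleton (0 : L)).infinite_compl).mono fun s hs => ?_
    have hs : s ≠ 0 := hs
    change g.eval s = 0
    rw [hg, show Function.update x c s = (s / t) • ((t / s) • Function.update x c s) by
      rw [smul_smul, div_mul_div_cancel₀ ht0, div_self hs, one_smul],
      aeval_smul_of_isHomogeneous hG, hzero _ (by simp [hs]), mul_zero]
  have := hg 0
  rw [hg0, Polynomial.eval_zero, Function.update_eq_self_iff.2 hx.symm] at this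
  exact this.symm

end CommonFactors

/-! ### Coprimality of two partial derivatives -/

section HighDegree

variable {K : Type*} [Field K] [Fintype K]

/-- Adding a binary form in b and c keeps ∂_a F and changes ∂_b F by a polynomial free of the
variable a. An irreducible V common to two different translates would divide the nonzero difference,
although V involves a. So the bad translates yield pairwise coprime factors of ∂_a F of positive
degree in a, and there are at most d of them. -/
theorem prob_common_factor_le {a b c : Fin 3} (hab : a ≠ b) (hac : a ≠ c) (hbc : b ≠ c) (p d : ℕ)
    [CharP K p] :
    prob K d (fun F => pderiv a F ≠ 0 ∧ ∃ V, Irreducible V ∧ degreeOf a V ≠ 0 ∧ V ∣ pderiv a F ∧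
      V ∣ pderiv b F) ≤ (d : ℝ) / Fintype.card K ^ (d - d / p) := by
  classical
  refine (prob_le_of_translates (c := d) (binaryForm b c p d)
    (isHomogeneous_binaryForm b c p d) fun F hF => ?_).trans_eq ?_
  · simp only [map_add, pderiv_binaryForm_of_ne hab hac, add_zero]
    by_cases h0 : pderiv a F = 0
    · simp [h0]
    rw [Set.ncard_eq_toFinset_card']
    set T := Set.toFinset {i | pderiv a F ≠ 0 ∧ ∃ V, Irreducible V ∧ degreeOf a V ≠ 0 ∧
      V ∣ pderiv a F ∧ V ∣ pderiv b F + pderiv b (binaryForm b c p d i)} with hT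
    have hex : ∀ i ∈ T, ∃ V, Irreducible V ∧ degreeOf a V ≠ 0 ∧
      V ∣ pderiv a F ∧ V ∣ pderiv b F + pderiv b (binaryForm b c p d i) := fun i hi => by
      simp only [hT, Set.mem_toFinset] at hi
      exact hi.2
    choose! V hirr hdeg hdvd1 hdvd2 using hex
    have hdvd : ∏ i ∈ T, V i ∣ pderiv a F := by
      refine Finset.prod_dvd_of_isRelPrime (fun i hi j hj hij => ?_) hdvd1
      change IsRelPrime (V i) (V j)
      rw [(hirr i hi).isRelPrime_iff_not_dvd]
      intro hVV
      have h1 : V i ∣ pderiv b (binaryForm b c p d (i - j)) := by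
        have := dvd_sub (hdvd2 i hi) (hVV.trans (hdvd2 j hj))
        rwa [add_sub_add_left_eq_sub, ← map_sub, ← binaryForm_sub] at this
      have h2 : pderiv b (binaryForm b c p d (i - j)) ≠ 0 := fun h => hij <| sub_eq_zero.1 <|
        eq_zero_of_forall_aeval_pderiv_binaryForm (L := AlgebraicClosure K) hbc hab hac
          fun v _ => by rw [h, map_zero]
      have h3 := degreeOf_le_of_dvd h2 h1 a
      rw [degreeOf_pderiv_binaryForm hbc hab hac] at h3
      exact hdeg i hi (by omega)
    calc T.card = ∑ i ∈ T, 1 := by simp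
      _ ≤ ∑ i ∈ T, degreeOf a (V i) := Finset.sum_le_sum fun i hi =>
          Nat.one_le_iff_ne_zero.2 (hdeg i hi)
      _ = degreeOf a (∏ i ∈ T, V i) := (degreeOf_prod_eq _ _ fun i hi => (hirr i hi).ne_zero).symm
      _ ≤ degreeOf a (pderiv a F) := degreeOf_le_of_dvd h0 hdvd a
      _ ≤ (pderiv a F).totalDegree := degreeOf_le_totalDegree _ _
      _ ≤ d := ((mem_forms.1 hF).pderiv.totalDegree_le).trans (Nat.sub_le d 1)
  · simp [card_nonMultiples]

/-- This disposes of the common factors that involve neither a nor b, by `aeval_eq_zero_of_dvd`.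
Among the translates by binary forms in a and b at most one is bad. -/
theorem prob_pderiv_vanish_le (L : Type*) [Field L] [Algebra K L] [Infinite L] {a b c : Fin 3}
    (hab : a ≠ b) (hac : a ≠ c) (hbc : b ≠ c) (p d : ℕ) [CharP K p] :
    prob K d (fun F => ∀ x : Fin 3 → L, x c = 0 → aeval x (pderiv a F) = 0) ≤
      1 / (Fintype.card K : ℝ) ^ (d - d / p) := by
  classical
  refine (prob_le_of_translates (c := 1) (binaryForm a b p d)
    (isHomogeneous_binaryForm a b p d) fun F hF => ?_).trans_eq ?_
  · rw [Set.ncard_le_one]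
    intro i hi j hj
    refine sub_eq_zero.1 (eq_zero_of_forall_aeval_pderiv_binaryForm (L := L) hab hac.symm hbc.symm
      fun v hv => ?_)
    have := congrArg₂ (· - ·) (hi v hv) (hj v hv)
    simpa [binaryForm_sub] using this
  · simp [card_nonMultiples]

/-- Two of the partial derivatives of a form usually have no common factor. -/
theorem prob_not_isRelPrime_le {a b c : Fin 3}
    (hab : a ≠ b) (hac : a ≠ c) (hbc : b ≠ c) (p d : ℕ) [CharP K p] :
    prob K d (fun F => ¬ (pderiv a F ≠ 0 ∧ IsRelPrime (pderiv a F) (pderiv b F))) ≤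
      (2 * d + 2) / (Fintype.card K : ℝ) ^ (d - d / p) := by
  have h1 := prob_common_factor_le (K := K) hab hac hbc p d
  have h2 := prob_common_factor_le (K := K) hab.symm hbc hac p d
  have h3 := prob_pderiv_vanish_le (K := K) (AlgebraicClosure K) hab hac hbc p d
  have h4 := prob_pderiv_vanish_le (K := K) (AlgebraicClosure K) hab.symm hbc hac p d
  have hE : (2 * d + 2) / (Fintype.card K : ℝ) ^ (d - d / p) =
    ((d : ℝ) / Fintype.card K ^ (d - d / p) + d / Fintype.card K ^ (d - d / p)) +
      (1 / (Fintype.card K : ℝ) ^ (d - d / p) + 1 / (Fintype.card K : ℝ) ^ (d - d / p)) := by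
    ring
  rw [hE]
  refine le_trans (prob_mono fun F hF h => ?_) ((prob_or_le d _ _).trans (add_le_add
    ((prob_or_le d _ _).trans (add_le_add h1 h2)) ((prob_or_le d _ _).trans (add_le_add h3 h4))))
  by_contra hno
  push Not at hno
  obtain ⟨⟨n1, n2⟩, ⟨x, hxc, hx⟩, ⟨y, hyc, hy⟩⟩ := hno
  have ha0 : pderiv a F ≠ 0 := fun h => hx (by rw [h, map_zero])
  have hb0 : pderiv b F ≠ 0 := fun h => hy (by rw [h, map_zero])
  refine h ⟨ha0, WfDvdMonoid.isRelPrime_of_no_irreducible_factors (fun h => ha0 h.1)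
    fun V hV hVa hVb => ?_⟩
  have habc : ∀ i, i = a ∨ i = b ∨ i = c := by
    intro i
    clear * - hab hac hbc
    omega
  by_cases hda : degreeOf a V = 0
  · by_cases hdb : degreeOf b V = 0
    · exact hx (aeval_eq_zero_of_dvd habc (mem_forms.1 hF).pderiv hV hda hdb hVa hxc)
    · exact n2 hb0 V hV hdb hVb hVa
  · exact n1 ha0 V hV hda hVa hVb

end HighDegree

/-! ### Singular points of high degree -/

section Orbits

variable {K : Type*} [Field K] [Fintype K] {L : Type*} [Field L] [Algebra K L]
  [Algebra.IsAlgebraic K L]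

open Classical in
theorem mul_card_image_orb_le {Z : Finset (Fin 3 → L)} {e : ℕ}
    (hZ : ∀ v ∈ Z, e ≤ deg K v ∧ orb K v ⊆ Z) : e * (Z.image (orb K)).card ≤ Z.card := by
  refine Finset.mul_card_image_le_card Z e fun Q hQ => ?_
  obtain ⟨v, hv, rfl⟩ := Finset.mem_image.1 hQ
  refine ((hZ v hv).1.trans_eq (card_orb v).symm).trans (Finset.card_le_card fun w hw => ?_)
  exact Finset.mem_filter.2 ⟨(hZ v hv).2 hw, orb_eq_of_mem hw⟩

open Classical in
-- A form over K that vanishes at v vanishes at all its conjugates, and D + 1 of these impose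
-- independent conditions in degree D.
theorem card_forms_aeval_eq_zero_mul_le {v : Fin 3 → L} (hv : Nrm v) {D : ℕ} (hD : D + 1 ≤ deg K v) :
    {H ∈ forms K D | aeval v H = 0}.card * Fintype.card K ^ (D + 1) ≤ (forms K D).card := by
  rw [← card_orb] at hD
  obtain ⟨S, hS, hcard⟩ := Finset.exists_subset_card_eq hD
  have hn : ∀ w ∈ S, Nrm w := fun w hw => nrm_of_mem_orb hv (hS hw)
  have h := card_vanish_sing_mul_le (K := K) (S₀ := S) (S₁ := ∅) (d := D) (by simp)
    (nonprop_nrm.mono fun w hw => hn w (by simpa using hw)) (by simp [hcard])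
  simp only [Finset.card_empty, mul_zero, add_zero, hcard] at h
  refine le_trans (Nat.mul_le_mul_right _ (Finset.card_le_card fun H hH => ?_)) h
  simp only [Finset.mem_filter, Finset.notMem_empty, false_imp_iff, implies_true, and_true] at hH ⊢
  refine ⟨hH.1, fun w hw => ?_⟩
  obtain ⟨i, rfl⟩ := mem_orb.1 (hS hw)
  rw [aeval_frob_iterate, hH.2, zero_pow (pow_ne_zero _ Fintype.card_ne_zero)]

open Classical in
-- The p-th power map is injective in characteristic p, so subtracting one solution maps the others
-- to forms that vanish at v.
theorem card_forms_aeval_pow_eq_mul_le {v : Fin 3 → L} (hv : Nrm v) {D : ℕ}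
    (hD : D + 1 ≤ deg K v) {p : ℕ} [Fact p.Prime] [CharP K p] (t : L) :
    {H ∈ forms K D | aeval v H ^ p = t}.card * Fintype.card K ^ (D + 1) ≤ (forms K D).card := by
  refine le_trans (Nat.mul_le_mul_right _ ?_) (card_forms_aeval_eq_zero_mul_le hv hD)
  rcases Finset.eq_empty_or_nonempty {H ∈ forms K D | aeval v H ^ p = t} with h | ⟨G, hG⟩
  · rw [h]
    simp
  have : CharP L p := charP_of_injective_algebraMap (algebraMap K L).injective p
  rw [Finset.mem_filter, mem_forms] at hG
  refine Finset.card_le_card_of_injOn (fun H => H - G) (fun H hH => ?_) fun H _ H' _ h => ?_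
  · simp only [Finset.coe_filter, Set.mem_ofPred_eq, mem_forms] at hH ⊢
    refine ⟨hH.1.sub hG.1, ?_⟩
    rw [map_sub, sub_eq_zero]
    exact frobenius_inj L p (by rw [frobenius_def, frobenius_def, hH.2, hG.2])
  · simpa using h

/-- Translation by H^p X_c^(d - pD) leaves ∂_a F and ∂_b F unchanged, so the possible singular
points are common zeros of two fixed coprime forms. These make up at most (d - 1)²/e orbits of
degree at least e, rounded down, and at each one F(v) + H(v)^p = 0 holds for at most a fraction
q^(-(D+1)) of the H. -/
theorem prob_singAt_of_isRelPrime_le (L : Type*) [Field L] [Algebra K L] [Algebra.IsAlgebraic K L]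
    {a b c : Fin 3} (hac : a ≠ c) (hbc : b ≠ c)
    (p d : ℕ) [Fact p.Prime] [CharP K p] {e D : ℕ} (he : D + 1 ≤ e) (hD : p * D ≤ d) :
    prob K d (fun F => (pderiv a F ≠ 0 ∧ IsRelPrime (pderiv a F) (pderiv b F)) ∧
      ∃ v : Fin 3 → L, Nrm v ∧ v c = 1 ∧ e ≤ deg K v ∧ SingAt F v) ≤
      ((((d - 1) ^ 2 / e : ℕ) : ℝ)) / (Fintype.card K : ℝ) ^ (D + 1) := by
  classical
  let u : forms K D → MvPolynomial (Fin 3) K := fun H => H.1 ^ p * X c ^ (d - p * D)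
  have hu : ∀ H, (u H).IsHomogeneous d := fun H => by
    have := ((mem_forms.1 H.2).pow p).mul (isHomogeneous_X_pow (R := K) c (d - p * D))
    rwa [mul_comm D p, Nat.add_sub_cancel' hD] at this
  have hder : ∀ x ≠ c, ∀ H, pderiv x (u H) = 0 := fun x hx H => by
    simp [u, Derivation.leibniz, Derivation.leibniz_pow, pderiv_X_of_ne hx.symm]
  have hne : Nonempty (forms K D) := ⟨⟨0, mem_forms.2 (isHomogeneous_zero _ _ _)⟩⟩
  have hpos : 0 < Fintype.card K ^ (D + 1) := pow_pos Fintype.card_pos _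
  refine (prob_le_of_translates
    (c := (d - 1) ^ 2 / e * ((forms K D).card / Fintype.card K ^ (D + 1))) u hu
    fun F hF => ?_).trans ?_
  · simp only [map_add, hder a hac, hder b hbc, add_zero]
    by_cases h0 : pderiv a F ≠ 0 ∧ IsRelPrime (pderiv a F) (pderiv b F)
    swap
    · simp [h0]
    let Z : Set (Fin 3 → L) := {v | Nrm v ∧ v c = 1 ∧ e ≤ deg K v ∧ aeval v (pderiv a F) = 0 ∧
      aeval v (pderiv b F) = 0}
    have hbez : ∀ S : Finset (Fin 3 → L), (S : Set (Fin 3 → L)) ⊆ Z → S.card ≤ (d - 1) ^ 2 :=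
      fun S hS => card_common_zeros_le (mem_forms.1 hF).pderiv (mem_forms.1 hF).pderiv h0.1 h0.2 S
        (nonprop_nrm.mono fun v hv => (hS hv).1) fun v hv => (hS hv).2.2.2
    have hfin : Z.Finite := by
      by_contra hinf
      obtain ⟨S, hS, hc⟩ := Set.Infinite.exists_subset_card_eq hinf ((d - 1) ^ 2 + 1)
      have := hbez S hS
      omega
    have hZ : ∀ v ∈ hfin.toFinset, e ≤ deg K v ∧ orb K v ⊆ hfin.toFinset := fun v hv => by
      rw [Set.Finite.mem_toFinset] at hv
      refine ⟨hv.2.2.1, fun w hw => ?_⟩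
      rw [Set.Finite.mem_toFinset]
      refine ⟨nrm_of_mem_orb hv.1 hw, ?_, (deg_of_mem_orb hw).symm ▸ hv.2.2.1, ?_⟩
      · obtain ⟨i, rfl⟩ := mem_orb.1 hw
        rw [frob_iterate_apply, hv.2.1, one_pow]
      · obtain ⟨i, rfl⟩ := mem_orb.1 hw
        rw [aeval_frob_iterate, aeval_frob_iterate, hv.2.2.2.1, hv.2.2.2.2,
          zero_pow (pow_ne_zero _ Fintype.card_ne_zero)]
        exact ⟨rfl, rfl⟩
    have hO : (hfin.toFinset.image (orb K)).card ≤ (d - 1) ^ 2 / e := by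
      rw [Nat.le_div_iff_mul_le (by omega), mul_comm]
      exact (mul_card_image_orb_le hZ).trans (hbez _ (by simp))
    let B : Finset (Fin 3 → L) → Finset (forms K D) := fun Q =>
      {H | ∃ v ∈ Q, v ∈ Z ∧ aeval v (F + u H) = 0}
    have hsub : {H | (pderiv a F ≠ 0 ∧ IsRelPrime (pderiv a F) (pderiv b F)) ∧
        ∃ v : Fin 3 → L, Nrm v ∧ v c = 1 ∧ e ≤ deg K v ∧ SingAt (F + u H) v} ⊆
        ((hfin.toFinset.image (orb K)).biUnion B : Set (forms K D)) := by
      rintro H ⟨-, v, hv1, hv2, hv3, hv4⟩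
      have hvZ : v ∈ Z := by
        have ha := hv4.2 a
        have hb := hv4.2 b
        rw [map_add, hder a hac, add_zero] at ha
        rw [map_add, hder b hbc, add_zero] at hb
        exact ⟨hv1, hv2, hv3, ha, hb⟩
      simp only [Finset.mem_coe, Finset.mem_biUnion]
      exact ⟨orb K v, Finset.mem_image_of_mem _ (hfin.mem_toFinset.2 hvZ),
        Finset.mem_filter.2 ⟨Finset.mem_univ _, v, self_mem_orb v, hvZ, hv4.1⟩⟩
    have hB : ∀ Q ∈ hfin.toFinset.image (orb K),
        (B Q).card ≤ (forms K D).card / Fintype.card K ^ (D + 1) := by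
      intro Q hQ
      obtain ⟨v, hv, rfl⟩ := Finset.mem_image.1 hQ
      rw [Set.Finite.mem_toFinset] at hv
      rw [Nat.le_div_iff_mul_le hpos]
      refine le_trans (Nat.mul_le_mul_right _ ?_) (card_forms_aeval_pow_eq_mul_le (p := p) hv.1
        (he.trans hv.2.2.1) (-aeval v F))
      refine Finset.card_le_card_of_injOn Subtype.val (fun H hH => ?_)
        Subtype.val_injective.injOn
      simp only [B, Finset.coe_filter, Finset.mem_univ, true_and, Set.mem_ofPred_eq] at hH ⊢
      obtain ⟨w, hw, hwZ, hw0⟩ := hH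
      refine ⟨H.2, ?_⟩
      have hv0 : aeval v (F + u H) = 0 := by
        obtain ⟨i, rfl⟩ := mem_orb.1 hw
        rw [aeval_frob_iterate] at hw0
        exact eq_zero_of_pow_eq_zero hw0
      rw [map_add] at hv0
      simp only [u, map_mul, map_pow, aeval_X, hv.2.1, one_pow, mul_one] at hv0
      exact eq_neg_of_add_eq_zero_right hv0
    calc _ ≤ ((hfin.toFinset.image (orb K)).biUnion B).card := by
          rw [← Set.ncard_coe_finset]
          exact Set.ncard_le_ncard hsub (Finset.finite_toSet _)
      _ ≤ _ := Finset.card_biUnion_le_card_mul _ _ _ hB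
      _ ≤ _ := Nat.mul_le_mul_right _ hO
  · rw [Fintype.card_coe, div_le_div_iff₀ (card_forms_pos' D) (by exact_mod_cast hpos)]
    have := Nat.div_mul_le_self (forms K D).card (Fintype.card K ^ (D + 1))
    have h2 := Nat.mul_le_mul_left ((d - 1) ^ 2 / e) this
    rw [← mul_assoc] at h2
    exact_mod_cast h2

theorem prob_singAt_chart_le (L : Type*) [Field L] [Algebra K L] [Algebra.IsAlgebraic K L]
    (c : Fin 3) (p d : ℕ) [Fact p.Prime] [CharP K p] {e D : ℕ} (he : D + 1 ≤ e) (hD : p * D ≤ d) :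
    prob K d (fun F => ∃ v : Fin 3 → L, Nrm v ∧ v c = 1 ∧ e ≤ deg K v ∧ SingAt F v) ≤
      (2 * d + 2) / (Fintype.card K : ℝ) ^ (d - d / p) +
        (((d - 1) ^ 2 / e : ℕ) : ℝ) / (Fintype.card K : ℝ) ^ (D + 1) := by
  obtain ⟨a, b, hab, hac, hbc⟩ : ∃ a b : Fin 3, a ≠ b ∧ a ≠ c ∧ b ≠ c := by
    revert c
    decide
  refine (prob_mono fun F hF h => ?_).trans ((prob_or_le d _ _).trans (add_le_add
    (prob_not_isRelPrime_le hab hac hbc p d)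
    (prob_singAt_of_isRelPrime_le L hac hbc p d he hD)))
  by_cases h0 : pderiv a F ≠ 0 ∧ IsRelPrime (pderiv a F) (pderiv b F)
  · exact Or.inr ⟨h0, h⟩
  · exact Or.inl h0

/-- A form is seldom singular at a point of large degree. -/
theorem prob_singAt_le (L : Type*) [Field L] [Algebra K L] [Algebra.IsAlgebraic K L]
    (p d : ℕ) [Fact p.Prime] [CharP K p] {e D : ℕ} (he : D + 1 ≤ e) (hD : p * D ≤ d) :
    prob K d (fun F => ∃ v : Fin 3 → L, Nrm v ∧ e ≤ deg K v ∧ SingAt F v) ≤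
      3 * ((2 * d + 2) / (Fintype.card K : ℝ) ^ (d - d / p) +
        (((d - 1) ^ 2 / e : ℕ) : ℝ) / (Fintype.card K : ℝ) ^ (D + 1)) := by
  refine (prob_mono (r := fun F => ∃ c ∈ (Finset.univ : Finset (Fin 3)),
    ∃ v : Fin 3 → L, Nrm v ∧ v c = 1 ∧ e ≤ deg K v ∧ SingAt F v) fun F hF h => ?_).trans
    ((prob_exists_le Finset.univ d _).trans ((Finset.sum_le_sum fun c _ =>
      prob_singAt_chart_le L c p d he hD).trans_eq ?_))
  · obtain ⟨v, ⟨c, hc, hc0⟩, h⟩ := h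
    exact ⟨c, Finset.mem_univ c, v, ⟨c, hc, hc0⟩, hc, h⟩
  · simp
    ring

end Orbits

/-! ### Moments of the binomial distribution -/

section Binomial

/-- The expectation of a function of a binomial random variable. -/
noncomputable def binE (ρ : ℝ) : ℕ → (ℕ → ℝ) →ₗ[ℝ] ℝ
  | 0 => LinearMap.proj 0
  | n + 1 => ρ • (binE ρ n).comp (LinearMap.funLeft ℝ ℝ Nat.succ) + (1 - ρ) • binE ρ n

theorem binE_zero (ρ : ℝ) (f : ℕ → ℝ) : binE ρ 0 f = f 0 := rfl

theorem binE_succ (ρ : ℝ) (n : ℕ) (f : ℕ → ℝ) :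
    binE ρ (n + 1) f = ρ * binE ρ n (fun x => f (x + 1)) + (1 - ρ) * binE ρ n f := rfl

theorem binE_const (ρ : ℝ) (n : ℕ) (c : ℝ) : binE ρ n (fun _ => c) = c := by
  induction n with
  | zero => rfl
  | succ n ih => rw [binE_succ, ih]; ring

theorem binE_choose (ρ : ℝ) (n j : ℕ) :
    binE ρ n (fun x => (x.choose j : ℝ)) = (n.choose j : ℝ) * ρ ^ j := by
  induction n generalizing j with
  | zero => rcases j with _ | j <;> simp [binE_zero]
  | succ n ih =>
    rcases j with _ | j
    · simp [binE_const]
    · have h : (fun x : ℕ => ((x + 1).choose (j + 1) : ℝ)) =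
          (fun x : ℕ => (x.choose j : ℝ)) + fun x : ℕ => (x.choose (j + 1) : ℝ) := by
        funext x
        simp [Nat.choose_succ_succ]
      rw [binE_succ, h, map_add, ih, ih, Nat.choose_succ_succ]
      push_cast
      ring

/-- Only the sign of the coefficients matters: an error proportional to `n.choose i` on binomial
coefficients then adds up to one proportional to n^j on powers, by the same identity at x = n. -/
theorem exists_pow_eq_sum_choose (j : ℕ) : ∃ s : ℕ → ℝ, (∀ i, 0 ≤ s i) ∧
    ∀ x : ℕ, (x : ℝ) ^ j = ∑ i ∈ Finset.range (j + 1), s i * (x.choose i : ℝ) := by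
  induction j with
  | zero => exact ⟨fun _ => 1, fun _ => zero_le_one, fun x => by simp⟩
  | succ j ih =>
    obtain ⟨s, hs, h⟩ := ih
    refine ⟨fun i => (if i ≤ j then s i * i else 0) + (if i = 0 then 0 else s (i - 1) * i),
      fun i => ?_, fun x => ?_⟩
    · refine add_nonneg ?_ ?_ <;> split_ifs <;>
        first | exact le_rfl | exact mul_nonneg (hs _) (Nat.cast_nonneg _)
    · have hx : ∀ i : ℕ, (x : ℝ) * (x.choose i : ℝ) =
          i * (x.choose i : ℝ) + (i + 1) * (x.choose (i + 1) : ℝ) := fun i => by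
        rcases le_or_gt i x with hi | hi
        · have h1 := Nat.choose_succ_right_eq x i
          have h2 : ((x - i : ℕ) : ℝ) = (x : ℝ) - i := by push_cast [hi]; ring
          have h3 : (x.choose (i + 1) : ℝ) * ((i : ℝ) + 1) = x.choose i * ((x : ℝ) - i) := by
            rw [← h2]
            exact_mod_cast h1
          linarith
        · rw [Nat.choose_eq_zero_of_lt hi, Nat.choose_eq_zero_of_lt (by omega : x < i + 1)]
          simp
      rw [pow_succ', h, Finset.mul_sum]
      simp_rw [add_mul, Finset.sum_add_distrib]
      rw [Finset.sum_range_succ (fun i => (if i ≤ j then s i * (i : ℝ) else 0) * (x.choose i : ℝ)),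
        Finset.sum_range_succ' (fun i => (if i = 0 then (0 : ℝ) else s (i - 1) * i) *
          (x.choose i : ℝ)), if_neg (by omega), if_pos rfl, zero_mul, zero_mul, add_zero, add_zero,
        ← Finset.sum_add_distrib]
      refine Finset.sum_congr rfl fun i hi => ?_
      rw [Finset.mem_range] at hi
      rw [if_pos (by omega), if_neg (by omega), Nat.add_sub_cancel, mul_left_comm, hx]
      push_cast
      ring

theorem abs_apply_pow_le {Δ : (ℕ → ℝ) →ₗ[ℝ] ℝ} {n k : ℕ} {η : ℝ}
    (h : ∀ j ≤ k, |Δ fun x => (x.choose j : ℝ)| ≤ (n.choose j : ℝ) * η) {j : ℕ} (hj : j ≤ k) :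
    |Δ fun x => (x : ℝ) ^ j| ≤ (n : ℝ) ^ j * η := by
  obtain ⟨s, hs, hx⟩ := exists_pow_eq_sum_choose j
  have e : (fun x : ℕ => (x : ℝ) ^ j) =
      ∑ i ∈ Finset.range (j + 1), s i • fun x : ℕ => (x.choose i : ℝ) := by
    funext x
    rw [hx, Finset.sum_apply]
    rfl
  rw [e, map_sum, hx, Finset.sum_mul]
  refine (Finset.abs_sum_le_sum_abs _ _).trans (Finset.sum_le_sum fun i hi => ?_)
  rw [Finset.mem_range] at hi
  rw [map_smul, smul_eq_mul, abs_mul, abs_of_nonneg (hs i), mul_assoc]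
  exact mul_le_mul_of_nonneg_left (h i (by omega)) (hs i)

/-- A functional that agrees up to `η` with a multiple of the binomial expectation on the binomial
coefficients agrees with it on powers. -/
theorem abs_sub_binE_le {Λ : (ℕ → ℝ) →ₗ[ℝ] ℝ} {n k : ℕ} {η w ρ : ℝ}
    (h : ∀ j ≤ k, |(Λ fun x => (x.choose j : ℝ)) - w * ((n.choose j : ℝ) * ρ ^ j)| ≤
      (n.choose j : ℝ) * η) (c : ℝ) :
    |(Λ fun x => ((x : ℝ) - c) ^ k) - w * binE ρ n fun x => ((x : ℝ) - c) ^ k| ≤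
      ((n : ℝ) + |c|) ^ k * η := by
  set Δ := Λ - w • binE ρ n with hΔ
  have h1 : ∀ f, Δ f = Λ f - w * binE ρ n f := fun f => rfl
  have h2 : ∀ j ≤ k, |Δ fun x => (x.choose j : ℝ)| ≤ (n.choose j : ℝ) * η := fun j hj => by
    rw [h1, binE_choose]
    exact h j hj
  rw [← h1]
  have e : (fun x : ℕ => ((x : ℝ) - c) ^ k) = ∑ j ∈ Finset.range (k + 1),
      ((-c) ^ (k - j) * (k.choose j : ℝ)) • fun x : ℕ => (x : ℝ) ^ j := by
    funext x
    rw [sub_eq_add_neg, add_pow, Finset.sum_apply]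
    refine Finset.sum_congr rfl fun j _ => ?_
    simp only [Pi.smul_apply, smul_eq_mul]
    ring
  rw [e, map_sum, add_pow, Finset.sum_mul]
  refine (Finset.abs_sum_le_sum_abs _ _).trans (Finset.sum_le_sum fun j hj => ?_)
  rw [Finset.mem_range] at hj
  rw [map_smul, smul_eq_mul, abs_mul, abs_mul, abs_pow, abs_neg, Nat.abs_cast]
  calc _ ≤ |c| ^ (k - j) * (k.choose j : ℝ) * ((n : ℝ) ^ j * η) :=
        mul_le_mul_of_nonneg_left (abs_apply_pow_le h2 (by omega)) (by positivity)
    _ = _ := by ring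

/-- The central moments of the binomial distribution. -/
noncomputable def binMoment (ρ : ℝ) (n k : ℕ) : ℝ := binE ρ n fun x => ((x : ℝ) - n * ρ) ^ k

/-- The central moments of the Bernoulli distribution. -/
noncomputable def bernMoment (ρ : ℝ) (k : ℕ) : ℝ := ρ * (1 - ρ) ^ k + (1 - ρ) * (-ρ) ^ k

theorem binE_add_pow (ρ : ℝ) (n k : ℕ) (f : ℕ → ℝ) (c : ℝ) :
    (binE ρ n fun x => (f x + c) ^ k) =
      ∑ j ∈ Finset.range (k + 1), (binE ρ n fun x => f x ^ j) * c ^ (k - j) * (k.choose j : ℝ) := by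
  have e : (fun x : ℕ => (f x + c) ^ k) = ∑ j ∈ Finset.range (k + 1),
      (c ^ (k - j) * (k.choose j : ℝ)) • fun x : ℕ => f x ^ j := by
    funext x
    rw [add_pow, Finset.sum_apply]
    refine Finset.sum_congr rfl fun j _ => ?_
    simp only [Pi.smul_apply, smul_eq_mul]
    ring
  rw [e, map_sum]
  refine Finset.sum_congr rfl fun j _ => ?_
  rw [map_smul, smul_eq_mul]
  ring

theorem binMoment_succ_eq_sum (ρ : ℝ) (n k : ℕ) : binMoment ρ (n + 1) k =
    ∑ j ∈ Finset.range (k + 1), (k.choose j : ℝ) * binMoment ρ n j * bernMoment ρ (k - j) := by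
  have h1 : (fun x : ℕ => (((x + 1 : ℕ) : ℝ) - ((n + 1 : ℕ) : ℝ) * ρ) ^ k) =
      fun x : ℕ => (((x : ℝ) - n * ρ) + (1 - ρ)) ^ k := by
    funext x; push_cast; ring
  have h2 : (fun x : ℕ => ((x : ℝ) - ((n + 1 : ℕ) : ℝ) * ρ) ^ k) =
      fun x : ℕ => (((x : ℝ) - n * ρ) + (-ρ)) ^ k := by
    funext x; push_cast; ring
  rw [binMoment, binE_succ, h1, h2, binE_add_pow, binE_add_pow, Finset.mul_sum, Finset.mul_sum,
    ← Finset.sum_add_distrib]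
  refine Finset.sum_congr rfl fun j _ => ?_
  simp only [binMoment, bernMoment]
  ring

theorem bernMoment_zero (ρ : ℝ) : bernMoment ρ 0 = 1 := by simp [bernMoment]

theorem bernMoment_one (ρ : ℝ) : bernMoment ρ 1 = 0 := by
  rw [bernMoment]; ring

theorem bernMoment_add_two (ρ : ℝ) (k : ℕ) : bernMoment ρ (k + 2) =
    ρ * (1 - ρ) * ((1 - ρ) ^ (k + 1) + (-1) ^ k * ρ ^ (k + 1)) := by
  rw [bernMoment, neg_pow]; ring

theorem binMoment_zero_right (ρ : ℝ) (n : ℕ) : binMoment ρ n 0 = 1 := by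
  simp [binMoment, binE_const]

theorem binMoment_zero_left (ρ : ℝ) {k : ℕ} (hk : k ≠ 0) : binMoment ρ 0 k = 0 := by
  simp [binMoment, binE_zero, hk]

theorem binMoment_one_right (ρ : ℝ) (n : ℕ) : binMoment ρ n 1 = 0 := by
  induction n with
  | zero => exact binMoment_zero_left ρ one_ne_zero
  | succ n ih => simp [binMoment_succ_eq_sum, Finset.sum_range_succ, ih, bernMoment_one]

theorem binMoment_one_left (ρ : ℝ) (k : ℕ) : binMoment ρ 1 k = bernMoment ρ k := by
  rw [binMoment, binE_succ, binE_zero, binE_zero, bernMoment]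
  simp

/-- The term of order k + 1 is absent because the first central Bernoulli moment is zero. So one
more trial changes a moment only through those of order at least two less, which is the source of
the exponent ⌊k/2⌋. -/
theorem binMoment_succ (ρ : ℝ) (n k : ℕ) : binMoment ρ (n + 1) (k + 2) = binMoment ρ n (k + 2) +
    ∑ j ∈ Finset.range (k + 1),
      ((k + 2).choose j : ℝ) * binMoment ρ n j * bernMoment ρ (k + 2 - j) := by
  rw [binMoment_succ_eq_sum, Finset.sum_range_succ, Finset.sum_range_succ]
  simp [bernMoment_zero, bernMoment_one, add_comm, show k + 2 - (k + 1) = 1 by omega]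

theorem abs_bernMoment_le {ρ : ℝ} (h0 : 0 ≤ ρ) (h1 : ρ ≤ 1) (k : ℕ) :
    |bernMoment ρ (k + 2)| ≤ ρ * (1 - ρ) := by
  have h2 : 0 ≤ 1 - ρ := by linarith
  rw [bernMoment_add_two, abs_mul, abs_of_nonneg (mul_nonneg h0 h2)]
  refine mul_le_of_le_one_right (mul_nonneg h0 h2) ((abs_add_le _ _).trans ?_)
  rw [abs_mul, abs_pow, abs_pow, abs_pow, abs_neg, abs_one, one_pow, one_mul, abs_of_nonneg h0,
    abs_of_nonneg h2]
  have a1 := pow_le_of_le_one h2 (by linarith : 1 - ρ ≤ 1) (Nat.succ_ne_zero k)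
  have a2 := pow_le_of_le_one h0 h1 (Nat.succ_ne_zero k)
  simp only [Nat.succ_eq_add_one] at a1 a2
  linarith

/-- The `k`-th central moment of a binomial distribution is at most of the order of the
`⌊k / 2⌋`-th power of the variance. -/
theorem exists_abs_binMoment_le (k : ℕ) : ∃ C : ℝ, 0 ≤ C ∧ ∀ ρ : ℝ, 0 ≤ ρ → ρ ≤ 1 → ∀ n : ℕ,
    |binMoment ρ n k| ≤ C * (1 + n * (ρ * (1 - ρ))) ^ (k / 2) := by
  induction k using Nat.strong_induction_on with
  | _ k ih =>
  rcases k with _ | _ | k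
  · exact ⟨1, zero_le_one, fun ρ _ _ n => by simp [binMoment_zero_right]⟩
  · exact ⟨0, le_rfl, fun ρ _ _ n => by simp [binMoment_one_right]⟩
  have ih' : ∀ j, ∃ C : ℝ, 0 ≤ C ∧ (j < k + 2 → ∀ ρ : ℝ, 0 ≤ ρ → ρ ≤ 1 → ∀ n : ℕ,
      |binMoment ρ n j| ≤ C * (1 + n * (ρ * (1 - ρ))) ^ (j / 2)) := fun j => by
    by_cases hj : j < k + 2
    · obtain ⟨C, h0, h⟩ := ih j hj
      exact ⟨C, h0, fun _ => h⟩
    · exact ⟨0, le_rfl, fun h => absurd h hj⟩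
  choose C hC0 hC using ih'
  refine ⟨∑ j ∈ Finset.range (k + 1), ((k + 2).choose j : ℝ) * C j,
    Finset.sum_nonneg fun j _ => mul_nonneg (Nat.cast_nonneg _) (hC0 j), fun ρ h0 h1 n => ?_⟩
  set D := ∑ j ∈ Finset.range (k + 1), ((k + 2).choose j : ℝ) * C j with hD
  have hD0 : 0 ≤ D := Finset.sum_nonneg fun j _ => mul_nonneg (Nat.cast_nonneg _) (hC0 j)
  set τ := ρ * (1 - ρ) with hτ
  have hτ0 : 0 ≤ τ := mul_nonneg h0 (by linarith)
  -- Each trial adds at most τ D (1 + nτ)^⌊k/2⌋; n is kept fixed in this bound while the number m of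
  -- trials grows.
  have key : ∀ m ≤ n, |binMoment ρ m (k + 2)| ≤ m * τ * (D * (1 + n * τ) ^ (k / 2)) := by
    intro m hm
    induction m with
    | zero => simp [binMoment_zero_left]
    | succ m ihm =>
      rw [binMoment_succ]
      refine (abs_add_le _ _).trans ?_
      have hstep : |∑ j ∈ Finset.range (k + 1), ((k + 2).choose j : ℝ) * binMoment ρ m j *
          bernMoment ρ (k + 2 - j)| ≤ τ * (D * (1 + n * τ) ^ (k / 2)) := by
        refine (Finset.abs_sum_le_sum_abs _ _).trans ?_
        rw [hD, Finset.sum_mul, Finset.mul_sum]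
        refine Finset.sum_le_sum fun j hj => ?_
        rw [Finset.mem_range] at hj
        rw [abs_mul, abs_mul, Nat.abs_cast]
        have b1 := abs_bernMoment_le h0 h1 (k - j)
        rw [show k - j + 2 = k + 2 - j by omega] at b1
        have b2 : |binMoment ρ m j| ≤ C j * (1 + n * τ) ^ (k / 2) := by
          refine (hC j (by omega) ρ h0 h1 m).trans (mul_le_mul_of_nonneg_left ?_ (hC0 j))
          have hmn : (m : ℝ) ≤ n := by exact_mod_cast (by omega : m ≤ n)
          refine (pow_le_pow_left₀ (by positivity) (by gcongr) _).trans
            (pow_le_pow_right₀ (by nlinarith [mul_nonneg (Nat.cast_nonneg (α := ℝ) n) hτ0]) ?_)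
          exact Nat.div_le_div_right (by omega)
        have := hC0 j
        calc _ ≤ ((k + 2).choose j : ℝ) * (C j * (1 + n * τ) ^ (k / 2)) * τ := by gcongr
          _ = _ := by ring
      calc _ ≤ m * τ * (D * (1 + n * τ) ^ (k / 2)) + τ * (D * (1 + n * τ) ^ (k / 2)) :=
            add_le_add (ihm (by omega)) hstep
        _ = _ := by push_cast; ring
  refine (key n le_rfl).trans ?_
  rw [show (k + 1 + 1) / 2 = k / 2 + 1 by omega, pow_succ]
  have hn : 0 ≤ (n : ℝ) * τ := by positivity
  calc _ ≤ (1 + n * τ) * (D * (1 + n * τ) ^ (k / 2)) := by gcongr; linarith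
    _ = _ := by ring

/-- The worst case is k odd, where (1 - ρ)^(k+1) - ρ^(k+1) ≥ (4/7 - 3/7) (1 - ρ)^k. The bound 3/7 is
the value of `rho` at q = 2, the largest that the model needs. -/
theorem bernMoment_nonneg {ρ : ℝ} (h0 : 0 ≤ ρ) (h1 : ρ ≤ 3 / 7) (k : ℕ) :
    ρ * (1 - ρ) * ((4 / 7) ^ k / 7) ≤ bernMoment ρ (k + 2) := by
  rw [bernMoment_add_two]
  refine mul_le_mul_of_nonneg_left ?_ (mul_nonneg h0 (by linarith))
  have a : (-1 : ℝ) ≤ (-1) ^ k := by rcases neg_one_pow_eq_or ℝ k with h | h <;> norm_num [h]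
  have b : ρ ^ (k + 1) ≤ (3 / 7) * (1 - ρ) ^ k := by
    rw [pow_succ']
    exact mul_le_mul h1 (pow_le_pow_left₀ h0 (by linarith) k) (by positivity) (by norm_num)
  have c : (4 / 7 : ℝ) ^ k ≤ (1 - ρ) ^ k := pow_le_pow_left₀ (by norm_num) (by linarith) k
  have e : (4 / 7) * (1 - ρ) ^ k ≤ (1 - ρ) ^ (k + 1) := by
    rw [pow_succ']
    exact mul_le_mul_of_nonneg_right (by linarith) (pow_nonneg (by linarith) k)
  have f : 0 ≤ ρ ^ (k + 1) := by positivity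
  nlinarith [mul_le_mul_of_nonneg_right a f]

theorem binMoment_nonneg {ρ : ℝ} (h0 : 0 ≤ ρ) (h1 : ρ ≤ 3 / 7) (n k : ℕ) :
    0 ≤ binMoment ρ n k := by
  have hb : ∀ j, 0 ≤ bernMoment ρ j := fun j => by
    rcases j with _ | _ | j
    · simp [bernMoment_zero]
    · simp [bernMoment_one]
    · exact le_trans (mul_nonneg (mul_nonneg h0 (by linarith)) (by positivity))
        (bernMoment_nonneg h0 h1 j)
  induction n generalizing k with
  | zero =>
    rcases eq_or_ne k 0 with rfl | hk
    · simp [binMoment_zero_right]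
    · exact (binMoment_zero_left ρ hk).ge
  | succ n ih =>
    rw [binMoment_succ_eq_sum]
    exact Finset.sum_nonneg fun j _ => mul_nonneg (mul_nonneg (Nat.cast_nonneg _) (ih j)) (hb _)

theorem add_le_binMoment_succ {ρ : ℝ} (h0 : 0 ≤ ρ) (h1 : ρ ≤ 3 / 7) (n k j : ℕ) (hj : j ≤ k) :
    binMoment ρ n (k + 2) + binMoment ρ n j * bernMoment ρ (k + 2 - j) ≤
      binMoment ρ (n + 1) (k + 2) := by
  have hb : ∀ i ≤ k, 0 ≤ bernMoment ρ (k + 2 - i) := fun i hi => by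
    rw [show k + 2 - i = k - i + 2 by omega]
    exact le_trans (mul_nonneg (mul_nonneg h0 (by linarith)) (by positivity))
      (bernMoment_nonneg h0 h1 _)
  rw [binMoment_succ]
  refine add_le_add_right (le_trans ?_ (Finset.single_le_sum (f := fun j =>
    ((k + 2).choose j : ℝ) * binMoment ρ n j * bernMoment ρ (k + 2 - j)) (fun i hi => ?_)
    (Finset.mem_range.2 (Nat.lt_succ_of_le hj)))) _
  · refine mul_le_mul_of_nonneg_right ?_ (hb j hj)
    refine le_mul_of_one_le_left (binMoment_nonneg h0 h1 n j) ?_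
    exact_mod_cast Nat.choose_pos (by omega)
  · exact mul_nonneg (mul_nonneg (Nat.cast_nonneg _) (binMoment_nonneg h0 h1 n i))
      (hb i (by simpa [Nat.lt_succ_iff] using hi))

/-- For ρ ≤ 3/7 all central moments are nonnegative, so lower bounds add up over the trials. The
second and third moments grow linearly in n. For higher orders, each of the last ⌊n/2⌋ trials adds
at least τ/7 times the moment of order two less, which is taken after at least n/3 trials. -/
theorem exists_le_binMoment (k : ℕ) : ∃ c : ℝ, 0 < c ∧ ∀ ρ : ℝ, 0 ≤ ρ → ρ ≤ 3 / 7 → ∀ n : ℕ,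
    1 ≤ n → c * (n * (ρ * (1 - ρ))) ^ ((k + 2) / 2) ≤ binMoment ρ n (k + 2) := by
  induction k using Nat.strong_induction_on with
  | _ k ih =>
  rcases k with _ | _ | k
  · refine ⟨1 / 7, by norm_num, fun ρ h0 h1 n _ => ?_⟩
    have hτ0 : 0 ≤ ρ * (1 - ρ) := mul_nonneg h0 (by linarith)
    have hb := bernMoment_nonneg h0 h1 0
    clear * - hb h0 h1
    induction n with
    | zero => simp [binMoment_zero_left]
    | succ n ih =>
      have := add_le_binMoment_succ h0 h1 n 0 0 le_rfl
      rw [binMoment_zero_right] at this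
      simp at *
      linarith
  · refine ⟨4 / 49, by norm_num, fun ρ h0 h1 n _ => ?_⟩
    have hb := bernMoment_nonneg h0 h1 1
    clear * - hb h0 h1
    induction n with
    | zero => simp [binMoment_zero_left]
    | succ n ih =>
      have := add_le_binMoment_succ h0 h1 n 1 0 (by omega)
      rw [binMoment_zero_right] at this
      simp at *
      linarith
  obtain ⟨c, hc, h⟩ := ih k (by omega)
  refine ⟨min ((4 / 7) ^ (k + 2) / 7) (c / 7 / 3 ^ ((k + 2) / 2 + 1)), by positivity,
    fun ρ h0 h1 n hn => ?_⟩
  set τ := ρ * (1 - ρ) with hτ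
  have hτ0 : 0 ≤ τ := mul_nonneg h0 (by linarith)
  have hτ1 : τ ≤ 1 := by nlinarith
  rw [show (k + 1 + 1 + 2) / 2 = (k + 2) / 2 + 1 by omega]
  set m := (k + 2) / 2 with hm
  -- For n = 1 there are no last ⌊n/2⌋ trials, and the Bernoulli moment is used directly.
  rcases hn.eq_or_lt with rfl | hn2
  · have hb := bernMoment_nonneg h0 h1 (k + 2)
    rw [binMoment_one_left]
    refine le_trans ?_ hb
    rw [Nat.cast_one, one_mul, ← hτ, mul_comm τ]
    exact mul_le_mul (min_le_left _ _) (pow_le_of_le_one hτ0 hτ1 (Nat.succ_ne_zero m))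
      (by positivity) (by positivity)
  · have hstep : ∀ i l : ℕ, (n : ℝ) / 3 ≤ l → 1 ≤ l → i * (c / 7 * (n * τ / 3) ^ m * τ) ≤
        binMoment ρ (l + i) (k + 2 + 2) := by
      intro i l hl hl1
      induction i with
      | zero => simpa using binMoment_nonneg h0 h1 l (k + 2 + 2)
      | succ i ihi =>
        have a := add_le_binMoment_succ h0 h1 (l + i) (k + 2) (k + 2) le_rfl
        have b := h ρ h0 h1 (l + i) (by omega)
        have d := bernMoment_nonneg h0 h1 0
        rw [show k + 2 + 2 - (k + 2) = 0 + 2 by omega] at a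
        rw [← hτ] at d b
        have e : (n * τ / 3) ^ m ≤ (((l + i : ℕ) : ℝ) * τ) ^ m := by
          refine pow_le_pow_left₀ (by positivity) ?_ m
          push_cast
          have := mul_nonneg (Nat.cast_nonneg (α := ℝ) i) hτ0
          nlinarith
        have f : c * (n * τ / 3) ^ m * (τ * ((4 / 7) ^ 0 / 7)) ≤
            binMoment ρ (l + i) (k + 2) * bernMoment ρ (0 + 2) :=
          mul_le_mul ((mul_le_mul_of_nonneg_left e hc.le).trans b) d (by positivity)
            (binMoment_nonneg h0 h1 _ _)
        push_cast
        rw [← add_assoc]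
        nlinarith
    have hl := hstep (n / 2) (n - n / 2) (by
      have : n ≤ 3 * (n - n / 2) := by omega
      have : (n : ℝ) ≤ 3 * ((n - n / 2 : ℕ) : ℝ) := by exact_mod_cast this
      linarith) (by omega)
    rw [show n - n / 2 + n / 2 = n by omega] at hl
    refine le_trans ?_ hl
    have hn3 : (n : ℝ) / 3 ≤ ((n / 2 : ℕ) : ℝ) := by
      have : n ≤ 3 * (n / 2) := by clear * - hn2; omega
      have : (n : ℝ) ≤ 3 * ((n / 2 : ℕ) : ℝ) := by exact_mod_cast this
      linarith
    calc _ ≤ (c / 7 / 3 ^ (m + 1)) * (n * τ) ^ (m + 1) :=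
          mul_le_mul_of_nonneg_right (min_le_right _ _) (by positivity)
      _ = (n : ℝ) / 3 * (c / 7 * (n * τ / 3) ^ m * τ) := by
          rw [div_pow, pow_succ, pow_succ]
          field_simp
      _ ≤ _ := mul_le_mul_of_nonneg_right hn3 (by positivity)

end Binomial

/-! ### Polynomials at an element with e distinct conjugates -/

section Univariate

variable {K : Type*} [Field K] [Fintype K] {L : Type*} [Field L] [Algebra K L]

theorem pow_card_pow_injOn {y : L} {e : ℕ}
    (hy : ∀ i, 0 < i → i < e → y ^ Fintype.card K ^ i ≠ y) :
    Set.InjOn (fun i => y ^ Fintype.card K ^ i) (Finset.range e) := by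
  have key : ∀ i j, i < j → j < e → y ^ Fintype.card K ^ i ≠ y ^ Fintype.card K ^ j := by
    intro i j hij hj h
    refine hy (j - i) (by omega) (by omega) ?_
    have h1 := (frob_injective (K := K) (L := L)).iterate i
      (a₁ := fun _ => y ^ Fintype.card K ^ (j - i)) (a₂ := fun _ => y) (by
        funext l
        rw [frob_iterate_apply, frob_iterate_apply, ← pow_mul, ← pow_add,
          show j - i + i = j by omega, h])
    exact congrFun h1 0
  intro i hi j hj h
  simp only [Finset.coe_range, Set.mem_Iio] at hi hj
  rcases lt_trichotomy i j with h1 | h1 | h1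
  · exact absurd h (key i j h1 hj)
  · exact h1
  · exact absurd h.symm (key j i h1 hi)

theorem polynomial_aeval_pow_card_pow (y : L) (g : Polynomial K) (i : ℕ) :
    Polynomial.aeval (y ^ Fintype.card K ^ i) g = Polynomial.aeval y g ^ Fintype.card K ^ i := by
  induction i with
  | zero => simp
  | succ i ih =>
    rw [pow_succ, pow_mul, pow_mul, ← ih]
    exact Polynomial.aeval_algHom_apply (FiniteField.frobeniusAlgHom K L) _ g

theorem polynomial_eq_zero_of_aeval_eq_zero {y : L} {e : ℕ}
    (hy : ∀ i, 0 < i → i < e → y ^ Fintype.card K ^ i ≠ y) {g : Polynomial K}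
    (hg : Polynomial.aeval y g = 0) (hd : g.natDegree < e) : g = 0 := by
  classical
  refine (Polynomial.map_eq_zero_iff (algebraMap K L).injective).1 ?_
  refine Polynomial.eq_zero_of_natDegree_lt_card_of_eval_eq_zero' _
    ((Finset.range e).image fun i => y ^ Fintype.card K ^ i) (fun z hz => ?_) ?_
  · obtain ⟨i, -, rfl⟩ := Finset.mem_image.1 hz
    rw [Polynomial.eval_map_algebraMap]
    rw [polynomial_aeval_pow_card_pow, hg, zero_pow (pow_ne_zero i Fintype.card_ne_zero)]
  · rw [Finset.card_image_of_injOn (pow_card_pow_injOn hy), Finset.card_range]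
    exact Polynomial.natDegree_map_le.trans_lt hd

/-- The minimal polynomial of y is separable and has degree at least e, so its square divides a
polynomial with a double root at y. -/
theorem polynomial_eq_zero_of_aeval_derivative_eq_zero [Algebra.IsAlgebraic K L] {y : L} {e : ℕ}
    (hy : ∀ i, 0 < i → i < e → y ^ Fintype.card K ^ i ≠ y) {g : Polynomial K}
    (hg : Polynomial.aeval y g = 0) (hg' : Polynomial.aeval y g.derivative = 0)
    (hd : g.natDegree < 2 * e) : g = 0 := by
  have hint : IsIntegral K y := Algebra.IsIntegral.isIntegral y
  have hm : e ≤ (minpoly K y).natDegree := by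
    by_contra hlt
    exact minpoly.ne_zero hint
      (polynomial_eq_zero_of_aeval_eq_zero hy (minpoly.aeval K y) (by omega))
  obtain ⟨h, rfl⟩ := minpoly.dvd K y hg
  rw [Polynomial.derivative_mul, map_add, map_mul, map_mul, minpoly.aeval, zero_mul, add_zero,
    mul_eq_zero] at hg'
  have hsep : Polynomial.aeval y (minpoly K y).derivative ≠ 0 :=
    (PerfectField.separable_of_irreducible (minpoly.irreducible hint)).aeval_derivative_ne_zero
      (minpoly.aeval K y)
  obtain ⟨u, rfl⟩ := minpoly.dvd K y (hg'.resolve_left hsep)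
  rcases eq_or_ne u 0 with rfl | hu
  · simp
  have h0 := minpoly.ne_zero hint
  rw [Polynomial.natDegree_mul h0 (mul_ne_zero h0 hu), Polynomial.natDegree_mul h0 hu] at hd
  omega

end Univariate

/-! ### Forms in a linear form and a coordinate -/

section Pencil

variable {K : Type*} [Field K] {L : Type*} [Field L] [Algebra K L]

/-- The polynomial with given coefficients. -/
noncomputable def polyOf {n : ℕ} (c : Fin n → K) : Polynomial K :=
  ∑ i, Polynomial.monomial i.1 (c i)

theorem natDegree_polyOf_lt {n : ℕ} (hn : n ≠ 0) (c : Fin n → K) : (polyOf c).natDegree < n := by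
  refine Nat.lt_of_le_pred (Nat.pos_of_ne_zero hn) (Polynomial.natDegree_sum_le_of_forall_le _ _
    fun i _ => (Polynomial.natDegree_monomial_le _).trans (Nat.le_pred_of_lt i.2))

theorem polyOf_eq_zero {n : ℕ} {c : Fin n → K} (h : polyOf c = 0) : c = 0 := by
  funext i
  have h1 : (polyOf c).coeff i.1 = c i := by
    rw [polyOf, Polynomial.finsetSum_coeff, Finset.sum_eq_single i]
    · simp
    · intro j _ hj
      rw [Polynomial.coeff_monomial, if_neg fun h => hj (Fin.ext h)]
    · simp
  rw [← h1, h]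
  rfl

/-- The form of degree `d` in a linear form and a variable with given coefficients. -/
noncomputable def pencilForm (U : MvPolynomial (Fin 3) K) (z : Fin 3) (d : ℕ) {n : ℕ}
    (c : Fin n → K) : MvPolynomial (Fin 3) K :=
  ∑ i, C (c i) * (U ^ i.1 * X z ^ (d - i.1))

theorem pencilForm_sub (U : MvPolynomial (Fin 3) K) (z : Fin 3) (d : ℕ) {n : ℕ}
    (c c' : Fin n → K) : pencilForm U z d (c - c') = pencilForm U z d c - pencilForm U z d c' := by
  simp [pencilForm, sub_mul]

theorem isHomogeneous_pencilForm {U : MvPolynomial (Fin 3) K} (hU : U.IsHomogeneous 1) (z : Fin 3)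
    {d n : ℕ} (hn : n ≤ d + 1) (c : Fin n → K) : (pencilForm U z d c).IsHomogeneous d := by
  refine IsHomogeneous.sum _ _ _ fun i _ => ?_
  have := (isHomogeneous_C (Fin 3) (c i)).mul
    ((hU.pow i.1).mul (isHomogeneous_X_pow (R := K) z (d - i.1)))
  have hi := i.2
  rwa [show 0 + (1 * i.1 + (d - i.1)) = d by omega] at this

theorem aeval_pencilForm (U : MvPolynomial (Fin 3) K) {z : Fin 3} (d : ℕ) {n : ℕ}
    (c : Fin n → K) {v : Fin 3 → L} (hv : v z = 1) :
    aeval v (pencilForm U z d c) = Polynomial.aeval (aeval v U) (polyOf c) := by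
  simp [pencilForm, polyOf, hv, Polynomial.aeval_monomial]

theorem aeval_pderiv_pencilForm (U : MvPolynomial (Fin 3) K) {z j : Fin 3} (hj : z ≠ j) (d : ℕ)
    {n : ℕ} (c : Fin n → K) {v : Fin 3 → L} (hv : v z = 1) :
    aeval v (pderiv j (pencilForm U z d c)) =
      Polynomial.aeval (aeval v U) (polyOf c).derivative * aeval v (pderiv j U) := by
  simp only [pencilForm, polyOf, map_sum, Polynomial.derivative_monomial,
    Polynomial.aeval_monomial, Finset.sum_mul]
  refine Finset.sum_congr rfl fun i _ => ?_
  simp [Derivation.leibniz, Derivation.leibniz_pow, pderiv_X_of_ne hj, hv]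
  ring

theorem derivative_aeval_restrict (F : MvPolynomial (Fin 3) K) :
    (aeval (![0, 1, Polynomial.X] : Fin 3 → Polynomial K) F).derivative =
      aeval (![0, 1, Polynomial.X] : Fin 3 → Polynomial K) (pderiv 2 F) := by
  induction F using MvPolynomial.induction_on with
  | C a => simp
  | add P Q hP hQ => simp [hP, hQ]
  | mul_X P i hP =>
    rw [map_mul, Polynomial.derivative_mul, hP, Derivation.leibniz, map_add, smul_eq_mul,
      smul_eq_mul, map_mul, map_mul, aeval_X, add_comm, mul_comm (aeval _ (pderiv 2 P))]
    congr 2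
    fin_cases i <;> simp [pderiv_X]

theorem natDegree_aeval_restrict_le {F : MvPolynomial (Fin 3) K} {d : ℕ} (hF : F.IsHomogeneous d) :
    (aeval (![0, 1, Polynomial.X] : Fin 3 → Polynomial K) F).natDegree ≤ d := by
  rw [aeval_def, eval₂_eq']
  refine Polynomial.natDegree_sum_le_of_forall_le _ _ fun m hm => ?_
  have hmd : m.degree = d := by
    rw [Finsupp.degree_eq_weight_one]
    exact hF (mem_support_iff.mp hm)
  have hm2 : m 2 ≤ d := hmd ▸ Finsupp.le_degree 2 m
  refine (Polynomial.natDegree_C_mul_le _ _).trans ((Polynomial.natDegree_prod_le _ _).trans ?_)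
  rw [Fin.sum_univ_three]
  refine le_trans (add_le_add (add_le_add Polynomial.natDegree_pow_le Polynomial.natDegree_pow_le)
    Polynomial.natDegree_pow_le) ?_
  simpa using hm2

end Pencil

/-! ### Smooth forms in large characteristic -/

section LargeCharacteristic

variable {K : Type*} [Field K] [Fintype K] {L : Type*} [Field L] [Algebra K L]
  [Algebra.IsAlgebraic K L]

theorem deg_le_of_pow_eq {v : Fin 3 → L} {i : ℕ} (hi : 0 < i)
    (h : ∀ j, v j ^ Fintype.card K ^ i = v j) : deg K v ≤ i :=
  Function.IsPeriodicPt.minimalPeriod_le hi (by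
    funext j
    rw [frob_iterate_apply, h])

/-- A projection from a rational point that is injective on the orbit of a given point. -/
theorem exists_projection {v : Fin 3 → L} (h0 : v 0 = 1) (hd : deg K v ≤ Fintype.card K) :
    ∃ a : K, ∀ i, 0 < i → i < deg K v →
      (v 1 + algebraMap K L a * v 2) ^ Fintype.card K ^ i ≠ v 1 + algebraMap K L a * v 2 := by
  classical
  -- There are q slopes a and at most q - 1 exponents i, so two slopes share an exponent. Then v 1
  -- and v 2 are both fixed by that power of Frobenius, against the definition of the degree.
  by_contra hno
  push Not at hno
  choose f hf0 hf1 hf using hno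
  have hmap : ∀ a ∈ (Finset.univ : Finset K), f a ∈ Finset.Ico 1 (deg K v) := fun a _ =>
    Finset.mem_Ico.2 ⟨hf0 a, hf1 a⟩
  obtain ⟨a, -, b, -, hab, hfab⟩ := Finset.exists_ne_map_eq_of_card_lt_of_maps_to
    (s := (Finset.univ : Finset K)) (by
      rw [Nat.card_Ico, Finset.card_univ]
      have := deg_pos (K := K) v
      omega) hmap
  have hadd : ∀ (i : ℕ) (c : K), (v 1 + algebraMap K L c * v 2) ^ Fintype.card K ^ i =
      v 1 ^ Fintype.card K ^ i + algebraMap K L c * v 2 ^ Fintype.card K ^ i := fun i c => by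
    have h := aeval_frob_iterate (K := K) i v (X 1 + C c * X 2)
    simp only [map_add, map_mul, aeval_X, aeval_C, frob_iterate_apply] at h
    exact h.symm
  have ha := hf a
  have hb := hf b
  rw [← hfab, hadd] at hb
  rw [hadd] at ha
  have h2 : v 2 ^ Fintype.card K ^ f a = v 2 := by
    have h3 : (algebraMap K L a - algebraMap K L b) * (v 2 ^ Fintype.card K ^ f a - v 2) = 0 := by
      linear_combination ha - hb
    refine sub_eq_zero.1 ((mul_eq_zero.1 h3).resolve_left fun h => hab ?_)
    exact (algebraMap K L).injective (sub_eq_zero.1 h)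
  have h1 : v 1 ^ Fintype.card K ^ f a = v 1 := by
    rw [h2] at ha
    exact add_right_cancel ha
  have := deg_le_of_pow_eq (hf0 a) (v := v) (fun j => by
    fin_cases j
    · simp [h0]
    · exact h1
    · exact h2)
  exact absurd (hf1 a) (by omega)

theorem SingAt.sub {F G : MvPolynomial (Fin 3) K} {v : Fin 3 → L} (hF : SingAt F v)
    (hG : SingAt G v) : SingAt (F - G) v :=
  ⟨by rw [map_sub, hF.1, hG.1, sub_zero], fun i => by
    rw [map_sub, map_sub, hF.2, hG.2, sub_zero]⟩

/-- Being singular at an affine point whose degree is between half of the degree of the form and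
the degree of the form. -/
theorem prob_singAt_affine_le {v : Fin 3 → L} {d : ℕ} (h0 : v 0 = 1)
    (hq : deg K v ≤ Fintype.card K) (hd : deg K v ≤ d) (hd2 : d + 1 < 2 * deg K v) :
    prob K d (fun F => SingAt F v) ≤ ((Fintype.card K : ℝ) ^ (d + 1 + deg K v))⁻¹ := by
  classical
  obtain ⟨a, ha⟩ := exists_projection h0 hq
  set U : MvPolynomial (Fin 3) K := X 1 + C a * X 2 with hU
  have hUv : aeval v U = v 1 + algebraMap K L a * v 2 := by simp [hU]
  have hUh : U.IsHomogeneous 1 := (isHomogeneous_X K 1).add (by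
    simpa using (isHomogeneous_C (Fin 3) a).mul (isHomogeneous_X K 2))
  have hepos := deg_pos (K := K) v
  -- Translates c(U) + X 2 b(U), homogenized with X 0, where c has degree at most d and b degree
  -- below deg v. If one is singular at v, then ∂_2 - a ∂_1 gives b(U(v)) = 0, hence b = 0; now c
  -- has a double root at U(v), of degree more than (d + 1)/2, hence c = 0.
  let u : (Fin (d + 1) → K) × (Fin (deg K v) → K) → MvPolynomial (Fin 3) K := fun c =>
    pencilForm U 0 d c.1 + X 2 * pencilForm U 0 (d - 1) c.2
  have husub : ∀ c c', u (c - c') = u c - u c' := fun c c' => by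
    simp only [u, Prod.fst_sub, Prod.snd_sub, pencilForm_sub]
    ring
  have huh : ∀ c, (u c).IsHomogeneous d := fun c => by
    refine (isHomogeneous_pencilForm hUh 0 le_rfl c.1).add ?_
    have := (isHomogeneous_X K 2).mul (isHomogeneous_pencilForm hUh 0 (d := d - 1)
      (by omega) c.2)
    rwa [show 1 + (d - 1) = d by omega] at this
  have hinj : ∀ c, SingAt (u c) v → c = 0 := by
    rintro ⟨c, b⟩ hs
    have d1 := hs.2 1
    have d2 := hs.2 2
    have e1 : aeval v (pderiv 1 U) = 1 := by simp [hU]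
    have e2 : aeval v (pderiv 2 U) = algebraMap K L a := by simp [hU]
    simp only [u, map_add, Derivation.leibniz, smul_eq_mul, map_mul, aeval_X, pderiv_X_self,
      aeval_pderiv_pencilForm U (show (0 : Fin 3) ≠ 1 by decide) _ _ h0,
      aeval_pderiv_pencilForm U (show (0 : Fin 3) ≠ 2 by decide) _ _ h0,
      aeval_pencilForm U _ _ h0, e1, e2, pderiv_X_of_ne (show (2 : Fin 3) ≠ 1 by decide),
      mul_one, mul_zero, add_zero] at d1 d2
    have hb : Polynomial.aeval (aeval v U) (polyOf b) = 0 := by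
      linear_combination d2 - algebraMap K L a * d1
    have hb0 : b = 0 := polyOf_eq_zero (polynomial_eq_zero_of_aeval_eq_zero
      (by rw [hUv]; exact ha) hb (natDegree_polyOf_lt hepos.ne' b))
    subst hb0
    have hp0 : polyOf (0 : Fin (deg K v) → K) = 0 := by simp [polyOf]
    rw [hp0, Polynomial.derivative_zero, map_zero, mul_zero, add_zero] at d1
    have hc : Polynomial.aeval (aeval v U) (polyOf c) = 0 := by
      have := hs.1
      simp only [u, map_add, map_mul, aeval_pencilForm U _ _ h0, hp0, map_zero, mul_zero,
        add_zero] at this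
      exact this
    have hc0 : c = 0 := polyOf_eq_zero (polynomial_eq_zero_of_aeval_derivative_eq_zero
      (by rw [hUv]; exact ha) hc d1 ((natDegree_polyOf_lt (Nat.succ_ne_zero d) c).trans hd2))
    rw [hc0]
    rfl
  refine (prob_le_of_translates (c := 1) u huh fun F hF => ?_).trans_eq ?_
  · rw [Set.ncard_le_one]
    intro c hc c' hc'
    refine sub_eq_zero.1 (hinj _ ?_)
    have := SingAt.sub hc hc'
    rwa [add_sub_add_left_eq_sub, ← husub] at this
  · simp [pow_add]

theorem prob_singAt_le_inv {v : Fin 3 → L} {d : ℕ} (hv : Nrm v) (hd : 2 * deg K v ≤ d + 1) :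
    prob K d (fun F => SingAt F v) ≤ ((Fintype.card K : ℝ) ^ (3 * deg K v))⁻¹ := by
  classical
  have := prob_le_of_card_mul_le (M := 1) (pow_pos Fintype.card_pos _)
    (by simpa using card_singAt_mul_le hv hd)
  push_cast at this
  simpa using this

/-- The coefficient 1, where `card_degPts_le` has 2, matters: `inv_card_le_prob_smooth` is decided
by the terms of order 1/q. -/
theorem card_degPts_affine_le (e : ℕ) [DecidableEq L] :
    {v ∈ degPts K L e | v 0 = 1}.card ≤ Fintype.card K ^ (2 * e) := by
  rcases Nat.eq_zero_or_pos e with rfl | he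
  · rw [Finset.card_eq_zero.2]
    · simp
    · ext v
      simp [mem_degPts, (deg_pos (K := K) v).ne']
  refine le_trans (Finset.card_le_card_of_injOn (t := fixedElts K L e ×ˢ fixedElts K L e)
    (fun v => (v 1, v 2)) (fun v hv => ?_) fun v hv w hw h => ?_) ?_
  · simp only [Finset.coe_filter, Set.mem_ofPred_eq, mem_degPts] at hv
    obtain ⟨⟨hv, rfl⟩, h0⟩ := hv
    simp only [Finset.coe_product, Set.mem_prod, Finset.mem_coe, mem_fixedElts he.ne']
    constructor <;> rw [← frob_iterate_apply, frob_iterate_deg]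
  · simp only [Finset.coe_filter, Set.mem_ofPred_eq] at hv hw
    simp only [Prod.mk.injEq] at h
    funext i
    fin_cases i
    · exact hv.2.trans hw.2.symm
    · exact h.1
    · exact h.2
  · rw [Finset.card_product, two_mul, pow_add]
    exact Nat.mul_le_mul (card_fixedElts_le he.ne') (card_fixedElts_le he.ne')

theorem card_degPts_infinity_le (e : ℕ) [DecidableEq L] :
    {v ∈ degPts K L e | v 0 = 0}.card ≤ 2 * Fintype.card K ^ e := by
  classical
  rcases Nat.eq_zero_or_pos e with rfl | he
  · rw [Finset.card_eq_zero.2]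
    · simp
    · ext v
      simp [mem_degPts, (deg_pos (K := K) v).ne']
  have h1 : {v ∈ degPts K L e | v 0 = 0} ⊆
      (fixedElts K L e).image (fun y => (![0, 1, y] : Fin 3 → L)) ∪ {![0, 0, 1]} := by
    intro v hv
    simp only [Finset.mem_filter, mem_degPts] at hv
    obtain ⟨⟨hv, hve⟩, h0⟩ := hv
    rw [Finset.mem_union, Finset.mem_image, Finset.mem_singleton]
    rcases nrm_cases hv with ⟨x, y, rfl⟩ | ⟨y, rfl⟩ | rfl
    · simp at h0
    · refine Or.inl ⟨y, (mem_fixedElts he.ne').2 ?_, rfl⟩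
      have := congrFun (frob_iterate_deg (K := K) (![0, 1, y] : Fin 3 → L)) 2
      rw [frob_iterate_apply, hve] at this
      exact this
    · exact Or.inr rfl
  refine (Finset.card_le_card h1).trans ((Finset.card_union_le _ _).trans ?_)
  have h2 := (Finset.card_image_le (s := fixedElts K L e)
    (f := fun y => (![0, 1, y] : Fin 3 → L))).trans (card_fixedElts_le he.ne')
  have h3 : 1 ≤ Fintype.card K ^ e := Nat.one_le_pow _ _ Fintype.card_pos
  rw [Finset.card_singleton]
  omega

theorem prob_sing_affine_low_le (K : Type*) [Field K] [Fintype K] (L : Type*) [Field L] [Algebra K L]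
    [Algebra.IsAlgebraic K L] (d : ℕ) :
    prob K d (fun F => ∃ v : Fin 3 → L, Nrm v ∧ v 0 = 1 ∧ 2 * deg K v ≤ d + 1 ∧ SingAt F v) ≤
      1 / (Fintype.card K : ℝ) + 2 / (Fintype.card K : ℝ) ^ 2 := by
  classical
  have hq := two_le_card_real (K := K)
  set q : ℝ := ((Fintype.card K : ℕ) : ℝ) with hqdef
  refine (prob_mono (r := fun F => ∃ e ∈ Finset.Ico 1 (d + 2), ∃ v ∈ {v ∈ degPts K L e | v 0 = 1},
    2 * e ≤ d + 1 ∧ SingAt F v) fun F _ => ?_).trans ((prob_exists_le _ _ _).trans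
      ((Finset.sum_le_sum (g := fun e => (q ^ e)⁻¹) fun e _ => ?_).trans ?_))
  · rintro ⟨v, hv, h0, hd, hs⟩
    exact ⟨deg K v, Finset.mem_Ico.2 ⟨deg_pos v, by omega⟩, v,
      Finset.mem_filter.2 ⟨mem_degPts.2 ⟨hv, rfl⟩, h0⟩, hd, hs⟩
  · refine (prob_exists_le _ _ _).trans ?_
    refine (Finset.sum_le_card_nsmul _ _ (q ^ (3 * e))⁻¹ fun v hv => ?_).trans ?_
    · obtain ⟨hv, -⟩ := Finset.mem_filter.1 hv
      obtain ⟨hv', rfl⟩ := mem_degPts.1 hv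
      by_cases hd : 2 * deg K v ≤ d + 1
      · simpa [hd] using prob_singAt_le_inv hv' hd
      · rw [prob_eq]
        simp only [hd, false_and, Finset.filter_false, Finset.card_empty, Nat.cast_zero, zero_div]
        positivity
    · have h : (({v ∈ degPts K L e | v 0 = 1}.card : ℕ) : ℝ) ≤ q ^ (2 * e) := by
        rw [hqdef]
        exact_mod_cast card_degPts_affine_le (K := K) (L := L) e
      rw [nsmul_eq_mul]
      refine (mul_le_mul_of_nonneg_right h (by positivity)).trans (le_of_eq ?_)
      rw [show 3 * e = 2 * e + e by ring, pow_add]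
      have : q ≠ 0 := by positivity
      field_simp
  · rw [Finset.sum_eq_sum_Ico_succ_bot (by omega)]
    have := sum_Ico_inv_pow_le hq (1 + 1) (d + 2)
    rw [div_eq_mul_inv 2, one_div, pow_one]
    linarith

/-- At most q^(2e) points of degree e, each with probability q^(-(d+1+e)), give a geometric series
that starts with q^(-2) because e < d. -/
theorem prob_sing_affine_medium_le (K : Type*) [Field K] [Fintype K] (L : Type*) [Field L]
    [Algebra K L] [Algebra.IsAlgebraic K L] {d : ℕ} (hd : d ≤ Fintype.card K) :
    prob K d (fun F => ∃ v : Fin 3 → L, Nrm v ∧ v 0 = 1 ∧ d + 1 < 2 * deg K v ∧ deg K v < d ∧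
      SingAt F v) ≤ 2 / (Fintype.card K : ℝ) ^ 2 := by
  classical
  have hq := two_le_card_real (K := K)
  set q : ℝ := ((Fintype.card K : ℕ) : ℝ) with hqdef
  refine (prob_mono (r := fun F => ∃ e ∈ Finset.range d, ∃ v ∈ {v ∈ degPts K L e | v 0 = 1},
    d + 1 < 2 * e ∧ SingAt F v) fun F _ => ?_).trans ((prob_exists_le _ _ _).trans
      ((Finset.sum_le_sum (g := fun e => (q ^ (d + 1 - e))⁻¹) fun e he => ?_).trans ?_))
  · rintro ⟨v, hv, h0, hd, hd', hs⟩
    exact ⟨deg K v, Finset.mem_range.2 hd', v,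
      Finset.mem_filter.2 ⟨mem_degPts.2 ⟨hv, rfl⟩, h0⟩, hd, hs⟩
  · rw [Finset.mem_range] at he
    refine (prob_exists_le _ _ _).trans ?_
    refine (Finset.sum_le_card_nsmul _ _ (q ^ (d + 1 + e))⁻¹ fun v hv => ?_).trans ?_
    · obtain ⟨hv, h0⟩ := Finset.mem_filter.1 hv
      obtain ⟨hv', rfl⟩ := mem_degPts.1 hv
      by_cases hd2 : d + 1 < 2 * deg K v
      · simpa [hd2] using prob_singAt_affine_le h0 (by omega) (by omega) hd2
      · rw [prob_eq]
        simp only [hd2, false_and, Finset.filter_false, Finset.card_empty, Nat.cast_zero, zero_div]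
        positivity
    · have h : (({v ∈ degPts K L e | v 0 = 1}.card : ℕ) : ℝ) ≤ q ^ (2 * e) := by
        rw [hqdef]
        exact_mod_cast card_degPts_affine_le (K := K) (L := L) e
      rw [nsmul_eq_mul]
      refine (mul_le_mul_of_nonneg_right h (by positivity)).trans (le_of_eq ?_)
      rw [show d + 1 + e = (d + 1 - e) + 2 * e by omega, pow_add]
      have : q ≠ 0 := by positivity
      field_simp
  · rw [← Finset.sum_range_reflect]
    have h1 : ∀ j ∈ Finset.range d, (q ^ (d + 1 - (d - 1 - j)))⁻¹ = (q ^ (2 + j))⁻¹ := by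
      intro j hj
      rw [Finset.mem_range] at hj
      rw [show d + 1 - (d - 1 - j) = 2 + j by omega]
    rw [Finset.sum_congr rfl h1]
    have := sum_Ico_inv_pow_le hq 2 (d + 2)
    rw [Finset.sum_Ico_eq_sum_range, Nat.add_sub_cancel] at this
    rwa [div_eq_mul_inv]

/-- The line at infinity has only O(q^e) points of degree e, so the series starts with q^(-2). -/
theorem prob_sing_infinity_low_le (K : Type*) [Field K] [Fintype K] (L : Type*) [Field L]
    [Algebra K L] [Algebra.IsAlgebraic K L] (d : ℕ) :
    prob K d (fun F => ∃ v : Fin 3 → L, Nrm v ∧ v 0 = 0 ∧ 2 * deg K v ≤ d + 1 ∧ SingAt F v) ≤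
      4 / (Fintype.card K : ℝ) ^ 2 := by
  classical
  have hq := two_le_card_real (K := K)
  set q : ℝ := ((Fintype.card K : ℕ) : ℝ) with hqdef
  refine (prob_mono (r := fun F => ∃ e ∈ Finset.Ico 1 (d + 2), ∃ v ∈ {v ∈ degPts K L e | v 0 = 0},
    2 * e ≤ d + 1 ∧ SingAt F v) fun F _ => ?_).trans ((prob_exists_le _ _ _).trans
      ((Finset.sum_le_sum (g := fun e => 2 * ((q ^ 2) ^ e)⁻¹) fun e _ => ?_).trans ?_))
  · rintro ⟨v, hv, h0, hd, hs⟩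
    exact ⟨deg K v, Finset.mem_Ico.2 ⟨deg_pos v, by omega⟩, v,
      Finset.mem_filter.2 ⟨mem_degPts.2 ⟨hv, rfl⟩, h0⟩, hd, hs⟩
  · refine (prob_exists_le _ _ _).trans ?_
    refine (Finset.sum_le_card_nsmul _ _ (q ^ (3 * e))⁻¹ fun v hv => ?_).trans ?_
    · obtain ⟨hv, -⟩ := Finset.mem_filter.1 hv
      obtain ⟨hv', rfl⟩ := mem_degPts.1 hv
      by_cases hd : 2 * deg K v ≤ d + 1
      · simpa [hd] using prob_singAt_le_inv hv' hd
      · rw [prob_eq]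
        simp only [hd, false_and, Finset.filter_false, Finset.card_empty, Nat.cast_zero, zero_div]
        positivity
    · have h : (({v ∈ degPts K L e | v 0 = 0}.card : ℕ) : ℝ) ≤ 2 * q ^ e := by
        rw [hqdef]
        exact_mod_cast card_degPts_infinity_le (K := K) (L := L) e
      rw [nsmul_eq_mul]
      refine (mul_le_mul_of_nonneg_right h (by positivity)).trans (le_of_eq ?_)
      rw [← pow_mul, show 3 * e = 2 * e + e by ring, pow_add]
      have : q ≠ 0 := by positivity
      field_simp
  · rw [← Finset.mul_sum]
    have := sum_Ico_inv_pow_le (show (2 : ℝ) ≤ q ^ 2 by nlinarith) 1 (d + 2)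
    rw [div_eq_mul_inv]
    rw [pow_one] at this
    linarith

/-- On the line at infinity F becomes a polynomial of degree at most d with a double root of degree
above (d + 1)/2. So it vanishes identically there, which amounts to d + 1 conditions. -/
theorem prob_sing_infinity_high_le (K : Type*) [Field K] [Fintype K] (L : Type*) [Field L]
    [Algebra K L] [Algebra.IsAlgebraic K L] {d : ℕ} (hd : 1 ≤ d) :
    prob K d (fun F => ∃ v : Fin 3 → L, Nrm v ∧ v 0 = 0 ∧ d + 1 < 2 * deg K v ∧ SingAt F v) ≤
      1 / (Fintype.card K : ℝ) ^ (d + 1) := by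
  classical
  let s : Fin 3 → Polynomial K := ![0, 1, Polynomial.X]
  let u : (Fin (d + 1) → K) → MvPolynomial (Fin 3) K := pencilForm (X 2) 1 d
  have key : ∀ F ∈ forms K d, (∃ v : Fin 3 → L, Nrm v ∧ v 0 = 0 ∧ d + 1 < 2 * deg K v ∧
      SingAt F v) → aeval s F = 0 := by
    rintro F hF ⟨v, hv, h0, hd2, hs⟩
    rcases nrm_cases hv with ⟨x, y, rfl⟩ | ⟨y, rfl⟩ | rfl
    · simp at h0
    · have hev : ∀ G : MvPolynomial (Fin 3) K,
          Polynomial.aeval y (aeval s G) = aeval ![0, 1, y] G := fun G => by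
        rw [comp_aeval_apply]
        congr 2
        funext i
        fin_cases i <;> simp [s]
      have hy : ∀ i, 0 < i → i < deg K (![0, 1, y] : Fin 3 → L) → y ^ Fintype.card K ^ i ≠ y := by
        intro i hi hi' h
        have := deg_le_of_pow_eq (K := K) (v := ![0, 1, y]) hi (fun j => by
          fin_cases j
          · simp
          · simp
          · exact h)
        omega
      refine polynomial_eq_zero_of_aeval_derivative_eq_zero hy (by rw [hev, hs.1]) ?_
        ((natDegree_aeval_restrict_le (mem_forms.1 hF)).trans_lt (by omega))
      rw [derivative_aeval_restrict, hev, hs.2]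
    · have : deg K (![0, 0, 1] : Fin 3 → L) ≤ 1 := deg_le_of_pow_eq one_pos fun j => by
        fin_cases j <;> simp [Fintype.card_ne_zero]
      omega
  refine (prob_mono key).trans ((prob_le_of_translates (c := 1) u
    (isHomogeneous_pencilForm (isHomogeneous_X K 2) 1 le_rfl) fun F hF => ?_).trans_eq ?_)
  · rw [Set.ncard_le_one]
    intro c hc c' hc'
    refine sub_eq_zero.1 (polyOf_eq_zero ?_)
    have h1 := congrArg₂ (· - ·) hc hc'
    simp only [map_add, add_sub_add_left_eq_sub, sub_zero] at h1
    rw [← map_sub, ← pencilForm_sub] at h1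
    have h2 : ∀ b, aeval s (u b) = polyOf b := fun b => by
      simp [u, s, pencilForm, polyOf, Polynomial.C_mul_X_pow_eq_monomial,
        Polynomial.algebraMap_eq]
    rw [← h2]
    exact h1
  · simp

/-- In characteristic larger than `d`, the smooth forms of degree `d` are not too rare. -/
theorem inv_card_le_prob_smooth (K : Type*) [Field K] [Fintype K] (p : ℕ) [Fact p.Prime] [CharP K p]
    {d : ℕ} (hd : 4 ≤ d) (hdp : d < p) (hq : 10 ≤ Fintype.card K) :
    1 / (Fintype.card K : ℝ) ≤
      prob K d (fun F => ∀ v : Fin 3 → AlgebraicClosure K, Nrm v → ¬ SingAt F v) := by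
  set L := AlgebraicClosure K
  have hpq : p ≤ Fintype.card K := by
    obtain ⟨n, hp, hn⟩ := FiniteField.card K p
    rw [hn]
    exact Nat.le_self_pow n.pos.ne' p
  have h1 := prob_sing_affine_low_le K L d
  have h2 := prob_sing_affine_medium_le K L (d := d) (by omega)
  have h3 := prob_sing_infinity_low_le K L d
  have h4 := prob_sing_infinity_high_le K L (d := d) (by omega)
  have h5 := prob_not_isRelPrime_le (K := K) (show (1 : Fin 3) ≠ 2 by decide)
    (show (1 : Fin 3) ≠ 0 by decide) (show (2 : Fin 3) ≠ 0 by decide) p d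
  have h6 := prob_singAt_of_isRelPrime_le (K := K) L (a := 1) (b := 2) (c := 0) (by decide)
    (by decide) p d (e := d) (D := 0) (by omega) (by omega)
  -- At most d - 2 orbits of degree at least d, each with probability 1/q: as d < q this leaves a
  -- margin of 3/q. Affine points of low degree use 1/q of it, up to 2/q², and all the terms of
  -- order 1/q² add up to at most 10/q² ≤ 1/q.
  have hdiv : (d - 1) ^ 2 / d = d - 2 := by
    obtain ⟨m, rfl⟩ : ∃ m, d = m + 2 := ⟨d - 2, by omega⟩
    rw [show (m + 2 - 1) ^ 2 = 1 + (m + 2) * m by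
      rw [show m + 2 - 1 = m + 1 by omega]; ring, Nat.add_mul_div_left _ _ (by omega),
      Nat.div_eq_of_lt (by omega)]
    omega
  rw [Nat.div_eq_of_lt hdp, Nat.sub_zero] at h5
  rw [hdiv, zero_add, pow_one] at h6
  have hunion : prob K d (fun F => ¬ ∀ v : Fin 3 → L, Nrm v → ¬ SingAt F v) ≤ _ :=
    (prob_mono fun F hF h => by
      push Not at h
      obtain ⟨v, hv, hs⟩ := h
      rcases nrm_cases hv with ⟨x, y, hxy⟩ | ⟨y, hxy⟩ | hxy
      · have h0 : v 0 = 1 := by rw [hxy]; rfl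
        by_cases g1 : 2 * deg K v ≤ d + 1
        · exact Or.inl (Or.inl (Or.inl ⟨v, hv, h0, g1, hs⟩))
        by_cases g2 : deg K v < d
        · exact Or.inl (Or.inl (Or.inr ⟨v, hv, h0, by omega, g2, hs⟩))
        by_cases g3 : pderiv 1 F ≠ 0 ∧ IsRelPrime (pderiv 1 F) (pderiv 2 F)
        · exact Or.inr (Or.inr ⟨g3, v, hv, h0, by omega, hs⟩)
        · exact Or.inr (Or.inl g3)
      all_goals
        have h0 : v 0 = 0 := by rw [hxy]; rfl
        by_cases g1 : 2 * deg K v ≤ d + 1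
        · exact Or.inl (Or.inr (Or.inl ⟨v, hv, h0, g1, hs⟩))
        · exact Or.inl (Or.inr (Or.inr ⟨v, hv, h0, by omega, hs⟩))).trans
    ((prob_or_le d _ _).trans (add_le_add ((prob_or_le d _ _).trans
      (add_le_add ((prob_or_le d _ _).trans (add_le_add h1 h2))
        ((prob_or_le d _ _).trans (add_le_add h3 h4))))
      ((prob_or_le d _ _).trans (add_le_add h5 h6))))
  rw [prob_not] at hunion
  have hq' : (10 : ℝ) ≤ Fintype.card K := by exact_mod_cast hq
  set q : ℝ := ((Fintype.card K : ℕ) : ℝ) with hqdef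
  have hq0 : 0 < q := by linarith
  have hd1 : ((d - 2 : ℕ) : ℝ) ≤ q - 3 := by
    have : d - 2 + 3 ≤ Fintype.card K := by omega
    have : ((d - 2 : ℕ) : ℝ) + 3 ≤ q := by rw [hqdef]; exact_mod_cast this
    linarith
  have hd2 : (2 * d + 2) / q ^ d ≤ 1 / q ^ 2 := by
    have hdq : (2 * d + 2 : ℝ) ≤ q ^ 2 := by
      have : d + 1 ≤ Fintype.card K := by omega
      have : (d : ℝ) + 1 ≤ q := by rw [hqdef]; exact_mod_cast this
      nlinarith
    rw [div_le_div_iff₀ (by positivity) (by positivity), one_mul]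
    calc (2 * d + 2 : ℝ) * q ^ 2 ≤ q ^ 2 * q ^ 2 := by gcongr
      _ = q ^ 4 := by ring
      _ ≤ q ^ d := pow_le_pow_right₀ (by linarith) hd
  have hd3 : 1 / q ^ (d + 1) ≤ 1 / q ^ 2 :=
    one_div_le_one_div_of_le (by positivity) (pow_le_pow_right₀ (by linarith) (by omega))
  have hd4 : ((d - 2 : ℕ) : ℝ) / q ≤ (q - 3) / q := by gcongr
  have hd5 : (q - 3) / q = 1 - 3 * (1 / q) := by field_simp
  have hd6 : 1 / q ^ 2 ≤ 1 / 10 * (1 / q) := by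
    rw [one_div_mul_one_div]
    exact one_div_le_one_div_of_le (by positivity) (by nlinarith)
  have e1 : 2 / q ^ 2 = 2 * (1 / q ^ 2) := by ring
  have e2 : 4 / q ^ 2 = 4 * (1 / q ^ 2) := by ring
  linarith

end LargeCharacteristic

/-! ### Moments of the point count and of the model -/

section Moments

open Classical in
theorem choose_card_filter_eq_sum {α : Type*} (s : Finset α) (P : α → Prop) (j : ℕ) :
    (({v ∈ s | P v}.card.choose j : ℕ) : ℝ) = ∑ Z ∈ s.powersetCard j, ind (∀ v ∈ Z, P v) := by
  rw [sum_ind, ← Finset.card_powersetCard]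
  congr 2
  ext Z
  simp only [Finset.mem_powersetCard, Finset.mem_filter, Finset.subset_iff]
  constructor
  · rintro ⟨h1, h2⟩
    exact ⟨⟨fun v hv => (h1 hv).1, h2⟩, fun v hv => (h1 hv).2⟩
  · rintro ⟨⟨h1, h2⟩, h3⟩
    exact ⟨fun v hv => ⟨h1 hv, h3 v hv⟩, h2⟩

variable {K : Type*} [Field K] [Fintype K]

/-- A binomial coefficient of the point count is the number of j-element sets of rational points on
the curve, so its average is a sum of the probabilities in the hypothesis. `abs_sub_binE_le` passes
from there to powers. -/
theorem abs_avg_pow_sub_le {d k : ℕ} (p : MvPolynomial (Fin 3) K → Prop) {w ρ η : ℝ}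
    (h : ∀ Z : Finset (Fin 3 → K), (∀ v ∈ Z, Nrm v) → Z.card ≤ k →
      |prob K d (fun F => (∀ v ∈ Z, eval v F = 0) ∧ p F) - w * ρ ^ Z.card| ≤ η) (c : ℝ) :
    |avg K d (fun F => ((pointCount F : ℝ) - c) ^ k * ind (p F)) -
      w * binE ρ (Fintype.card K ^ 2 + Fintype.card K + 1) (fun x => ((x : ℝ) - c) ^ k)| ≤
      (((Fintype.card K ^ 2 + Fintype.card K + 1 : ℕ) : ℝ) + |c|) ^ k * η := by
  classical
  let Λ : (ℕ → ℝ) →ₗ[ℝ] ℝ :=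
    { toFun := fun f => avg K d fun F => f (pointCount F) * ind (p F)
      map_add' := fun f g => by
        rw [← avg_add]
        exact avg_congr fun F _ => add_mul _ _ _
      map_smul' := fun a f => by
        rw [RingHom.id_apply, smul_eq_mul, ← avg_mul_left]
        exact avg_congr fun F _ => mul_assoc _ _ _ }
  have hΛ : ∀ f, Λ f = avg K d fun F => f (pointCount F) * ind (p F) := fun f => rfl
  refine abs_sub_binE_le (Λ := Λ) (fun j hj => ?_) c
  have e1 : (Λ fun x => (x.choose j : ℝ)) = ∑ Z ∈ (ratPts K).powersetCard j,
      prob K d (fun F => (∀ v ∈ Z, eval v F = 0) ∧ p F) := by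
    simp only [prob]
    rw [hΛ, ← avg_sum]
    refine avg_congr fun F hF => ?_
    simp only [ind_and]
    rw [pointCount_eq (mem_forms.1 hF), ← Finset.sum_mul, ← choose_card_filter_eq_sum]
  have e2 : w * (((Fintype.card K ^ 2 + Fintype.card K + 1).choose j : ℝ) * ρ ^ j) =
      ∑ Z ∈ (ratPts K).powersetCard j, w * ρ ^ j := by
    rw [Finset.sum_const, Finset.card_powersetCard, card_ratPts, nsmul_eq_mul]
    ring
  have e3 : ((Fintype.card K ^ 2 + Fintype.card K + 1).choose j : ℝ) * η =
      ∑ Z ∈ (ratPts K).powersetCard j, η := by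
    rw [Finset.sum_const, Finset.card_powersetCard, card_ratPts, nsmul_eq_mul]
  rw [e1, e2, e3, ← Finset.sum_sub_distrib]
  refine (Finset.abs_sum_le_sum_abs _ _).trans (Finset.sum_le_sum fun Z hZ => ?_)
  rw [Finset.mem_powersetCard] at hZ
  have := h Z (fun v hv => mem_ratPts.1 (hZ.1 hv)) (hZ.2.trans_le hj)
  rwa [hZ.2] at this

theorem prob_vanish_eq {d : ℕ} (Z : Finset (Fin 3 → K)) (hZ : ∀ v ∈ Z, Nrm v)
    (hd : Z.card ≤ d + 1) :
    prob K d (fun F => ∀ v ∈ Z, eval v F = 0) = (1 / (Fintype.card K : ℝ)) ^ Z.card := by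
  classical
  have := prob_vanish_singOn (L := K) (d := d) Z hZ ∅ (by simp) (by simpa using hd)
  simpa using this

variable (K) in
/-- The deviation of the number of points of a form from `q + 1`. -/
noncomputable def dev (F : MvPolynomial (Fin 3) K) : ℝ :=
  (pointCount F : ℝ) - ((Fintype.card K : ℝ) + 1)

/-- Vanishing at up to d + 1 rational points consists of independent events of probability 1/q, so
these moments are exactly binomial. -/
theorem avg_dev_pow_eq {d k : ℕ} (hk : k ≤ d + 1) :
    avg K d (fun F => dev K F ^ k) =
      binE (1 / (Fintype.card K : ℝ)) (Fintype.card K ^ 2 + Fintype.card K + 1)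
        (fun x => ((x : ℝ) - ((Fintype.card K : ℝ) + 1)) ^ k) := by
  have h := abs_avg_pow_sub_le (K := K) (d := d) (k := k) (fun _ => True) (w := 1)
    (ρ := 1 / (Fintype.card K : ℝ)) (η := 0) (fun Z hZ hZk => by
      simp only [and_true]
      rw [prob_vanish_eq Z hZ (hZk.trans hk), one_mul, sub_self, abs_zero])
    ((Fintype.card K : ℝ) + 1)
  rw [mul_zero, one_mul] at h
  rw [← sub_eq_zero, ← abs_nonpos_iff]
  simpa [ind, dev] using h

/-- The moments of the number of points of all forms of large degree. -/
theorem exists_abs_avg_dev_pow_le (k : ℕ) : ∃ C : ℝ, 0 ≤ C ∧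
    ∀ (K : Type*) [Field K] [Fintype K] (d : ℕ), k ≤ d + 1 →
      |avg K d (fun F => dev K F ^ k)| ≤ C * (Fintype.card K : ℝ) ^ (k / 2) := by
  choose C hC0 hC using exists_abs_binMoment_le
  refine ⟨∑ j ∈ Finset.range (k + 1), C j * 3 ^ (j / 2) * (k.choose j : ℝ),
    Finset.sum_nonneg fun j _ => by have := hC0 j; positivity, fun K _ _ d hk => ?_⟩
  have hq := two_le_card_real (K := K)
  rw [avg_dev_pow_eq hk]
  set q : ℝ := ((Fintype.card K : ℕ) : ℝ) with hqdef
  have hn : ((Fintype.card K ^ 2 + Fintype.card K + 1 : ℕ) : ℝ) = q ^ 2 + q + 1 := by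
    rw [hqdef]
    push_cast
    ring
  set n := Fintype.card K ^ 2 + Fintype.card K + 1 with hndef
  -- The mean over all forms is q + 1 + 1/q, so centring at q + 1 costs only a shift by 1/q ≤ 1.
  have hnq : (n : ℝ) * (1 / q) = q + 1 + 1 / q := by
    rw [hn]
    field_simp
  have e : (fun x : ℕ => ((x : ℝ) - (q + 1)) ^ k) =
      fun x : ℕ => (((x : ℝ) - n * (1 / q)) + 1 / q) ^ k := by
    funext x
    rw [hnq]
    ring
  rw [e, binE_add_pow, Finset.sum_mul]
  have hq1 : 1 / q ≤ 1 := by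
    rw [div_le_one (by linarith)]
    linarith
  have hq0 : 0 ≤ 1 / q := by positivity
  refine (Finset.abs_sum_le_sum_abs _ _).trans (Finset.sum_le_sum fun j hj => ?_)
  rw [Finset.mem_range] at hj
  have b1 := hC j (1 / q) hq0 hq1 n
  have b2 : 1 + n * (1 / q * (1 - 1 / q)) ≤ 3 * q := by
    rw [← mul_assoc, hnq]
    nlinarith [mul_nonneg hq0 hq0]
  have b2' : 0 ≤ 1 + n * (1 / q * (1 - 1 / q)) := by
    have : 0 ≤ 1 - 1 / q := by linarith
    positivity
  have b3 : (1 + n * (1 / q * (1 - 1 / q))) ^ (j / 2) ≤ 3 ^ (j / 2) * q ^ (k / 2) := by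
    refine (pow_le_pow_left₀ b2' b2 _).trans ?_
    rw [mul_pow]
    exact mul_le_mul_of_nonneg_left (pow_le_pow_right₀ (by linarith)
      (Nat.div_le_div_right (by omega))) (by positivity)
  have hCj := hC0 j
  rw [abs_mul, abs_mul, abs_pow, abs_of_nonneg hq0, Nat.abs_cast]
  change |binMoment (1 / q) n j| * _ * _ ≤ _
  calc |binMoment (1 / q) n j| * (1 / q) ^ (k - j) * (k.choose j : ℝ) ≤
        (C j * (3 ^ (j / 2) * q ^ (k / 2))) * 1 * (k.choose j : ℝ) := by
        gcongr
        · exact b1.trans (mul_le_mul_of_nonneg_left b3 hCj)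
        · exact pow_le_one₀ hq0 hq1
    _ = _ := by ring

theorem rho_nonneg (q : ℕ) : 0 ≤ rho q := by
  rw [rho]
  positivity

theorem rho_le {q : ℕ} (hq : 2 ≤ q) : rho q ≤ 3 / 7 := by
  have : (2 : ℝ) ≤ q := by exact_mod_cast hq
  rw [rho, div_le_div_iff₀ (by positivity) (by norm_num)]
  nlinarith

/-- The central moments of the number of successes in the model. -/
noncomputable def modelMoment (q k : ℕ) : ℝ := binMoment (rho q) (q ^ 2 + q + 1) k

theorem card_mul_rho (q : ℕ) : ((q ^ 2 + q + 1 : ℕ) : ℝ) * rho q = (q : ℝ) + 1 := by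
  rw [rho]
  push_cast
  field_simp

theorem modelMoment_eq (q k : ℕ) :
    modelMoment q k = binE (rho q) (q ^ 2 + q + 1) fun x => ((x : ℝ) - ((q : ℝ) + 1)) ^ k := by
  rw [modelMoment, binMoment, card_mul_rho]

theorem exists_abs_modelMoment_le (k : ℕ) : ∃ C : ℝ, 0 ≤ C ∧ ∀ q : ℕ, 2 ≤ q →
    |modelMoment q k| ≤ C * (q : ℝ) ^ (k / 2) := by
  obtain ⟨C, hC0, hC⟩ := exists_abs_binMoment_le k
  refine ⟨C * 2 ^ (k / 2), by positivity, fun q hq => ?_⟩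
  have h0 := rho_nonneg q
  have h1 := rho_le hq
  have hq' : (2 : ℝ) ≤ q := by exact_mod_cast hq
  refine (hC _ h0 (by linarith) _).trans ?_
  rw [← mul_assoc, card_mul_rho, mul_assoc, ← mul_pow]
  refine mul_le_mul_of_nonneg_left (pow_le_pow_left₀ ?_ ?_ _) hC0
  · have : 0 ≤ 1 - rho q := by linarith
    positivity
  · nlinarith

theorem exists_le_modelMoment (k : ℕ) : ∃ c : ℝ, 0 < c ∧ ∀ q : ℕ, 2 ≤ q → 2 ≤ k →
    c * (q : ℝ) ^ (k / 2) ≤ modelMoment q k := by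
  rcases k with _ | _ | k
  · exact ⟨1, one_pos, fun q _ h => absurd h (by omega)⟩
  · exact ⟨1, one_pos, fun q _ h => absurd h (by omega)⟩
  obtain ⟨c, hc, h⟩ := exists_le_binMoment k
  refine ⟨c * (4 / 7) ^ ((k + 2) / 2), by positivity, fun q hq _ => ?_⟩
  have h0 := rho_nonneg q
  have h1 := rho_le hq
  refine le_trans ?_ (h _ h0 h1 (q ^ 2 + q + 1) (by omega))
  rw [← mul_assoc, card_mul_rho, mul_assoc, ← mul_pow]
  refine mul_le_mul_of_nonneg_left (pow_le_pow_left₀ (by positivity) ?_ _) hc.le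
  nlinarith [Nat.cast_nonneg (α := ℝ) q]

theorem iIndepFun_real_forall_eq {Ω : Type*} [MeasurableSpace Ω] {μ : Measure Ω}
    {q : ℕ} {X : Fin (q ^ 2 + q + 1) → Ω → ℝ}
    (hX : IsPointModel q μ X) (Z : Finset (Fin (q ^ 2 + q + 1))) :
    μ.real {ω | ∀ i ∈ Z, X i ω = 1} = rho q ^ Z.card := by
  have h := hX.indep.measure_inter_preimage_eq_mul Z (sets := fun _ => {1})
    (fun i _ => measurableSet_singleton 1)
  have e : {ω | ∀ i ∈ Z, X i ω = 1} = ⋂ i ∈ Z, X i ⁻¹' {1} := by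
    ext ω
    simp
  rw [Measure.real, e, h, ENNReal.toReal_prod, ← Finset.prod_const]
  exact Finset.prod_congr rfl fun i _ => hX.prob_one i

/-- The variables are almost surely 0 or 1, since the two probabilities add up to 1, so their sum is
the number N of successes. By independence N has binomial factorial moments, and `abs_sub_binE_le`
applies with η = 0. -/
theorem integral_model_eq {Ω : Type*} [MeasurableSpace Ω] (μ : Measure Ω) [IsProbabilityMeasure μ]
    {q : ℕ} {X : Fin (q ^ 2 + q + 1) → Ω → ℝ} (hX : IsPointModel q μ X) (k : ℕ) :
    ∫ ω, ((∑ i, X i ω) - ((q : ℝ) + 1)) ^ k ∂μ = modelMoment q k := by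
  classical
  let N : Ω → ℕ := fun ω => {i ∈ (Finset.univ : Finset (Fin (q ^ 2 + q + 1))) | X i ω = 1}.card
  have hset : ∀ i, MeasurableSet {ω | X i ω = 1} := fun i =>
    hX.measurable i (measurableSet_singleton 1)
  have hN : Measurable N := by
    have : N = fun ω => ∑ i, if X i ω = 1 then 1 else 0 := by
      funext ω
      rw [Finset.sum_boole]
      rfl
    rw [this]
    exact Finset.measurable_sum _ fun i _ => Measurable.ite (hset i) measurable_const measurable_const
  have hNle : ∀ ω, N ω ≤ q ^ 2 + q + 1 := fun ω =>
    (Finset.card_filter_le _ _).trans (by simp)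
  have hint : ∀ f : ℕ → ℝ, Integrable (fun ω => f (N ω)) μ := fun f => by
    refine Integrable.of_bound ((measurable_of_countable f).comp hN).aestronglyMeasurable
      (∑ i ∈ Finset.range (q ^ 2 + q + 2), |f i|) (Filter.Eventually.of_forall fun ω => ?_)
    rw [Real.norm_eq_abs]
    exact Finset.single_le_sum (f := fun i => |f i|) (fun i _ => abs_nonneg _)
      (Finset.mem_range.2 (Nat.lt_succ_of_le (hNle ω)))
  let Λ : (ℕ → ℝ) →ₗ[ℝ] ℝ :=
    { toFun := fun f => ∫ ω, f (N ω) ∂μ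
      map_add' := fun f g => integral_add (hint f) (hint g)
      map_smul' := fun a f => integral_const_mul a _ }
  have h := abs_sub_binE_le (Λ := Λ) (n := q ^ 2 + q + 1) (k := k) (η := 0) (w := 1) (ρ := rho q)
    (fun j hj => by
      have e1 : (Λ fun x => (x.choose j : ℝ)) =
          ∑ Z ∈ (Finset.univ : Finset (Fin (q ^ 2 + q + 1))).powersetCard j, rho q ^ j := by
        change ∫ ω, ((N ω).choose j : ℝ) ∂μ = _
        have hm : ∀ Z : Finset (Fin (q ^ 2 + q + 1)), MeasurableSet {ω | ∀ i ∈ Z, X i ω = 1} :=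
          fun Z => by
            have e : {ω | ∀ i ∈ Z, X i ω = 1} = ⋂ i ∈ Z, {ω | X i ω = 1} := by
              ext ω
              simp
            rw [e]
            exact Finset.measurableSet_biInter _ fun i _ => hset i
        have e2 : (fun ω => ((N ω).choose j : ℝ)) = fun ω =>
            ∑ Z ∈ (Finset.univ : Finset (Fin (q ^ 2 + q + 1))).powersetCard j,
              ({ω | ∀ i ∈ Z, X i ω = 1} : Set Ω).indicator (fun _ => (1 : ℝ)) ω := by
          funext ω
          rw [choose_card_filter_eq_sum]
          refine Finset.sum_congr rfl fun Z _ => ?_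
          by_cases hω : ∀ i ∈ Z, X i ω = 1
          · rw [ind_of hω, Set.indicator_of_mem (show ω ∈ {ω | ∀ i ∈ Z, X i ω = 1} from hω)]
          · rw [ind_of_not hω, Set.indicator_of_notMem (show ω ∉ {ω | ∀ i ∈ Z, X i ω = 1} from hω)]
        rw [e2, integral_finsetSum _ fun Z _ => (integrable_const (1 : ℝ)).indicator (hm Z)]
        refine Finset.sum_congr rfl fun Z hZ => ?_
        rw [integral_indicator (hm Z), setIntegral_const, smul_eq_mul, mul_one,
          iIndepFun_real_forall_eq hX, (Finset.mem_powersetCard.1 hZ).2]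
      rw [e1, Finset.sum_const, Finset.card_powersetCard, Finset.card_univ, Fintype.card_fin,
        nsmul_eq_mul, one_mul, sub_self, abs_zero, mul_zero]) ((q : ℝ) + 1)
  rw [mul_zero, one_mul, ← modelMoment_eq] at h
  rw [← sub_eq_zero.1 (abs_nonpos_iff.1 h)]
  refine integral_congr_ae ?_
  have hae : ∀ᵐ ω ∂μ, ∀ i, X i ω = 1 ∨ X i ω = 0 := by
    rw [ae_all_iff]
    intro i
    have hset0 : MeasurableSet {ω | X i ω = 0} := hX.measurable i (measurableSet_singleton 0)
    have hsum : μ.real ({ω | X i ω = 1} ∪ {ω | X i ω = 0}) = 1 := by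
      rw [measureReal_union (Set.disjoint_left.2 fun ω h1 h0 => by
        simp only [Set.mem_ofPred_eq] at h1 h0
        exact one_ne_zero (h1.symm.trans h0)) hset0, hX.prob_one, hX.prob_zero]
      field_simp
      ring
    have := (prob_compl_eq_zero_iff ((hset i).union hset0)).2 (by
      rw [Measure.real, ENNReal.toReal_eq_one_iff] at hsum
      exact hsum)
    rw [ae_iff]
    refine measure_mono_null (fun ω hω => ?_) this
    exact hω
  filter_upwards [hae] with ω hω
  congr 2
  have : ((N ω : ℕ) : ℝ) = ∑ i, if X i ω = 1 then (1 : ℝ) else 0 := by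
    rw [Finset.sum_boole]
  rw [this]
  refine Finset.sum_congr rfl fun i _ => ?_
  rcases hω i with h1 | h0
  · rw [h1, if_pos rfl]
  · rw [h0, if_neg zero_ne_one]

end Moments

/-! ### Averages over smooth forms -/

section SmoothAverages

variable (K : Type*) [Field K] [Fintype K]

/-- The average over all forms of degree `d` of the `k`-th power of the deviation of the number of
points, restricted to smooth forms. -/
noncomputable def smoothAvg (k d : ℕ) : ℝ :=
  avg K d fun F => dev K F ^ k * ind (IsSmoothForm F)

/-- The probability that a form of degree `d` is smooth. -/
noncomputable def smoothProb (d : ℕ) : ℝ := prob K d IsSmoothForm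

variable {K}

theorem smoothProb_nonneg (d : ℕ) : 0 ≤ smoothProb K d := prob_nonneg d _

theorem smoothForms_eq_filter (d : ℕ) [DecidablePred (IsSmoothForm (K := K))] :
    smoothForms K d = {F ∈ forms K d | IsSmoothForm F} := by
  ext F
  simp [smoothForms, smoothFormSet, mem_forms]

theorem smoothProb_pos {d : ℕ} (hd : 1 ≤ d) : 0 < smoothProb K d := by
  classical
  rw [smoothProb, prob_eq, ← smoothForms_eq_filter]
  exact div_pos (by exact_mod_cast (smoothForms_nonempty K d hd).card_pos) (card_forms_pos' d)

theorem smoothMoment_eq (k d : ℕ) : smoothMoment K k d =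
    smoothAvg K k d / smoothProb K d / √((Fintype.card K : ℝ) + 1) ^ k := by
  classical
  have h1 : smoothAvg K k d = (∑ F ∈ smoothForms K d, dev K F ^ k) / (forms K d).card := by
    rw [smoothAvg, avg, smoothForms_eq_filter, Finset.sum_filter]
    congr 1
    refine Finset.sum_congr rfl fun F _ => ?_
    by_cases h : IsSmoothForm F <;> simp [ind, h]
  have h2 : smoothProb K d = ((smoothForms K d).card : ℝ) / (forms K d).card := by
    rw [smoothProb, prob_eq, smoothForms_eq_filter]
  have h3 := (card_forms_pos' (K := K) d).ne'
  rw [h1, h2, div_div_div_cancel_right₀ h3, smoothMoment]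
  simp only [div_pow, dev]
  rw [← Finset.sum_div]
  ring

theorem sq_avg_mul_ind_le (d : ℕ) (f : MvPolynomial (Fin 3) K → ℝ)
    (p : MvPolynomial (Fin 3) K → Prop) :
    avg K d (fun F => f F * ind (p F)) ^ 2 ≤ avg K d (fun F => f F ^ 2) * prob K d p := by
  have h := Finset.sum_mul_sq_le_sq_mul_sq (forms K d) f fun F => ind (p F)
  have e : ∀ F, ind (p F) ^ 2 = ind (p F) := fun F => by
    by_cases h : p F <;> simp [ind, h]
  simp only [e] at h
  rw [avg, avg, prob, avg, div_pow, div_mul_div_comm, ← pow_two]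
  exact div_le_div_of_nonneg_right h (by positivity)

/-- Replacing the smooth forms by a set of forms that contains them and few other forms. -/
theorem abs_avg_sub_smoothAvg_le (k d : ℕ) {p b : MvPolynomial (Fin 3) K → Prop}
    (h1 : ∀ F ∈ forms K d, IsSmoothForm F → p F)
    (h2 : ∀ F ∈ forms K d, p F → IsSmoothForm F ∨ b F) :
    |avg K d (fun F => dev K F ^ k * ind (p F)) - smoothAvg K k d| ≤
      √(avg K d (fun F => dev K F ^ (2 * k)) * prob K d b) := by
  refine Real.le_sqrt_of_sq_le ?_
  have h3 : |avg K d (fun F => dev K F ^ k * ind (p F)) - smoothAvg K k d| ≤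
      avg K d fun F => |dev K F| ^ k * ind (b F) := by
    rw [smoothAvg, ← avg_sub]
    refine (abs_avg_le d _).trans (avg_mono fun F hF => ?_)
    rw [← mul_sub, abs_mul, abs_pow]
    refine mul_le_mul_of_nonneg_left ?_ (by positivity)
    by_cases hs : IsSmoothForm F
    · rw [ind_of hs, ind_of (h1 F hF hs), sub_self, abs_zero]
      exact ind_nonneg _
    · by_cases hp : p F
      · rw [ind_of hp, ind_of_not hs, ind_of ((h2 F hF hp).resolve_left hs)]
        simp
      · rw [ind_of_not hp, ind_of_not hs, sub_self, abs_zero]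
        exact ind_nonneg _
  -- Cauchy-Schwarz separates the size of the deviation from the rarity of b.
  refine (pow_le_pow_left₀ (abs_nonneg _) h3 2).trans ((sq_avg_mul_ind_le d _ b).trans_eq ?_)
  congr 1
  refine avg_congr fun F _ => ?_
  rw [← pow_mul, mul_comm k 2, pow_mul, sq_abs, ← pow_mul]

theorem pointCount_le {d : ℕ} {F : MvPolynomial (Fin 3) K} (hF : F.IsHomogeneous d) :
    pointCount F ≤ Fintype.card K ^ 2 + Fintype.card K + 1 := by
  classical
  rw [pointCount_eq hF, ← card_ratPts]
  exact Finset.card_filter_le _ _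

theorem abs_dev_le {d : ℕ} {F : MvPolynomial (Fin 3) K} (hF : F.IsHomogeneous d) :
    |dev K F| ≤ (Fintype.card K : ℝ) ^ 2 := by
  have hq := two_le_card_real (K := K)
  have h : (pointCount F : ℝ) ≤ (Fintype.card K : ℝ) ^ 2 + Fintype.card K + 1 := by
    exact_mod_cast pointCount_le hF
  rw [dev, abs_le]
  constructor
  · nlinarith [Nat.cast_nonneg (α := ℝ) (pointCount F)]
  · linarith

theorem abs_smoothAvg_le_of_abs_dev_le {k d : ℕ} {B : ℝ}
    (h : ∀ F ∈ forms K d, IsSmoothForm F → |dev K F| ≤ B) :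
    |smoothAvg K k d| ≤ B ^ k * smoothProb K d := by
  refine (abs_avg_le d _).trans ?_
  rw [smoothProb, prob, ← avg_mul_left]
  refine avg_mono fun F hF => ?_
  rw [abs_mul, abs_of_nonneg (ind_nonneg _), abs_pow]
  by_cases hs : IsSmoothForm F
  · exact mul_le_mul_of_nonneg_right (pow_le_pow_left₀ (abs_nonneg _) (h F hF hs) k) (ind_nonneg _)
  · rw [ind_of_not hs, mul_zero, mul_zero]

theorem abs_smoothAvg_le_avg (k d : ℕ) : |smoothAvg K k d| ≤ avg K d fun F => |dev K F| ^ k := by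
  refine (abs_avg_le d _).trans (avg_mono fun F _ => ?_)
  rw [abs_mul, abs_of_nonneg (ind_nonneg _), abs_pow]
  exact mul_le_of_le_one_right (by positivity) (ind_le_one _)

/-- Since |t|^k ≤ 1 + t^(2m), an even moment over all forms suffices; those are bounded by
`exists_abs_avg_dev_pow_le`. -/
theorem abs_smoothAvg_le_one_add {k m : ℕ} (hm : k ≤ 2 * m) (d : ℕ) :
    |smoothAvg K k d| ≤ 1 + avg K d fun F => dev K F ^ (2 * m) := by
  refine (abs_smoothAvg_le_avg k d).trans ?_
  rw [← avg_const (K := K) d 1, ← avg_add]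
  refine avg_mono fun F _ => ?_
  have h0 : dev K F ^ (2 * m) = |dev K F| ^ (2 * m) := by
    rw [pow_mul, pow_mul, sq_abs]
  rw [h0]
  rcases le_total |dev K F| 1 with h | h
  · have := pow_le_one₀ (n := k) (abs_nonneg _) h
    have : 0 ≤ |dev K F| ^ (2 * m) := by positivity
    linarith
  · have := pow_le_pow_right₀ h hm
    linarith

/-- A plane curve of degree `d` has at most `2 d q` points. -/
theorem pointCount_le_mul {d : ℕ} {F : MvPolynomial (Fin 3) K} (hF : F.IsHomogeneous d)
    (hF0 : F ≠ 0) : pointCount F ≤ 2 * d * Fintype.card K := by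
  classical
  set q := Fintype.card K with hq
  have hq2 : 2 ≤ q := Fintype.one_lt_card
  -- Schwartz-Zippel bounds the zeros in K³ by d q², and each rational point of the curve carries q
  -- - 1 ≥ q/2 of them.
  have h1 : {f : Fin 3 → K | eval f F = 0}.ncard ≤ d * q ^ 2 := by
    have h := schwartz_zippel_totalDegree hF0 (Finset.univ : Finset K)
    rw [Fintype.piFinset_univ, Finset.card_univ, ← hq, div_le_div_iff₀ (by positivity)
      (by positivity), hF.totalDegree hF0] at h
    have h' : {f ∈ (Finset.univ : Finset (Fin 3 → K)) | eval f F = 0}.card * q ≤ d * q ^ 3 := by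
      exact_mod_cast h
    have h'' : {f ∈ (Finset.univ : Finset (Fin 3 → K)) | eval f F = 0}.card ≤ d * q ^ 2 := by
      refine Nat.le_of_mul_le_mul_right (c := q) ?_ (by omega)
      rw [mul_assoc, ← pow_succ]
      exact h'
    rw [Set.ncard_eq_toFinset_card']
    convert h''
    ext
    simp
  have h2 : pointCount F * (q - 1) ≤ {f : Fin 3 → K | eval f F = 0}.ncard := by
    rw [pointCount_eq hF, Set.ncard_eq_toFinset_card', ← Fintype.card_units (α := K),
      ← Finset.card_univ, ← Finset.card_product]
    refine Finset.card_le_card_of_injOn (fun x => (x.2 : K) • x.1) (fun x hx => ?_) ?_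
    · simp only [Finset.coe_product, Set.mem_prod, Finset.mem_coe, Finset.mem_filter] at hx
      simp only [Set.coe_toFinset, Set.mem_ofPred_eq]
      have := aeval_smul_of_isHomogeneous (K := K) (L := K) hF (x.2 : K) x.1
      simp only [← aeval_eq_eval_self] at *
      rw [this, hx.1.2, mul_zero]
    · rintro ⟨v, s⟩ hv ⟨w, t⟩ hw h
      simp only [Finset.coe_product, Set.mem_prod, Finset.mem_coe, Finset.mem_filter,
        mem_ratPts] at hv hw h
      have hvw : v = ((s : K)⁻¹ * t) • w := by
        rw [mul_smul, ← h, smul_smul, inv_mul_cancel₀ s.ne_zero, one_smul]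
      have hvw' := hv.1.1.eq_of_eq_smul hw.1.1 hvw
      subst hvw'
      have hst : (s : K) = t := by
        obtain ⟨i, hi⟩ := Function.ne_iff.1 hv.1.1.ne_zero
        have := congrFun h i
        simp only [Pi.smul_apply, smul_eq_mul] at this
        exact mul_right_cancel₀ hi this
      rw [Units.ext hst]
  have h3 : q ≤ 2 * (q - 1) := by omega
  have h4 : pointCount F * q ≤ 2 * d * q * q := by
    calc pointCount F * q ≤ pointCount F * (2 * (q - 1)) := Nat.mul_le_mul_left _ h3
      _ = 2 * (pointCount F * (q - 1)) := by ring
      _ ≤ 2 * (d * q ^ 2) := Nat.mul_le_mul_left _ (h2.trans h1)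
      _ = _ := by ring
  exact Nat.le_of_mul_le_mul_right h4 (by omega)

theorem IsSmoothForm.ne_zero {F : MvPolynomial (Fin 3) K} (h : IsSmoothForm F) : F ≠ 0 := by
  rintro rfl
  exact h ![1, 0, 0] (fun h => one_ne_zero (congrFun h 0)) ⟨map_zero _, fun i => by simp⟩

theorem abs_dev_le_mul {d : ℕ} {F : MvPolynomial (Fin 3) K} (hF : F.IsHomogeneous d)
    (hs : IsSmoothForm F) : |dev K F| ≤ (2 * d + 2) * (Fintype.card K : ℝ) := by
  have hq := two_le_card_real (K := K)
  have h : (pointCount F : ℝ) ≤ 2 * d * Fintype.card K := by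
    exact_mod_cast pointCount_le_mul hF hs.ne_zero
  have hd := Nat.cast_nonneg (α := ℝ) d
  rw [dev, abs_le]
  constructor
  · nlinarith [Nat.cast_nonneg (α := ℝ) (pointCount F)]
  · nlinarith

theorem one_sub_le_smoothProb {d : ℕ} {B : ℝ}
    (h : prob K d (fun F => ∃ v : Fin 3 → AlgebraicClosure K, Nrm v ∧ 1 ≤ deg K v ∧ SingAt F v) ≤ B) :
    1 - B ≤ smoothProb K d := by
  have h1 : prob K d (fun F => ¬ IsSmoothForm F) ≤ B := by
    refine (prob_mono fun F hF hs => ?_).trans h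
    rw [isSmoothForm_iff (mem_forms.1 hF)] at hs
    push Not at hs
    obtain ⟨v, hv, hs⟩ := hs
    exact ⟨v, hv, deg_pos v, hs⟩
  rw [prob_not] at h1
  rw [smoothProb]
  linarith

theorem prob_smooth_eq (d : ℕ) :
    prob K d (fun F => ∀ v : Fin 3 → AlgebraicClosure K, Nrm v → ¬ SingAt F v) =
      smoothProb K d :=
  avg_congr fun F hF => by rw [isSmoothForm_iff (mem_forms.1 hF)]

end SmoothAverages

/-! ### Lower bounds for the error term -/

section ErrorTerm

/-- The error term, with `q ^ k` in place of `q ^ min k (q ^ 2 + q + 1)`. -/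
noncomputable def relError (k q p d : ℕ) : ℝ :=
  (d : ℝ) ^ (-(1 / 3) : ℝ)
    + (q : ℝ) ^ k * (((d : ℝ) - 1) ^ 2 * (q : ℝ) ^ (-min (((d / p : ℕ) : ℝ) + 1) ((d : ℝ) / 3)))
    + (q : ℝ) ^ k * ((d : ℝ) * (q : ℝ) ^ (-(((d - 1) / p : ℕ) : ℝ) - 1))

variable {k q p d : ℕ}

/-- The two powers of q differ only if k > q² + q + 1; then q ≤ k, and q^k ≤ k^k. -/
theorem relError_le_errorTerm (hk : 1 ≤ k) (hq : 2 ≤ q) :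
    relError k q p d ≤ (k : ℝ) ^ k * errorTerm k q p d := by
  have hq' : (2 : ℝ) ≤ q := by exact_mod_cast hq
  have hk' : (1 : ℝ) ≤ k := by exact_mod_cast hk
  have h1 : (q : ℝ) ^ k ≤ (k : ℝ) ^ k * (q : ℝ) ^ min k (q ^ 2 + q + 1) := by
    rcases le_total k (q ^ 2 + q + 1) with h | h
    · rw [min_eq_left h]
      exact le_mul_of_one_le_left (by positivity) (one_le_pow₀ hk')
    · have hqk : (q : ℝ) ≤ k := by exact_mod_cast (by nlinarith : q ≤ k)
      calc (q : ℝ) ^ k ≤ (k : ℝ) ^ k := pow_le_pow_left₀ (by linarith) hqk k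
        _ ≤ _ := le_mul_of_one_le_right (by positivity) (one_le_pow₀ (by linarith))
  have e : relError k q p d = (q : ℝ) ^ k * ((q : ℝ) ^ (-(k : ℝ)) * (d : ℝ) ^ (-(1 / 3) : ℝ)
      + ((d : ℝ) - 1) ^ 2 * (q : ℝ) ^ (-min (((d / p : ℕ) : ℝ) + 1) ((d : ℝ) / 3))
      + (d : ℝ) * (q : ℝ) ^ (-(((d - 1) / p : ℕ) : ℝ) - 1)) := by
    have : (q : ℝ) ^ k * (q : ℝ) ^ (-(k : ℝ)) = 1 := by
      rw [Real.rpow_neg (by linarith), Real.rpow_natCast, mul_inv_cancel₀ (by positivity)]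
    rw [mul_add, mul_add, ← mul_assoc, this, one_mul, relError]
  rw [e, errorTerm, ← mul_assoc]
  exact mul_le_mul_of_nonneg_right h1 (by positivity)

theorem rpow_le_relError : (d : ℝ) ^ (-(1 / 3) : ℝ) ≤ relError k q p d := by
  rw [relError, add_assoc]
  exact le_add_of_nonneg_right (by positivity)

theorem relError_nonneg : 0 ≤ relError k q p d := by
  rw [relError]
  positivity

theorem mul_rpow_le_relError (hq : 1 ≤ q) :
    (q : ℝ) ^ k * (((d : ℝ) - 1) ^ 2 * (q : ℝ) ^ (-((d : ℝ) / 3))) ≤ relError k q p d := by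
  have hq' : (1 : ℝ) ≤ q := by exact_mod_cast hq
  have h : (q : ℝ) ^ (-((d : ℝ) / 3)) ≤
      (q : ℝ) ^ (-min (((d / p : ℕ) : ℝ) + 1) ((d : ℝ) / 3)) :=
    Real.rpow_le_rpow_of_exponent_le hq' (neg_le_neg (min_le_right _ _))
  rw [relError]
  have h1 : 0 ≤ (d : ℝ) ^ (-(1 / 3) : ℝ) := by positivity
  have h2 : 0 ≤ (q : ℝ) ^ k * ((d : ℝ) * (q : ℝ) ^ (-(((d - 1) / p : ℕ) : ℝ) - 1)) := by positivity
  have h3 : (q : ℝ) ^ k * (((d : ℝ) - 1) ^ 2 * (q : ℝ) ^ (-((d : ℝ) / 3))) ≤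
      (q : ℝ) ^ k * (((d : ℝ) - 1) ^ 2 *
        (q : ℝ) ^ (-min (((d / p : ℕ) : ℝ) + 1) ((d : ℝ) / 3))) := by gcongr
  linarith

/-- Each of the last two summands contains at least the factor q^(-(⌊d/p⌋+1)), and d² ≤ 2 ((d - 1)²
+ d). -/
theorem sq_div_le_relError (hq : 1 ≤ q) :
    (q : ℝ) ^ k * ((d : ℝ) ^ 2 / (q : ℝ) ^ (d / p + 1)) ≤ 2 * relError k q p d := by
  have hq' : (1 : ℝ) ≤ q := by exact_mod_cast hq
  have e0 : ((q : ℝ) ^ (d / p + 1))⁻¹ = (q : ℝ) ^ (-(((d / p : ℕ) : ℝ) + 1)) := by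
    rw [Real.rpow_neg (by linarith)]
    norm_cast
  have h1 : (q : ℝ) ^ (-(((d / p : ℕ) : ℝ) + 1)) ≤
      (q : ℝ) ^ (-min (((d / p : ℕ) : ℝ) + 1) ((d : ℝ) / 3)) :=
    Real.rpow_le_rpow_of_exponent_le hq' (neg_le_neg (min_le_left _ _))
  have h2 : (q : ℝ) ^ (-(((d / p : ℕ) : ℝ) + 1)) ≤
      (q : ℝ) ^ (-(((d - 1) / p : ℕ) : ℝ) - 1) := by
    refine Real.rpow_le_rpow_of_exponent_le hq' ?_
    have : (((d - 1) / p : ℕ) : ℝ) ≤ ((d / p : ℕ) : ℝ) := by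
      exact_mod_cast Nat.div_le_div_right (Nat.sub_le d 1)
    linarith
  rw [← e0] at h1 h2
  set x := ((q : ℝ) ^ (d / p + 1))⁻¹
  have hx : 0 ≤ x := by positivity
  have h3 : (q : ℝ) ^ k * (((d : ℝ) - 1) ^ 2 * x) + (q : ℝ) ^ k * ((d : ℝ) * x) ≤
      relError k q p d := by
    rw [relError]
    have h0 : 0 ≤ (d : ℝ) ^ (-(1 / 3) : ℝ) := by positivity
    have a1 : (q : ℝ) ^ k * (((d : ℝ) - 1) ^ 2 * x) ≤ (q : ℝ) ^ k * (((d : ℝ) - 1) ^ 2 *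
      (q : ℝ) ^ (-min (((d / p : ℕ) : ℝ) + 1) ((d : ℝ) / 3))) := by gcongr
    have a2 : (q : ℝ) ^ k * ((d : ℝ) * x) ≤
      (q : ℝ) ^ k * ((d : ℝ) * (q : ℝ) ^ (-(((d - 1) / p : ℕ) : ℝ) - 1)) := by gcongr
    linarith
  rw [div_eq_mul_inv]
  have hd : (d : ℝ) ^ 2 ≤ 2 * (((d : ℝ) - 1) ^ 2 + d) := by nlinarith [sq_nonneg ((d : ℝ) - 1)]
  calc (q : ℝ) ^ k * ((d : ℝ) ^ 2 * x) ≤ (q : ℝ) ^ k * (2 * (((d : ℝ) - 1) ^ 2 + d) * x) := by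
        gcongr
    _ = 2 * ((q : ℝ) ^ k * (((d : ℝ) - 1) ^ 2 * x) + (q : ℝ) ^ k * ((d : ℝ) * x)) := by ring
    _ ≤ _ := by linarith

/-- The square is available because 2/3 ≤ 1; it is needed under the square root that Cauchy-Schwarz
produces. -/
theorem inv_le_relError_sq (hd : 1 ≤ d) : 1 / (d : ℝ) ≤ relError k q p d ^ 2 := by
  have hd' : (1 : ℝ) ≤ d := by exact_mod_cast hd
  have h1 : 1 / (d : ℝ) ≤ ((d : ℝ) ^ (-(1 / 3) : ℝ)) ^ 2 := by
    rw [one_div, ← Real.rpow_neg_one, ← Real.rpow_natCast, ← Real.rpow_mul (by linarith)]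
    exact Real.rpow_le_rpow_of_exponent_le hd' (by norm_num)
  exact h1.trans (pow_le_pow_left₀ (by positivity) rpow_le_relError 2)

theorem inv_le_relError (hd : 1 ≤ d) : 1 / (d : ℝ) ≤ relError k q p d := by
  have hd' : (1 : ℝ) ≤ d := by exact_mod_cast hd
  refine le_trans ?_ rpow_le_relError
  rw [one_div, ← Real.rpow_neg_one]
  exact Real.rpow_le_rpow_of_exponent_le hd' (by norm_num)

/-- The dichotomy that controls the contribution of the points of high degree. -/
theorem div_pow_le_relError_sq (hk : 1 ≤ k) (hq : 1 ≤ q) (hd : 1 ≤ d) :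
    (d : ℝ) / (q : ℝ) ^ (d / p) ≤ relError k q p d ^ 2 * 4 := by
  have hq' : (1 : ℝ) ≤ q := by exact_mod_cast hq
  have hd' : (1 : ℝ) ≤ d := by exact_mod_cast hd
  set Q : ℝ := (q : ℝ) ^ (d / p) with hQ
  have hQ0 : 0 < Q := by positivity
  -- If d³ ≤ Q, then d/Q ≤ 1/d. Otherwise d/Q ≤ (d²/Q)², and d²/Q is at most twice the error term.
  rcases le_total ((d : ℝ) ^ 3) Q with h | h
  · refine le_trans ?_ ((inv_le_relError_sq (k := k) (q := q) (p := p) hd).trans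
      (le_mul_of_one_le_right (by positivity) (by norm_num)))
    rw [div_le_div_iff₀ hQ0 (by linarith)]
    nlinarith
  · have h1 := sq_div_le_relError (k := k) (p := p) (d := d) hq
    have h2 : (d : ℝ) ^ 2 / Q ≤ 2 * relError k q p d := by
      refine le_trans ?_ h1
      rw [show (q : ℝ) ^ (d / p + 1) = Q * q from pow_succ _ _]
      calc (d : ℝ) ^ 2 / Q = (q : ℝ) ^ 1 * ((d : ℝ) ^ 2 / (Q * q)) := by field_simp
        _ ≤ _ := by gcongr
    have h3 : (d : ℝ) / Q ≤ ((d : ℝ) ^ 2 / Q) ^ 2 := by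
      rw [div_pow, div_le_div_iff₀ hQ0 (by positivity)]
      nlinarith [mul_le_mul_of_nonneg_left h (by positivity : 0 ≤ (d : ℝ) * Q)]
    have h4 := pow_le_pow_left₀ (by positivity) h2 2
    nlinarith

end ErrorTerm

/-! ### Elementary growth estimates -/

section Growth

theorem nine_mul_sq_le_two_pow {l : ℕ} (hl : 10 ≤ l) : 9 * l ^ 2 ≤ 2 ^ l := by
  induction l, hl using Nat.le_induction with
  | base => norm_num
  | succ l hl ih =>
    rw [pow_succ 2 l]
    nlinarith

/-- The degree condition of the sieve with j = r = log₂ d + 2k + 1 and at most k rational points. -/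
theorem sieve_length_le {k d : ℕ} (hd : 2 ^ (2 * k + 12) ≤ d) :
    k + 2 * ((Nat.log 2 d + 2 * k + 1 + 1) * (Nat.log 2 d + 2 * k + 1)) ≤ d + 1 := by
  have hd0 : d ≠ 0 := by
    rintro rfl
    exact absurd hd (by simp)
  have h1 : 2 * k + 12 ≤ Nat.log 2 d := Nat.le_log_of_pow_le (by norm_num) hd
  have h2 := Nat.pow_log_le_self 2 hd0
  set l := Nat.log 2 d
  have h3 := nine_mul_sq_le_two_pow (show 10 ≤ l by omega)
  have h4 : (l + 2 * k + 1 + 1) * (l + 2 * k + 1) ≤ (2 * l) * (2 * l) :=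
    Nat.mul_le_mul (by omega) (by omega)
  nlinarith

theorem twelve_mul_sq_le_two_pow {t : ℕ} (ht : 20 ≤ t) : 12 * (2 * t + 1) ^ 2 * 2 ≤ 2 ^ t := by
  induction t, ht using Nat.le_induction with
  | base => norm_num
  | succ t ht ih =>
    rw [pow_succ 2 t]
    nlinarith

theorem twelve_mul_sq_mul_le_pow {q p d : ℕ} (hq : 2 ≤ q) (hp : 2 ≤ p) (hd : 40 ≤ d) :
    12 * d ^ 2 * q ≤ q ^ (d - d / p) := by
  have h1 : d / p ≤ d / 2 := Nat.div_le_div_left hp (by norm_num)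
  have h2 : q * q ^ (d / 2 - 1) ≤ q ^ (d - d / p) := by
    rw [← pow_succ']
    exact Nat.pow_le_pow_right (by omega) (by omega)
  have h3 : 2 ^ (d / 2 - 1) ≤ q ^ (d / 2 - 1) := Nat.pow_le_pow_left hq _
  have h4 := twelve_mul_sq_le_two_pow (show 20 ≤ d / 2 by omega)
  have h5 : 2 ^ (d / 2) = 2 ^ (d / 2 - 1) * 2 := by
    rw [← pow_succ]
    congr 1
    omega
  have h6 : 12 * d ^ 2 ≤ 2 ^ (d / 2 - 1) := by
    have : d ^ 2 ≤ (2 * (d / 2) + 1) ^ 2 := Nat.pow_le_pow_left (by omega) 2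
    omega
  calc 12 * d ^ 2 * q ≤ q ^ (d / 2 - 1) * q := Nat.mul_le_mul_right _ (h6.trans h3)
    _ = q * q ^ (d / 2 - 1) := by ring
    _ ≤ _ := h2

theorem succ_sq_le_four_mul_two_pow (t : ℕ) : (t + 1) ^ 2 ≤ 4 * 2 ^ t := by
  rcases lt_or_ge t 4 with ht | ht
  · interval_cases t <;> norm_num
  · induction t, ht using Nat.le_induction with
    | base => norm_num
    | succ t ht ih =>
      rw [pow_succ 2 t]
      nlinarith

/-- If `d` is not small compared to `q ^ (d / p + 1)`, then either `q` and `d` are bounded, or `q`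
is a prime larger than `d`. -/
theorem exists_bound_of_le_mul {c : ℝ} (hc : 0 < c) : ∃ B : ℕ, ∀ p s d : ℕ, 2 ≤ p → 1 ≤ s →
    c * ((p ^ s : ℕ) : ℝ) ^ (d / p + 1) ≤ d → (s = 1 ∧ d < p) ∨ (p ^ s ≤ B ∧ d ≤ B) := by
  obtain ⟨N, hN⟩ := exists_nat_gt (1 / c)
  have hN0 : (1 : ℝ) < N * c := by rwa [div_lt_iff₀ hc] at hN
  refine ⟨(4 * N ^ 2 + 1) * (4 * N ^ 2), fun p s d hp hs h => ?_⟩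
  set q := p ^ s with hq
  have hpq : p ≤ q := Nat.le_self_pow (by omega) p
  set t := d / p with ht
  have hdt : d < (t + 1) * p := by
    rw [ht, mul_comm]
    exact Nat.lt_mul_div_succ d (by omega)
  have h' : q ^ (t + 1) ≤ N * d := by
    have h1 : ((q : ℕ) : ℝ) ^ (t + 1) ≤ N * d := by
      have h2 : (0 : ℝ) ≤ (q : ℝ) ^ (t + 1) := by positivity
      have h3 := mul_le_mul_of_nonneg_left h (Nat.cast_nonneg (α := ℝ) N)
      nlinarith
    exact_mod_cast h1
  have hqpos : 0 < q := by omega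
  -- For t = 0 one has d < p, and s ≥ 2 bounds p, as p² ≤ q ≤ N d. For t ≥ 1, q^t ≤ N (t + 1)
  -- together with (t + 1)² ≤ 4 · 2^t bounds q^t.
  rcases Nat.eq_zero_or_pos t with ht0 | ht0
  · rw [ht0, zero_add, pow_one] at h'
    rw [ht0, zero_add, one_mul] at hdt
    rcases hs.eq_or_lt with h1 | h1
    · exact Or.inl ⟨h1.symm, hdt⟩
    · right
      have h2 : p * p ≤ q := by
        rw [hq, ← pow_two]
        exact Nat.pow_le_pow_right (by omega) h1
      have h3 : p * p < N * p := by nlinarith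
      have h4 : p < N := lt_of_mul_lt_mul_right h3 (Nat.zero_le p)
      constructor <;> nlinarith
  · right
    have h1 : q ^ t ≤ N * (t + 1) := by
      have h2 : q ^ t * q < N * (t + 1) * q + 1 := by
        rw [← pow_succ]
        nlinarith [Nat.mul_le_mul_left N hdt.le, Nat.mul_le_mul_left (N * (t + 1)) hpq]
      exact Nat.le_of_mul_le_mul_right (Nat.lt_succ_iff.1 h2) hqpos
    have h2 := succ_sq_le_four_mul_two_pow t
    have h3 : 2 ^ t ≤ q ^ t := Nat.pow_le_pow_left (by omega) t
    have hQ : 0 < q ^ t := by positivity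
    have h4 : q ^ t ≤ 4 * N ^ 2 := by
      have : q ^ t * q ^ t ≤ 4 * N ^ 2 * q ^ t := by
        calc q ^ t * q ^ t ≤ (N * (t + 1)) * (N * (t + 1)) := Nat.mul_le_mul h1 h1
          _ = N ^ 2 * (t + 1) ^ 2 := by ring
          _ ≤ N ^ 2 * (4 * q ^ t) := Nat.mul_le_mul_left _ (by omega)
          _ = _ := by ring
      exact Nat.le_of_mul_le_mul_right this hQ
    have h5 : q ≤ q ^ t := Nat.le_self_pow ht0.ne' q
    have h6 : t < 2 ^ t := Nat.lt_two_pow_self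
    have h7 : t + 1 ≤ 4 * N ^ 2 + 1 := by omega
    constructor
    · nlinarith
    · exact hdt.le.trans (Nat.mul_le_mul h7 (by omega))

end Growth

/-! ### The main estimate for large degree -/

section Sieve

/-- Degrees up to (d + 1)/2 fall to the union bound. Beyond that, `prob_singAt_le` is used with D =
⌊d/p⌋, the largest value with p D ≤ d. -/
theorem prob_sing_of_lt_deg_le (K : Type*) [Field K] [Fintype K] (L : Type*) [Field L] [Algebra K L]
    [Algebra.IsAlgebraic K L] (p : ℕ) [Fact p.Prime] [CharP K p] {d : ℕ} (hd : 40 ≤ d) (r : ℕ) :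
    prob K d (fun F => ∃ v : Fin 3 → L, Nrm v ∧ r < deg K v ∧ SingAt F v) ≤
      4 * ((Fintype.card K : ℝ) ^ (r + 1))⁻¹ + 1 / (d * Fintype.card K) +
        6 * (d / (Fintype.card K : ℝ) ^ (d / p + 1)) := by
  have hp : 2 ≤ p := (Fact.out : p.Prime).two_le
  have hdp : d / p ≤ d / 2 := Nat.div_le_div_left hp (by norm_num)
  have h1 := prob_medium_le K L d r
  have h2 := prob_singAt_le (K := K) L p d (e := d / 2 + 1) (D := d / p) (by omega)
    (Nat.mul_div_le d p)
  have h3 : prob K d (fun F => ∃ v : Fin 3 → L, Nrm v ∧ r < deg K v ∧ SingAt F v) ≤ _ :=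
    (prob_mono fun F _ h => by
      obtain ⟨v, hv, hr, hs⟩ := h
      by_cases hm : 2 * deg K v ≤ d + 1
      · exact Or.inl ⟨v, hv, hr, hm, hs⟩
      · exact Or.inr ⟨v, hv, by omega, hs⟩).trans ((prob_or_le d _ _).trans (add_le_add h1 h2))
  refine h3.trans ?_
  have hq := two_le_card_real (K := K)
  have hpow : 12 * (d : ℝ) ^ 2 * (Fintype.card K : ℝ) ≤ (Fintype.card K : ℝ) ^ (d - d / p) := by
    exact_mod_cast twelve_mul_sq_mul_le_pow (Fintype.one_lt_card (α := K)) hp hd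
  set q : ℝ := ((Fintype.card K : ℕ) : ℝ) with hqdef
  have hd' : (40 : ℝ) ≤ d := by exact_mod_cast hd
  have a1 : 3 * ((2 * d + 2) / q ^ (d - d / p)) ≤ 1 / (d * q) := by
    rw [← mul_div_assoc, div_le_div_iff₀ (by positivity) (by positivity), one_mul]
    refine le_trans ?_ hpow
    have : 0 ≤ (d : ℝ) * q := by positivity
    nlinarith
  have a2 : (((d - 1) ^ 2 / (d / 2 + 1) : ℕ) : ℝ) ≤ 2 * d := by
    have : (d - 1) ^ 2 / (d / 2 + 1) ≤ 2 * d := by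
      refine Nat.div_le_of_le_mul ?_
      have e1 : (d - 1) ^ 2 ≤ d * d := by
        rw [← pow_two]
        exact Nat.pow_le_pow_left (Nat.sub_le d 1) 2
      have e2 : d ≤ (d / 2 + 1) * 2 := by omega
      calc (d - 1) ^ 2 ≤ d * d := e1
        _ ≤ (d / 2 + 1) * 2 * d := Nat.mul_le_mul_right d e2
        _ = _ := by ring
    exact_mod_cast this
  have a3 : 3 * ((((d - 1) ^ 2 / (d / 2 + 1) : ℕ) : ℝ) / q ^ (d / p + 1)) ≤
      6 * (d / q ^ (d / p + 1)) := by
    rw [← mul_div_assoc, ← mul_div_assoc]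
    exact div_le_div_of_nonneg_right (by linarith) (by positivity)
  linarith

/-- The reason for the choice of r: log₂ d + 1 factors q yield 1/d, and the remaining 2k + 1
outweigh the q^(2k) by which the k-th power of the point count multiplies the sieve error. -/
theorem inv_pow_log_le {q d : ℕ} (hq : 2 ≤ q) (hd : 1 ≤ d) (k : ℕ) :
    ((q : ℝ) ^ (Nat.log 2 d + 2 * k + 1 + 1))⁻¹ ≤ 1 / d * (1 / (q : ℝ) ^ (2 * k + 1)) := by
  have hd0 : (0 : ℝ) < d := by exact_mod_cast hd
  have hq0 : (0 : ℝ) < q := by exact_mod_cast (by omega : 0 < q)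
  have h1 : (d : ℝ) ≤ (q : ℝ) ^ (Nat.log 2 d + 1) := by
    have : d ≤ q ^ (Nat.log 2 d + 1) :=
      (Nat.lt_pow_succ_log_self (by norm_num) d).le.trans (Nat.pow_le_pow_left hq _)
    exact_mod_cast this
  rw [one_div_mul_one_div, ← one_div, show Nat.log 2 d + 2 * k + 1 + 1 =
    (Nat.log 2 d + 1) + (2 * k + 1) by ring, pow_add]
  exact one_div_le_one_div_of_le (by positivity) (mul_le_mul_of_nonneg_right h1 (by positivity))

set_option maxHeartbeats 1600000 in
-- Three errors: passing from smooth forms to forms without singular points of degree at most r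
-- (`T1`), the sieve error times (3q²)^k (`T2`), and replacing the Euler product by the probability
-- of smoothness (`T3`).
theorem exists_sieve_estimate (k : ℕ) (hk : 1 ≤ k) : ∃ C : ℝ, 0 ≤ C ∧
    ∀ (K : Type*) [Field K] [Fintype K] (d : ℕ), 2 ^ (2 * k + 12) ≤ d →
      |smoothAvg K k d - modelMoment (Fintype.card K) k * smoothProb K d| ≤
        C * relError k (Fintype.card K) (ringChar K) d * (Fintype.card K : ℝ) ^ (k / 2) ∧
      Real.exp (-4) - (2 * Real.exp 4 + 5) / d -
        6 * (d / (Fintype.card K : ℝ) ^ (d / ringChar K + 1)) ≤ smoothProb K d := by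
  obtain ⟨C₁, hC₁, h₁⟩ := exists_abs_avg_dev_pow_le (2 * k)
  obtain ⟨C₂, hC₂, h₂⟩ := exists_abs_modelMoment_le k
  refine ⟨√(29 * C₁) + 3 ^ k * (2 * Real.exp 4) + C₂ * (2 * Real.exp 4 + 6), by positivity,
    fun K _ _ d hd => ?_⟩
  have hpow : 2 * k + 12 < 2 ^ (2 * k + 12) := Nat.lt_two_pow_self
  have h4096 : 2 ^ 12 ≤ 2 ^ (2 * k + 12) := Nat.pow_le_pow_right (by norm_num) (by omega)
  have hd40 : 40 ≤ d := by omega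
  have hp : Fact (ringChar K).Prime := ⟨CharP.char_is_prime K _⟩
  have hlen := sieve_length_le hd
  set p := ringChar K with hpdef
  have hq2 : 2 ≤ Fintype.card K := Fintype.one_lt_card
  have hηle := inv_pow_log_le hq2 (by omega : 1 ≤ d) k
  set r := Nat.log 2 d + 2 * k + 1 with hr
  set L := AlgebraicClosure K
  let low : MvPolynomial (Fin 3) K → Prop := fun F =>
    ∀ v : Fin 3 → L, Nrm v → deg K v ≤ r → ¬ SingAt F v
  let bad : MvPolynomial (Fin 3) K → Prop := fun F =>
    ∃ v : Fin 3 → L, Nrm v ∧ r < deg K v ∧ SingAt F v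
  have hb := prob_sing_of_lt_deg_le K L p hd40 r
  change prob K d bad ≤ _ at hb
  have hlow : ∀ Z : Finset (Fin 3 → K), (∀ v ∈ Z, Nrm v) → Z.card ≤ k →
      |prob K d (fun F => (∀ v ∈ Z, eval v F = 0) ∧ low F) -
        eulerProd K L r * rho (Fintype.card K) ^ Z.card| ≤
      2 * Real.exp 4 * ((Fintype.card K : ℝ) ^ (r + 1))⁻¹ := fun Z hZ hZk =>
    abs_prob_low_sub_le L (j := r) (by omega) Z hZ (by omega)
  have H1 := abs_avg_pow_sub_le low hlow ((Fintype.card K : ℝ) + 1)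
  rw [← modelMoment_eq] at H1
  have H2 := hlow ∅ (by simp) (by simp)
  simp only [Finset.notMem_empty, false_imp_iff, implies_true, true_and, Finset.card_empty,
    pow_zero, mul_one] at H2
  have H3 := abs_avg_sub_smoothAvg_le k d (p := low) (b := bad)
    (fun F hF hs v hv _ => (isSmoothForm_iff (mem_forms.1 hF)).1 hs v hv)
    (fun F hF hl => by
      by_cases h : bad F
      · exact Or.inr h
      · refine Or.inl ((isSmoothForm_iff (mem_forms.1 hF)).2 fun v hv hs => ?_)
        by_cases hvr : deg K v ≤ r
        · exact hl v hv hvr hs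
        · exact h ⟨v, hv, by omega, hs⟩)
  have H4 : prob K d low ≤ smoothProb K d + prob K d bad := by
    refine (prob_mono fun F hF hl => ?_).trans (prob_or_le d _ _)
    by_cases h : bad F
    · exact Or.inr h
    · refine Or.inl ((isSmoothForm_iff (mem_forms.1 hF)).2 fun v hv hs => ?_)
      by_cases hvr : deg K v ≤ r
      · exact hl v hv hvr hs
      · exact h ⟨v, hv, by omega, hs⟩
  have H5 : smoothProb K d ≤ prob K d low :=
    prob_mono fun F hF hs v hv _ => (isSmoothForm_iff (mem_forms.1 hF)).1 hs v hv
  have H6 := h₁ K d (by omega)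
  rw [Nat.mul_div_cancel_left k (by norm_num)] at H6
  have H7 := h₂ (Fintype.card K) hq2
  have H8 := exp_le_eulerProd (K := K) (L := L) r
  have E1 := inv_le_relError (k := k) (q := Fintype.card K) (p := p) (by omega : 1 ≤ d)
  have E2 := inv_le_relError_sq (k := k) (q := Fintype.card K) (p := p) (by omega : 1 ≤ d)
  have E3 := div_pow_le_relError_sq (k := k) (q := Fintype.card K) (p := p) hk (by omega)
    (by omega : 1 ≤ d)
  have E0 := relError_nonneg (k := k) (q := Fintype.card K) (p := p) (d := d)
  set x := relError k (Fintype.card K) p d with hx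
  have hn : (((Fintype.card K ^ 2 + Fintype.card K + 1 : ℕ) : ℝ) + |(Fintype.card K : ℝ) + 1|) ≤
      3 * (Fintype.card K : ℝ) ^ 2 := by
    have := two_le_card_real (K := K)
    rw [abs_of_nonneg (by linarith)]
    push_cast
    nlinarith
  have hn0 : 0 ≤ (((Fintype.card K ^ 2 + Fintype.card K + 1 : ℕ) : ℝ) +
    |(Fintype.card K : ℝ) + 1|) := by positivity
  have hq := two_le_card_real (K := K)
  set N := (((Fintype.card K ^ 2 + Fintype.card K + 1 : ℕ) : ℝ) + |(Fintype.card K : ℝ) + 1|)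
  set a := modelMoment (Fintype.card K) k
  set q : ℝ := ((Fintype.card K : ℕ) : ℝ) with hqdef
  set b := prob K d bad with hbdef
  set w := eulerProd K L r
  set u := (q ^ (r + 1))⁻¹ with hu
  have hd0 : (0 : ℝ) < d := by exact_mod_cast (by omega : 0 < d)
  have hu0 : 0 ≤ u := by positivity
  have hb0 : 0 ≤ b := prob_nonneg d _
  have hb1 : b ≤ 1 := prob_le_one d _
  have hexp : 0 < Real.exp 4 := Real.exp_pos 4
  have hqk : 1 / q ^ (2 * k + 1) ≤ 1 / q :=
    one_div_le_one_div_of_le (by positivity) (le_self_pow₀ (by linarith) (by omega))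
  have hu1 : u ≤ 1 / d * (1 / q) := hηle.trans (mul_le_mul_of_nonneg_left hqk (by positivity))
  have hq1 : 1 / q ≤ 1 := by
    rw [div_le_one (by linarith)]
    linarith
  have hu2 : u ≤ 1 / d := hu1.trans (mul_le_of_le_one_right (by positivity) hq1)
  have hb2 : b ≤ 5 * (1 / d * (1 / q)) + 6 * (d / q ^ (d / p + 1)) := by
    rw [one_div_mul_one_div] at hu1 ⊢
    linarith
  -- 29 = 5 + 6 · 4, from `inv_le_relError_sq` and `div_pow_le_relError_sq`. The factor q pays for
  -- q^k ≤ (q^⌊k/2⌋)² q when k is odd.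
  have hqb : q * b ≤ 29 * x ^ 2 := by
    have e1 : q * (1 / d * (1 / q)) = 1 / d := by field_simp
    have e2 : q * (d / q ^ (d / p + 1)) = d / q ^ (d / p) := by
      rw [pow_succ]
      field_simp
    have := mul_le_mul_of_nonneg_left hb2 (by linarith : 0 ≤ q)
    have e3 : q * (5 * (1 / d * (1 / q)) + 6 * (d / q ^ (d / p + 1))) =
      5 * (q * (1 / d * (1 / q))) + 6 * (q * (d / q ^ (d / p + 1))) := by ring
    rw [e3, e1, e2] at this
    linarith
  have hbx : b ≤ 6 * x := by
    have e1 : 2 * b ≤ q * b := mul_le_mul_of_nonneg_right hq hb0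
    have e2 : b ^ 2 ≤ b := by
      rw [pow_two]
      exact mul_le_of_le_one_left hb0 hb1
    refine (sq_le_sq₀ hb0 (by linarith)).1 (le_trans (b := 29 * x ^ 2) (by linarith) ?_)
    rw [mul_pow]
    linarith [sq_nonneg x]
  have hQ : 1 ≤ q ^ (k / 2) := one_le_pow₀ (by linarith)
  have T1 : √(avg K d (fun F => dev K F ^ (2 * k)) * b) ≤ √(29 * C₁) * x * q ^ (k / 2) := by
    refine Real.sqrt_le_iff.2 ⟨by positivity, ?_⟩
    rw [mul_pow, mul_pow, Real.sq_sqrt (by positivity)]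
    have e1 : q ^ k ≤ (q ^ (k / 2)) ^ 2 * q := by
      rw [← pow_mul, ← pow_succ]
      exact pow_le_pow_right₀ (by linarith) (by omega)
    calc _ ≤ C₁ * q ^ k * b := mul_le_mul_of_nonneg_right ((le_abs_self _).trans H6) hb0
      _ ≤ C₁ * ((q ^ (k / 2)) ^ 2 * q) * b := by gcongr
      _ = C₁ * (q ^ (k / 2)) ^ 2 * (q * b) := by ring
      _ ≤ C₁ * (q ^ (k / 2)) ^ 2 * (29 * x ^ 2) := by gcongr
      _ = _ := by ring
  have T2 : N ^ k * (2 * Real.exp 4 * u) ≤ 3 ^ k * (2 * Real.exp 4) * x * q ^ (k / 2) := by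
    have e1 : q ^ (2 * k) * u ≤ x := by
      refine le_trans ?_ E1
      calc q ^ (2 * k) * u ≤ q ^ (2 * k) * (1 / d * (1 / q ^ (2 * k + 1))) := by gcongr
        _ = 1 / d * (1 / q) := by
          rw [pow_succ]
          field_simp
        _ ≤ _ := mul_le_of_le_one_right (by positivity) hq1
    calc N ^ k * (2 * Real.exp 4 * u) ≤ (3 * q ^ 2) ^ k * (2 * Real.exp 4 * u) := by gcongr
      _ = 3 ^ k * (2 * Real.exp 4) * (q ^ (2 * k) * u) := by
          rw [mul_pow, ← pow_mul]
          ring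
      _ ≤ 3 ^ k * (2 * Real.exp 4) * x := by gcongr
      _ ≤ _ := le_mul_of_one_le_right (by positivity) hQ
  have T3 : |a| * (2 * Real.exp 4 * u + b) ≤ C₂ * (2 * Real.exp 4 + 6) * x * q ^ (k / 2) := by
    have e1 : 2 * Real.exp 4 * u + b ≤ (2 * Real.exp 4 + 6) * x := by
      have := mul_le_mul_of_nonneg_left (hu2.trans E1) (by positivity : 0 ≤ 2 * Real.exp 4)
      linarith
    calc _ ≤ (C₂ * q ^ (k / 2)) * ((2 * Real.exp 4 + 6) * x) := by gcongr
      _ = _ := by ring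
  constructor
  · have hw : |w - smoothProb K d| ≤ 2 * Real.exp 4 * u + b := by
      rw [abs_le] at H2 ⊢
      constructor <;> linarith [H2.1, H2.2]
    have e1 : smoothAvg K k d - a * smoothProb K d =
        -((avg K d fun F => dev K F ^ k * ind (low F)) - smoothAvg K k d) +
        ((avg K d fun F => dev K F ^ k * ind (low F)) - w * a) + a * (w - smoothProb K d) := by ring
    rw [e1]
    refine (abs_add_le _ _).trans ?_
    have e2 := abs_add_le (-((avg K d fun F => dev K F ^ k * ind (low F)) - smoothAvg K k d))
      ((avg K d fun F => dev K F ^ k * ind (low F)) - w * a)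
    rw [abs_neg] at e2
    rw [abs_mul a]
    have e3 := mul_le_mul_of_nonneg_left hw (abs_nonneg a)
    have e4 : |(avg K d fun F => dev K F ^ k * ind (low F)) - w * a| ≤
      N ^ k * (2 * Real.exp 4 * u) := H1
    calc _ ≤ √(29 * C₁) * x * q ^ (k / 2) + 3 ^ k * (2 * Real.exp 4) * x * q ^ (k / 2) +
          C₂ * (2 * Real.exp 4 + 6) * x * q ^ (k / 2) := by linarith
      _ = _ := by ring
  · have e1 : (2 * Real.exp 4 + 5) / d = 2 * Real.exp 4 * (1 / d) + 5 * (1 / d) := by ring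
    have e2 := mul_le_mul_of_nonneg_left hu2 (by positivity : 0 ≤ 2 * Real.exp 4)
    have e3 : (1 / d : ℝ) * (1 / q) ≤ 1 / d := mul_le_of_le_one_right (by positivity) hq1
    rw [abs_le] at H2
    linarith [H2.1]

end Sieve

/-! ### Uniformity in q and d -/

section Uniform

theorem one_le_mul_relError {k q p d B : ℕ} (hd : 1 ≤ d) (hB : d ≤ B) :
    (1 : ℝ) ≤ B * relError k q p d := by
  have hd' : (0 : ℝ) < d := by exact_mod_cast hd
  have hB' : (d : ℝ) ≤ B := by exact_mod_cast hB
  have h := inv_le_relError (k := k) (q := q) (p := p) hd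
  rw [div_le_iff₀ hd'] at h
  calc (1 : ℝ) ≤ relError k q p d * d := h
    _ ≤ relError k q p d * B := mul_le_mul_of_nonneg_left hB' relError_nonneg
    _ = _ := mul_comm _ _

/-- Where the error term is bounded below, it absorbs the model moment, and only the smooth average
itself has to be bounded. -/
theorem exists_abs_sub_le_of_abs_smoothAvg_le (k : ℕ) : ∃ C : ℝ, 0 ≤ C ∧
    ∀ (K : Type*) [Field K] [Fintype K] (d : ℕ) (α β : ℝ),
      |smoothAvg K k d| ≤ α * relError k (Fintype.card K) (ringChar K) d *
        (Fintype.card K : ℝ) ^ (k / 2) * smoothProb K d →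
      1 ≤ β * relError k (Fintype.card K) (ringChar K) d →
      |smoothAvg K k d - modelMoment (Fintype.card K) k * smoothProb K d| ≤
        (α + C * β) * relError k (Fintype.card K) (ringChar K) d *
          (Fintype.card K : ℝ) ^ (k / 2) * smoothProb K d := by
  obtain ⟨C, hC, h⟩ := exists_abs_modelMoment_le k
  refine ⟨C, hC, fun K _ _ d α β h1 h2 => ?_⟩
  have hS := smoothProb_nonneg (K := K) d
  have h3 : |modelMoment (Fintype.card K) k * smoothProb K d| ≤
      C * β * relError k (Fintype.card K) (ringChar K) d *
        (Fintype.card K : ℝ) ^ (k / 2) * smoothProb K d := by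
    rw [abs_mul, abs_of_nonneg hS]
    refine mul_le_mul_of_nonneg_right ((h _ Fintype.one_lt_card).trans ?_) hS
    rw [mul_assoc C]
    exact mul_le_mul_of_nonneg_right (le_mul_of_one_le_right hC h2) (by positivity)
  refine (abs_sub _ _).trans ((add_le_add h1 h3).trans (le_of_eq ?_))
  ring

theorem exists_abs_sub_le_of_le (k B : ℕ) : ∃ C : ℝ, 0 ≤ C ∧
    ∀ (K : Type*) [Field K] [Fintype K] (d : ℕ), 1 ≤ d → d ≤ B → Fintype.card K ≤ B →
      |smoothAvg K k d - modelMoment (Fintype.card K) k * smoothProb K d| ≤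
        C * relError k (Fintype.card K) (ringChar K) d *
          (Fintype.card K : ℝ) ^ (k / 2) * smoothProb K d := by
  obtain ⟨C, hC, h⟩ := exists_abs_sub_le_of_abs_smoothAvg_le k
  refine ⟨((B : ℝ) ^ 2) ^ k * B + C * B, by positivity, fun K _ _ d hd hdB hqB => ?_⟩
  have hx := one_le_mul_relError (k := k) (q := Fintype.card K) (p := ringChar K) hd hdB
  refine h K d _ _ ?_ hx
  have hq : (1 : ℝ) ≤ Fintype.card K := by exact_mod_cast Fintype.card_pos
  have hqB' : (Fintype.card K : ℝ) ≤ B := by exact_mod_cast hqB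
  refine (abs_smoothAvg_le_of_abs_dev_le fun F hF _ => abs_dev_le (mem_forms.1 hF)).trans
    (mul_le_mul_of_nonneg_right ?_ (smoothProb_nonneg d))
  calc ((Fintype.card K : ℝ) ^ 2) ^ k ≤ ((B : ℝ) ^ 2) ^ k := by gcongr
    _ ≤ ((B : ℝ) ^ 2) ^ k * (B * relError k (Fintype.card K) (ringChar K) d) :=
      le_mul_of_one_le_right (by positivity) hx
    _ = ((B : ℝ) ^ 2) ^ k * B * relError k (Fintype.card K) (ringChar K) d := by ring
    _ ≤ _ := le_mul_of_one_le_right (mul_nonneg (by positivity) relError_nonneg)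
      (one_le_pow₀ hq)

/-- The case D = 0 of `prob_singAt_le`, for q large compared with d². -/
theorem prob_sing_le (K : Type*) [Field K] [Fintype K] {d : ℕ} (hd : 1 ≤ d) :
    prob K d (fun F => ∃ v : Fin 3 → AlgebraicClosure K, Nrm v ∧ 1 ≤ deg K v ∧ SingAt F v) ≤
      12 * d ^ 2 / Fintype.card K := by
  have hp : Fact (ringChar K).Prime := ⟨CharP.char_is_prime K _⟩
  have hp2 := hp.out.two_le
  have hq : (1 : ℝ) ≤ Fintype.card K := by exact_mod_cast Fintype.card_pos
  have h := prob_singAt_le (K := K) (AlgebraicClosure K) (ringChar K) d (e := 1) (D := 0)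
    le_rfl (by simp)
  refine h.trans ?_
  have hd' : (1 : ℝ) ≤ d := by exact_mod_cast hd
  have hdp : d / ringChar K < d := Nat.div_lt_self hd hp2
  have h1 : (2 * (d : ℝ) + 2) / (Fintype.card K : ℝ) ^ (d - d / ringChar K) ≤
      (2 * d + 2) / Fintype.card K :=
    div_le_div_of_nonneg_left (by positivity) (by linarith) (le_self_pow₀ hq (by omega))
  have h2 : (((d - 1) ^ 2 / 1 : ℕ) : ℝ) = ((d : ℝ) - 1) ^ 2 := by
    rw [Nat.div_one]
    push_cast [hd]
    ring
  rw [h2, zero_add, pow_one]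
  have h3 : 3 * ((2 * (d : ℝ) + 2) / Fintype.card K + ((d : ℝ) - 1) ^ 2 / Fintype.card K) ≤
      12 * d ^ 2 / Fintype.card K := by
    rw [← add_div, ← mul_div_assoc]
    refine div_le_div_of_nonneg_right ?_ (by linarith)
    nlinarith
  linarith

/-- For 2 ≤ d < k one has d/3 ≤ ⌊k/2⌋, so the factor q^(k - d/3) of the error term is large enough.
For d = 1 that summand has the factor (d - 1)² = 0, and `sq_div_le_relError` takes over. -/
theorem pow_le_relError_mul {k q p d : ℕ} (hq : 1 ≤ q) (hd : 1 ≤ d) (hdk : d < k) (hp : 2 ≤ p) :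
    (q : ℝ) ^ k ≤ 2 * relError k q p d * (q : ℝ) ^ (k / 2) := by
  have hq' : (1 : ℝ) ≤ q := by exact_mod_cast hq
  have hx := relError_nonneg (k := k) (q := q) (p := p) (d := d)
  rcases Nat.lt_or_ge 1 d with h | h
  · have h1 := mul_rpow_le_relError (k := k) (p := p) (d := d) hq
    have hd2 : (1 : ℝ) ≤ ((d : ℝ) - 1) ^ 2 := by
      have : (2 : ℝ) ≤ d := by exact_mod_cast h
      nlinarith
    have h2 : (q : ℝ) ^ ((d : ℝ) / 3) ≤ (q : ℝ) ^ (k / 2) := by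
      rw [← Real.rpow_natCast]
      refine Real.rpow_le_rpow_of_exponent_le hq' ?_
      have : (d : ℝ) ≤ 3 * ((k / 2 : ℕ) : ℝ) := by exact_mod_cast (by omega : d ≤ 3 * (k / 2))
      linarith
    have h3 : (q : ℝ) ^ (-((d : ℝ) / 3)) * (q : ℝ) ^ ((d : ℝ) / 3) = 1 := by
      rw [← Real.rpow_add (by linarith), neg_add_cancel, Real.rpow_zero]
    calc (q : ℝ) ^ k = (q : ℝ) ^ k * (1 * (q : ℝ) ^ (-((d : ℝ) / 3))) * (q : ℝ) ^ ((d : ℝ) / 3) := by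
          rw [one_mul, mul_assoc, h3, mul_one]
      _ ≤ (q : ℝ) ^ k * (((d : ℝ) - 1) ^ 2 * (q : ℝ) ^ (-((d : ℝ) / 3))) *
          (q : ℝ) ^ ((d : ℝ) / 3) := by gcongr
      _ ≤ relError k q p d * (q : ℝ) ^ (k / 2) := by gcongr
      _ ≤ _ := by
        have : 0 ≤ relError k q p d * (q : ℝ) ^ (k / 2) := by positivity
        linarith
  · obtain rfl : d = 1 := by omega
    have h1 := sq_div_le_relError (k := k) (p := p) (d := 1) hq
    rw [Nat.div_eq_of_lt (by omega), zero_add, pow_one, Nat.cast_one, one_pow] at h1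
    calc (q : ℝ) ^ k = (q : ℝ) ^ k * (1 / q) * q := by field_simp
      _ ≤ 2 * relError k q p 1 * (q : ℝ) ^ (k / 2) :=
        mul_le_mul h1 (le_self_pow₀ hq' (by omega)) (by positivity) (by positivity)

theorem le_relError {k q p d : ℕ} (hq : 1 ≤ q) (hd : 2 ≤ d) (hdk : d + 2 ≤ 2 * k) :
    (q : ℝ) ≤ relError k q p d := by
  have hq' : (1 : ℝ) ≤ q := by exact_mod_cast hq
  refine le_trans ?_ (mul_rpow_le_relError (k := k) (p := p) (d := d) hq)
  have hd2 : (1 : ℝ) ≤ ((d : ℝ) - 1) ^ 2 := by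
    have : (2 : ℝ) ≤ d := by exact_mod_cast hd
    nlinarith
  have h : (q : ℝ) ≤ (q : ℝ) ^ k * (1 * (q : ℝ) ^ (-((d : ℝ) / 3))) := by
    rw [one_mul, ← Real.rpow_natCast, ← Real.rpow_add (by linarith)]
    refine Real.self_le_rpow_of_one_le hq' ?_
    have h1 : (d : ℝ) + 2 ≤ 2 * k := by exact_mod_cast hdk
    have h2 : (2 : ℝ) ≤ d := by exact_mod_cast hd
    linarith
  refine h.trans ?_
  gcongr

theorem exists_abs_sub_le_of_degree_lt (k D : ℕ) : ∃ C : ℝ, 0 ≤ C ∧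
    ∀ (K : Type*) [Field K] [Fintype K] (d : ℕ), 1 ≤ d → d ≤ D →
      |smoothAvg K k d - modelMoment (Fintype.card K) k * smoothProb K d| ≤
        C * relError k (Fintype.card K) (ringChar K) d *
          (Fintype.card K : ℝ) ^ (k / 2) * smoothProb K d := by
  obtain ⟨C, hC, h⟩ := exists_abs_sub_le_of_abs_smoothAvg_le k
  obtain ⟨C₀, hC₀, h₀⟩ := exists_abs_sub_le_of_le k (D + 24 * D ^ 2)
  obtain ⟨C₁, hC₁, h₁⟩ := exists_abs_avg_dev_pow_le k
  obtain ⟨C₂, hC₂, h₂⟩ := exists_abs_avg_dev_pow_le (2 * k)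
  obtain ⟨C₃, hC₃, h₃⟩ := exists_abs_avg_dev_pow_le (2 * ((k + 1) / 2))
  set α₁ : ℝ := (2 * D + 2) ^ k * 2 with hα₁
  set α₂ : ℝ := 2 * (C₁ + √(C₂ * (12 * D ^ 2))) * D with hα₂
  set α₃ : ℝ := 2 * (1 + C₃) with hα₃
  have hα₁0 : 0 ≤ α₁ := by positivity
  have hα₂0 : 0 ≤ α₂ := by positivity
  have hα₃0 : 0 ≤ α₃ := by positivity
  refine ⟨C₀ + (α₁ + α₂ + α₃ + C * D), by positivity, fun K _ _ d hd hdD => ?_⟩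
  have hq2 := two_le_card_real (K := K)
  have hx := one_le_mul_relError (k := k) (q := Fintype.card K) (p := ringChar K) hd hdD
  have hx0 := relError_nonneg (k := k) (q := Fintype.card K) (p := ringChar K) (d := d)
  have hS0 := smoothProb_nonneg (K := K) d
  have hqpos : 1 ≤ Fintype.card K := Fintype.card_pos
  have hp2 : 2 ≤ ringChar K := (CharP.char_is_prime K _ : (ringChar K).Prime).two_le
  -- Beyond this bound 12 d²/q ≤ 1/2, so at least half of the forms are smooth.
  by_cases hqB : Fintype.card K ≤ D + 24 * D ^ 2
  · refine (h₀ K d hd (by omega) hqB).trans ?_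
    have : 0 ≤ α₁ + α₂ + α₃ + C * D := by positivity
    gcongr
    linarith
  refine (h K d (α₁ + α₂ + α₃) D ?_ hx).trans ?_
  swap
  · refine mul_le_mul_of_nonneg_right (mul_le_mul_of_nonneg_right
      (mul_le_mul_of_nonneg_right ?_ hx0) (by positivity)) hS0
    linarith
  have hqD : 24 * (D : ℝ) ^ 2 ≤ Fintype.card K := by
    exact_mod_cast (by omega : 24 * D ^ 2 ≤ Fintype.card K)
  have hdD' : (d : ℝ) ≤ D := by exact_mod_cast hdD
  have hG := prob_sing_le K hd
  have hd2 : 12 * (d : ℝ) ^ 2 ≤ 12 * D ^ 2 := by gcongr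
  have hS : 1 / 2 ≤ smoothProb K d := by
    have h1 := one_sub_le_smoothProb hG
    have h2 : 12 * (d : ℝ) ^ 2 / Fintype.card K ≤ 1 / 2 := by
      rw [div_le_div_iff₀ (by linarith) (by norm_num)]
      linarith
    linarith
  set x := relError k (Fintype.card K) (ringChar K) d with hxdef
  set q : ℝ := ((Fintype.card K : ℕ) : ℝ) with hqdef
  have hQ : 1 ≤ q ^ (k / 2) := one_le_pow₀ (by linarith)
  have key : ∀ α : ℝ, 0 ≤ α → |smoothAvg K k d| ≤ α * x * q ^ (k / 2) →
      |smoothAvg K k d| ≤ 2 * α * x * q ^ (k / 2) * smoothProb K d := fun α hα hA => by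
    have h1 : 0 ≤ α * x * q ^ (k / 2) := by positivity
    calc _ ≤ α * x * q ^ (k / 2) := hA
      _ = 2 * (α * x * q ^ (k / 2)) * (1 / 2) := by ring
      _ ≤ 2 * (α * x * q ^ (k / 2)) * smoothProb K d := by gcongr
      _ = _ := by ring
  have hmono : ∀ α : ℝ, α ≤ α₁ + α₂ + α₃ →
      α * x * q ^ (k / 2) * smoothProb K d ≤
        (α₁ + α₂ + α₃) * x * q ^ (k / 2) * smoothProb K d := fun α hα => by gcongr
  -- For d < k the trivial bound (2d + 2) q for the deviation is set against a large error term. For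
  -- k ≤ d < 2k - 1 an even moment of order k or k + 1 is available and loses at most a factor q,
  -- which is at most x. For d ≥ 2k - 1 the 2k-th moment and Cauchy-Schwarz apply.
  rcases Nat.lt_or_ge d k with hdk | hdk
  · refine le_trans ?_ (hmono α₁ (by linarith))
    refine (abs_smoothAvg_le_of_abs_dev_le (B := (2 * d + 2) * q) fun F hF hs =>
      abs_dev_le_mul (mem_forms.1 hF) hs).trans (mul_le_mul_of_nonneg_right ?_ hS0)
    have h1 := pow_le_relError_mul hqpos hd hdk hp2
    calc ((2 * (d : ℝ) + 2) * q) ^ k = (2 * d + 2) ^ k * q ^ k := mul_pow _ _ _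
      _ ≤ (2 * D + 2) ^ k * (2 * x * q ^ (k / 2)) := by gcongr
      _ = _ := by ring
  rcases Nat.lt_or_ge (d + 1) (2 * k) with hdk2 | hdk2
  · refine le_trans (key (1 + C₃) (by positivity) ?_) (hmono _ (by linarith))
    have h1 := abs_smoothAvg_le_one_add (K := K) (by omega : k ≤ 2 * ((k + 1) / 2)) d
    have h2 := (le_abs_self _).trans (h₃ K d (by omega))
    rw [Nat.mul_div_cancel_left _ (by norm_num)] at h2
    have h3 : q ≤ x := le_relError hqpos (by omega) (by omega)
    have h4 : (1 : ℝ) ≤ q ^ ((k + 1) / 2) := one_le_pow₀ (by linarith)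
    have h5 : q ^ ((k + 1) / 2) ≤ q * q ^ (k / 2) := by
      rw [← pow_succ']
      exact pow_le_pow_right₀ (by linarith) (by omega)
    calc |smoothAvg K k d| ≤ (1 + C₃) * q ^ ((k + 1) / 2) := by
          rw [add_mul, one_mul]
          linarith
      _ ≤ (1 + C₃) * (q * q ^ (k / 2)) := by gcongr
      _ ≤ (1 + C₃) * (x * q ^ (k / 2)) := by gcongr
      _ = _ := by ring
  · refine le_trans (key ((C₁ + √(C₂ * (12 * D ^ 2))) * D) (by positivity) ?_)
      (hmono _ (by rw [hα₂]; linarith))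
    have h1 := abs_avg_sub_smoothAvg_le (K := K) k d (p := fun _ => True)
      (b := fun F => ∃ v : Fin 3 → AlgebraicClosure K, Nrm v ∧ 1 ≤ deg K v ∧ SingAt F v)
      (fun F _ _ => trivial) (fun F hF _ => by
        by_cases hs : IsSmoothForm F
        · exact Or.inl hs
        · right
          rw [isSmoothForm_iff (mem_forms.1 hF)] at hs
          push Not at hs
          obtain ⟨v, hv, hs⟩ := hs
          exact ⟨v, hv, deg_pos v, hs⟩)
    have h2 : avg K d (fun F => dev K F ^ k * ind True) = avg K d fun F => dev K F ^ k :=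
      avg_congr fun F _ => by simp [ind]
    rw [h2] at h1
    have h3 := h₁ K d (by omega)
    have h4 := (le_abs_self _).trans (h₂ K d hdk2)
    rw [Nat.mul_div_cancel_left _ (by norm_num)] at h4
    have h5 : √(avg K d (fun F => dev K F ^ (2 * k)) * prob K d (fun F =>
        ∃ v : Fin 3 → AlgebraicClosure K, Nrm v ∧ 1 ≤ deg K v ∧ SingAt F v)) ≤
        √(C₂ * (12 * D ^ 2)) * q ^ (k / 2) := by
      refine Real.sqrt_le_iff.2 ⟨by positivity, ?_⟩
      rw [mul_pow, Real.sq_sqrt (by positivity)]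
      have e1 : q ^ k ≤ (q ^ (k / 2)) ^ 2 * q := by
        rw [← pow_mul, ← pow_succ]
        exact pow_le_pow_right₀ (by linarith) (by omega)
      calc _ ≤ C₂ * q ^ k * (12 * d ^ 2 / q) :=
            mul_le_mul h4 hG (prob_nonneg d _) (by positivity)
        _ ≤ C₂ * ((q ^ (k / 2)) ^ 2 * q) * (12 * D ^ 2 / q) := by gcongr
        _ = _ := by field_simp
    have h6 : |smoothAvg K k d| ≤ (C₁ + √(C₂ * (12 * D ^ 2))) * q ^ (k / 2) := by
      have e := abs_sub_abs_le_abs_sub (smoothAvg K k d) (avg K d fun F => dev K F ^ k)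
      rw [abs_sub_comm] at e
      rw [add_mul]
      linarith
    calc _ ≤ (C₁ + √(C₂ * (12 * D ^ 2))) * q ^ (k / 2) := h6
      _ ≤ (C₁ + √(C₂ * (12 * D ^ 2))) * q ^ (k / 2) * (D * x) :=
        le_mul_of_one_le_right (by positivity) hx
      _ = _ := by ring

/-- Since ⌊d/p⌋ = 0 and d ≥ c q, the error term is at least a multiple of q^k d²/q, hence of
q^(k+1). The extra factor q makes up for knowing only that smooth forms have probability at least
1/q. -/
theorem exists_abs_sub_le_of_degree_lt_card (k : ℕ) {c : ℝ} (hc : 0 < c) : ∃ C : ℝ, 0 ≤ C ∧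
    ∀ (K : Type*) [Field K] [Fintype K] (d : ℕ), 10 ≤ d → 2 * k ≤ d + 1 → d < ringChar K →
      Fintype.card K = ringChar K → c * Fintype.card K ≤ d →
      |smoothAvg K k d - modelMoment (Fintype.card K) k * smoothProb K d| ≤
        C * relError k (Fintype.card K) (ringChar K) d *
          (Fintype.card K : ℝ) ^ (k / 2) * smoothProb K d := by
  obtain ⟨C, hC, h⟩ := exists_abs_sub_le_of_abs_smoothAvg_le k
  obtain ⟨C₁, hC₁, h₁⟩ := exists_abs_avg_dev_pow_le (2 * k)
  refine ⟨(1 + C₁) * (2 / c ^ 2) + C * (2 / c ^ 2), by positivity,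
    fun K _ _ d hd hdk hdp hqp hcd => ?_⟩
  have hp : Fact (ringChar K).Prime := ⟨CharP.char_is_prime K _⟩
  have hq2 := two_le_card_real (K := K)
  have hS := inv_card_le_prob_smooth K (ringChar K) (by omega) hdp (by omega)
  rw [prob_smooth_eq] at hS
  have h2 := sq_div_le_relError (k := k) (q := Fintype.card K) (p := ringChar K) (d := d)
    Fintype.card_pos
  rw [Nat.div_eq_of_lt hdp, zero_add, pow_one] at h2
  have hx0 := relError_nonneg (k := k) (q := Fintype.card K) (p := ringChar K) (d := d)
  have h3 := abs_smoothAvg_le_one_add (K := K) (le_of_eq_of_le (one_mul k).symm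
    (Nat.mul_le_mul_right k (by norm_num))) d
  have h4 := (le_abs_self _).trans (h₁ K d hdk)
  rw [Nat.mul_div_cancel_left _ (by norm_num)] at h4
  have hS0 := smoothProb_nonneg (K := K) d
  specialize h K d ((1 + C₁) * (2 / c ^ 2)) (2 / c ^ 2)
  set x := relError k (Fintype.card K) (ringChar K) d with hxdef
  set q : ℝ := ((Fintype.card K : ℕ) : ℝ) with hqdef
  have h5 : q ^ k * q ≤ 2 / c ^ 2 * x := by
    have e1 : (c * q) ^ 2 ≤ (d : ℝ) ^ 2 := by gcongr
    have e2 : q ^ k * (c ^ 2 * q) ≤ 2 * x := by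
      refine le_trans ?_ h2
      have : c ^ 2 * q = (c * q) ^ 2 / q := by field_simp
      rw [this]
      gcongr
    rw [div_mul_eq_mul_div, le_div_iff₀ (by positivity)]
    linarith
  have hqk : 1 ≤ q ^ k := one_le_pow₀ (by linarith)
  refine h ?_ (le_trans ?_ h5)
  · have hQ : 1 ≤ q ^ (k / 2) := one_le_pow₀ (by linarith)
    have hqS : 1 ≤ q * smoothProb K d := by
      rwa [div_le_iff₀ (by linarith), mul_comm] at hS
    calc |smoothAvg K k d| ≤ (1 + C₁) * q ^ k := by
          rw [add_mul, one_mul]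
          linarith
      _ ≤ (1 + C₁) * q ^ k * (q * smoothProb K d) :=
          le_mul_of_one_le_right (by positivity) hqS
      _ = (1 + C₁) * (q ^ k * q) * smoothProb K d := by ring
      _ ≤ (1 + C₁) * (2 / c ^ 2 * x) * smoothProb K d := by gcongr
      _ ≤ (1 + C₁) * (2 / c ^ 2 * x) * smoothProb K d * q ^ (k / 2) :=
          le_mul_of_one_le_right (by positivity) hQ
      _ = _ := by ring
  · exact one_le_mul_of_one_le_of_one_le hqk (by linarith)

theorem exists_abs_sub_le (k : ℕ) (hk : 1 ≤ k) : ∃ C : ℝ, 0 ≤ C ∧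
    ∀ (K : Type*) [Field K] [Fintype K] (d : ℕ), 1 ≤ d →
      |smoothAvg K k d - modelMoment (Fintype.card K) k * smoothProb K d| ≤
        C * relError k (Fintype.card K) (ringChar K) d *
          (Fintype.card K : ℝ) ^ (k / 2) * smoothProb K d := by
  set c := Real.exp (-4) with hcdef
  have hc : 0 < c := Real.exp_pos _
  have hc24 : 0 < c / 24 := by positivity
  -- For d ≥ N the term (2 e⁴ + 5)/d is at most c/4. With 6 · c/24 = c/4 from the case distinction
  -- below, smooth forms then have probability at least c/2.
  obtain ⟨N, hN⟩ := exists_nat_gt ((2 * Real.exp 4 + 5) * (4 / c))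
  obtain ⟨C₁, hC₁, h₁⟩ := exists_abs_sub_le_of_degree_lt k (2 ^ (2 * k + 12) + N)
  obtain ⟨C₂, hC₂, h₂⟩ := exists_sieve_estimate k hk
  obtain ⟨B, hB⟩ := exists_bound_of_le_mul hc24
  obtain ⟨C₃, hC₃, h₃⟩ := exists_abs_sub_le_of_le k B
  obtain ⟨C₄, hC₄, h₄⟩ := exists_abs_sub_le_of_degree_lt_card k hc24
  refine ⟨C₁ + C₂ * (2 / c) + C₃ + C₄, by positivity, fun K _ _ d hd => ?_⟩
  have hx0 := relError_nonneg (k := k) (q := Fintype.card K) (p := ringChar K) (d := d)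
  have hS0 := smoothProb_nonneg (K := K) d
  have hmono : ∀ C : ℝ, C ≤ C₁ + C₂ * (2 / c) + C₃ + C₄ →
      C * relError k (Fintype.card K) (ringChar K) d *
        (Fintype.card K : ℝ) ^ (k / 2) * smoothProb K d ≤
      (C₁ + C₂ * (2 / c) + C₃ + C₄) * relError k (Fintype.card K) (ringChar K) d *
        (Fintype.card K : ℝ) ^ (k / 2) * smoothProb K d := fun C hC => by gcongr
  have hC₂' : 0 ≤ C₂ * (2 / c) := by positivity
  by_cases hdD : d ≤ 2 ^ (2 * k + 12) + N
  · exact (h₁ K d hd hdD).trans (hmono _ (by linarith))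
  have hd0 : (0 : ℝ) < d := by exact_mod_cast hd
  by_cases hdq : c / 24 * (Fintype.card K : ℝ) ^ (d / ringChar K + 1) ≤ d
  · obtain ⟨n, hp, hn⟩ := FiniteField.card K (ringChar K)
    rcases hB (ringChar K) n d hp.two_le n.pos (by rwa [← hn]) with ⟨h1, hdp⟩ | ⟨h1, h2⟩
    · have hqp : Fintype.card K = ringChar K := by rw [hn, h1, pow_one]
      have hpow : 2 * k + 12 < 2 ^ (2 * k + 12) := Nat.lt_two_pow_self
      rw [Nat.div_eq_of_lt hdp, zero_add, pow_one] at hdq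
      exact (h₄ K d (by omega) (by omega) hdp hqp hdq).trans (hmono _ (by linarith))
    · exact (h₃ K d hd h2 (by rwa [hn])).trans (hmono _ (by linarith))
  · obtain ⟨h1, h2⟩ := h₂ K d (by omega)
    refine le_trans ?_ (hmono (C₂ * (2 / c)) (by linarith))
    have hNd : (N : ℝ) ≤ d := by exact_mod_cast (Nat.le_add_left N _).trans (not_le.1 hdD).le
    have e1 : (2 * Real.exp 4 + 5) / d ≤ c / 4 := by
      rw [div_le_iff₀ hd0]
      have : (2 * Real.exp 4 + 5) * (4 / c) * (c / 4) = 2 * Real.exp 4 + 5 := by field_simp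
      nlinarith
    have hq := two_le_card_real (K := K)
    have e2 : (d : ℝ) / (Fintype.card K : ℝ) ^ (d / ringChar K + 1) ≤ c / 24 := by
      rw [div_le_iff₀ (by positivity)]
      exact (not_le.1 hdq).le
    have hS : c / 2 ≤ smoothProb K d := by linarith
    have hS1 : 1 ≤ 2 / c * smoothProb K d := by
      rw [div_mul_eq_mul_div, le_div_iff₀ hc]
      linarith
    calc _ ≤ C₂ * relError k (Fintype.card K) (ringChar K) d * (Fintype.card K : ℝ) ^ (k / 2) := h1
      _ ≤ C₂ * relError k (Fintype.card K) (ringChar K) d * (Fintype.card K : ℝ) ^ (k / 2) *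
          (2 / c * smoothProb K d) := le_mul_of_one_le_right (by positivity) hS1
      _ = _ := by ring

end Uniform

end PlaneCurves

/-! ### Conclusion -/

theorem theorem2 (k : ℕ) (hk : 1 ≤ k) :
    ∃ C : ℝ, ∀ (K : Type*) [Field K] [Fintype K] (d : ℕ), 1 ≤ d →
      ∀ (Ω : Type*) [MeasurableSpace Ω] (μ : Measure Ω) [IsProbabilityMeasure μ]
        (X : Fin (Fintype.card K ^ 2 + Fintype.card K + 1) → Ω → ℝ),
        PlaneCurves.IsPointModel (Fintype.card K) μ X →
        (2 ≤ k → ∃ δ : ℝ,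
          |δ| ≤ C * PlaneCurves.errorTerm k (Fintype.card K) (ringChar K) d ∧
          PlaneCurves.smoothMoment K k d =
            (∫ ω, (1 / √((Fintype.card K : ℝ) + 1) *
              ((∑ i, X i ω) - ((Fintype.card K : ℝ) + 1))) ^ k ∂μ) * (1 + δ)) ∧
        (k = 1 →
          |PlaneCurves.smoothMoment K k d -
            ∫ ω, (1 / √((Fintype.card K : ℝ) + 1) *
              ((∑ i, X i ω) - ((Fintype.card K : ℝ) + 1))) ^ k ∂μ| ≤
            C * PlaneCurves.errorTerm k (Fintype.card K) (ringChar K) d) := by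
  obtain ⟨C, hC, h⟩ := PlaneCurves.exists_abs_sub_le k hk
  obtain ⟨c, hc, hm⟩ := PlaneCurves.exists_le_modelMoment k
  -- C / c serves k ≥ 2, C serves k = 1, and k^k is the cost of the minimum in the exponent of the
  -- error term.
  refine ⟨(C / c + C) * k ^ k, fun K _ _ d hd Ω _ μ _ X hX => ?_⟩
  have hq : 2 ≤ Fintype.card K := Fintype.one_lt_card
  have hq' : (2 : ℝ) ≤ Fintype.card K := by exact_mod_cast hq
  have hint : ∫ ω, (1 / √((Fintype.card K : ℝ) + 1) *
      ((∑ i, X i ω) - ((Fintype.card K : ℝ) + 1))) ^ k ∂μ =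
      PlaneCurves.modelMoment (Fintype.card K) k / √((Fintype.card K : ℝ) + 1) ^ k := by
    simp only [mul_pow]
    rw [integral_const_mul, PlaneCurves.integral_model_eq μ hX k, one_div, inv_pow,
      inv_mul_eq_div]
  have hx0 := PlaneCurves.relError_nonneg (k := k) (q := Fintype.card K) (p := ringChar K) (d := d)
  have hE := PlaneCurves.relError_le_errorTerm (p := ringChar K) (d := d) hk hq
  have hS := PlaneCurves.smoothProb_pos (K := K) hd
  have hB := h K d hd
  have hR : 1 ≤ √((Fintype.card K : ℝ) + 1) := Real.one_le_sqrt.2 (by linarith)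
  have hRk : 0 < √((Fintype.card K : ℝ) + 1) ^ k := by positivity
  have hratio : |PlaneCurves.smoothAvg K k d / PlaneCurves.smoothProb K d -
      PlaneCurves.modelMoment (Fintype.card K) k| ≤
      C * PlaneCurves.relError k (Fintype.card K) (ringChar K) d *
        (Fintype.card K : ℝ) ^ (k / 2) := by
    rw [div_sub' hS.ne', abs_div, abs_of_pos hS, div_le_iff₀ hS, mul_comm (PlaneCurves.smoothProb K d)]
    exact hB
  have hbound : ∀ D : ℝ, 0 ≤ D → D ≤ C / c + C →
      D * PlaneCurves.relError k (Fintype.card K) (ringChar K) d ≤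
        (C / c + C) * k ^ k * PlaneCurves.errorTerm k (Fintype.card K) (ringChar K) d :=
    fun D h0 h1 => by
      rw [mul_assoc]
      exact mul_le_mul h1 hE hx0 (by positivity)
  rw [hint, PlaneCurves.smoothMoment_eq]
  have hCc : 0 ≤ C / c := by positivity
  constructor
  · intro hk2
    have hM := hm (Fintype.card K) hq hk2
    have hQ : 0 < (Fintype.card K : ℝ) ^ (k / 2) := by positivity
    have hM0 : 0 < PlaneCurves.modelMoment (Fintype.card K) k := lt_of_lt_of_le (by positivity) hM
    refine ⟨(PlaneCurves.smoothAvg K k d / PlaneCurves.smoothProb K d -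
      PlaneCurves.modelMoment (Fintype.card K) k) / PlaneCurves.modelMoment (Fintype.card K) k,
      le_trans ?_ (hbound (C / c) hCc (by linarith)), ?_⟩
    · rw [abs_div, abs_of_pos hM0, div_le_iff₀ hM0]
      refine hratio.trans ?_
      calc _ = C / c * PlaneCurves.relError k (Fintype.card K) (ringChar K) d *
            (c * (Fintype.card K : ℝ) ^ (k / 2)) := by field_simp
        _ ≤ _ := by gcongr
    · field_simp
      ring
  · rintro rfl
    rw [pow_one, ← sub_div, abs_div, abs_of_pos (by linarith : 0 < √((Fintype.card K : ℝ) + 1))]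
    refine (div_le_self (abs_nonneg _) hR).trans (hratio.trans ?_)
    rw [Nat.div_eq_of_lt (by norm_num), pow_zero, mul_one]
    exact hbound C hC (by linarith)
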